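/- **Setting.** Let $d\in\{1,2\}$, $T>0$, and let $\Omega\subset\mathbb R^d$ be a bounded Lipschitz domain, $Q_T=\Omega\times(0,T)$. For $t\in[0,T]$ let $\Omega_1(t),\Omega_2(t)\subset\Omega$ be disjoint open sets with common boundary (interface) $\Gamma(t)=\partial\Omega_1(t)\cap\partial\Omega_2(t)$ such that $\Omega=\Omega_1(t)\cup\Gamma(t)\cup\Omega_2(t)$ and $\Gamma(t)\cap\partial\Omega=\varnothing$; assume that $Q_i=\bigcup_{t\in(0,T)}\Omega_i(t)\times\{t\}$ $(i=1,2)$ is open and that $\Gamma^*=\bigcup_{t\in(0,T)}\Gamma(t)\times\{t\}$ is a $C^2$ hypersurface of $\mathbb R^{d+1}$. Let $\mathbf v\in C([0,T],C^2(\Omega)^d)$, where $C^2(\Omega)$ denotes the functions bounded together with their derivatives up to order two, satisfy $\nabla\cdot\mathbf v=0$ in $\Omega\times[0,T]$, and let $\Gamma(t)$ be transported by $\mathbf v$. Let $\kappa=\kappa_i>0$ (constants) in $Q_i$, let $\ell\in L^\infty(Q_T)$ with $\ell\ge L$ a.e. for some constant $L>0$, let $\omega$ be a nonempty open set with $\omega\subset\Omega_2(t)$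 for all $t\in[0,T]$, and $\omega_T=\omega\times(0,T)$. Let $z\in L^2(\omega_T)$ (the noisy data $z_d^\varepsilon$) be arbitrary and $\lambda>0$. Let $Y=H^{1,0}_0(Q_T)$ be the closure of $C^1_c(Q_T)$ for the norm $(\|v\|_{L^2(Q_T)}^2+\|\nabla v\|_{L^2(Q_T)}^2)^{1/2}$, where $\nabla$ is the gradient in the space variable, $Y'$ its dual with pairing $\langle\cdot,\cdot\rangle$, $X=\{v\in Y:\partial_t v\in Y'\}$, $X_0=\{v\in X: v(\cdot,0)=0\}$ and $X_T=\{v\in X: v(\cdot,T)=0\}$, the values at $t=0,T$ being those of the representative in $C([0,T],L^2(\Omega))$. For $u,p\in X$ and $\varphi,\phi\in Y$ put $$a(u,\varphi)=\langle\partial_t u,\varphi\rangle+\int_{Q_T}(\mathbf v\cdot\nabla u)\varphi+\kappa\nabla u\cdot\nabla\varphi,\qquad a'(p,\phi)=-\langle\partial_t p,\phi\rangle+\int_{Q_T}-(\mathbf v\cdot\nabla p)\phi+\kappa\nabla p\cdot\nabla\phi .$$ Let $F_+=\{f\in L^2(Q_T): f\ge 0\text{ a.e.}\}$. For $f\in L^2(Q_T)$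 the state $u(f)\in X_0$ is the solution of $a(u(f),\varphi)=(\ell f,\varphi)_{L^2(Q_T)}$ for all $\varphi\in Y$. For $u\in X_0$ the adjoint is the solution $p\in X_T$ of $a'(p,\phi)=(\chi_{\omega_T}(u-z),\phi)_{L^2(Q_T)}$ for all $\phi\in Y$. Consider the problem $$\min_{f\in F_+}\ \tfrac12\|u(f)-z\|^2_{L^2(\omega_T)}+\tfrac\lambda2\|f\|^2_{L^2(Q_T)}.\tag{P}$$ **Theorem.** Every $f\in L^2(Q_T)$ has exactly one state, every $u\in X_0$ has exactly one adjoint, and (P) has a unique solution $f_\lambda^\varepsilon\in F_+$. Together with its state $u_\lambda^\varepsilon\in X_0$ and the adjoint $p_\lambda^\varepsilon\in X_T$ of $u_\lambda^\varepsilon$, it satisfies $$a(u_\lambda^\varepsilon,\varphi)=(\ell f_\lambda^\varepsilon,\varphi)_{L^2(Q_T)}\quad\forall\varphi\in Y,$$ $$a'(p_\lambda^\varepsilon,\phi)=(\chi_{\omega_T}(u_\lambda^\varepsilon-z),\phi)_{L^2(Q_T)}\quad\forall\phi\in Y,$$ $$(\ell p_\lambda^\varepsilon+\lambda f_\lambda^\varepsilon,\,g-f_\lambda^\varepsilon)_{L^2(Q_T)}\ge0\quad\forall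 g\in F_+ .$$ The last inequality is equivalent to the projection formula $f_\lambda^\varepsilon=\max\{0,-\tfrac1\lambda\,\ell p_\lambda^\varepsilon\}$ a.e. in $Q_T$; in particular this formula holds. More precisely, for all $f\in F_+$ and $p\in X_T$, the inequality $(\ell p+\lambda f,g-f)_{L^2(Q_T)}\ge0$ for all $g\in F_+$ holds if and only if $f=\max\{0,-\tfrac1\lambda\,\ell p\}$ a.e. in $Q_T$. -/

import Mathlib

open MeasureTheory Set Topology
open scoped NNReal ENNReal RealInnerProductSpace

noncomputable section

namespace InverseSource

/-- The space `ℝ^d` with the Euclidean norm. -/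
abbrev Space (d : ℕ) : Type := EuclideanSpace ℝ (Fin d)

/-- Space-time `ℝ^d × ℝ`; a point is `(x, t)`. -/
abbrev SpaceTime (d : ℕ) : Type := Space d × ℝ

/-! ### Geometry -/

/-- Lipschitz domain: a nonempty connected open set which near each of its boundary points is the
strict subgraph, in some unit direction `e`, of a Lipschitz function of the variables orthogonal
to `e` (that is, of a Lipschitz function that is invariant under translation along `e`). -/
def IsLipschitzDomain {d : ℕ} (Ω : Set (Space d)) : Prop :=
  IsOpen Ω ∧ IsConnected Ω ∧
    ∀ x ∈ frontier Ω, ∃ (e : Space d) (K : ℝ≥0) (γ : Space d → ℝ) (U : Set (Space d)),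
      ‖e‖ = 1 ∧ LipschitzWith K γ ∧ (∀ (y : Space d) (s : ℝ), γ (y + s • e) = γ y) ∧
        IsOpen U ∧ x ∈ U ∧ Ω ∩ U = {y | y ∈ U ∧ ⟪y, e⟫ < γ y}

/-- `C²`-regular hypersurface of space-time: locally the zero set of a `C²` function with
nonvanishing differential. -/
def IsC2Hypersurface {d : ℕ} (M : Set (SpaceTime d)) : Prop :=
  ∀ z ∈ M, ∃ (U : Set (SpaceTime d)) (ψ : SpaceTime d → ℝ), IsOpen U ∧ z ∈ U ∧
    ContDiffOn ℝ 2 ψ U ∧ (∀ y ∈ U, fderiv ℝ ψ y ≠ 0) ∧ M ∩ U = {y | y ∈ U ∧ ψ y = 0}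

/-- The velocity field `v` belongs to `C([0,T], C²(Ω))`, where `C²(Ω)` is the space of `C²` fields
on `Ω` that are bounded together with their derivatives up to order two, with the sup norm of
these derivatives. -/
def IsContinuousC2Field {d : ℕ} (Ω : Set (Space d)) (T : ℝ) (v : Space d → ℝ → Space d) : Prop :=
  (∀ t ∈ Icc 0 T, ContDiffOn ℝ 2 (fun x => v x t) Ω) ∧
  (∀ t ∈ Icc 0 T, ∃ C : ℝ, ∀ k ≤ 2, ∀ x ∈ Ω, ‖iteratedFDeriv ℝ k (fun y => v y t) x‖ ≤ C) ∧
  (∀ t ∈ Icc 0 T, ∀ ε > 0, ∃ δ > 0, ∀ s ∈ Icc 0 T, |s - t| < δ → ∀ k ≤ 2, ∀ x ∈ Ω,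
    ‖iteratedFDeriv ℝ k (fun y => v y s) x - iteratedFDeriv ℝ k (fun y => v y t) x‖ ≤ ε)

/-- The (spatial) divergence of a vector field on `ℝ^d`. -/
def divergence {d : ℕ} (w : Space d → Space d) (x : Space d) : ℝ :=
  ∑ i : Fin d, (fderiv ℝ w x (EuclideanSpace.single i 1)) i

/-- The interface between two subdomains: their common boundary. -/
def interface {d : ℕ} (A B : Set (Space d)) : Set (Space d) := frontier A ∩ frontier B

/-- The sets `Γ t`, `t ∈ [0,T]`, are transported by the velocity field `v`: `Γ t` consists of
the positions at time `t` of the particles that start on `Γ 0` and move with velocity `v`. -/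
def IsTransportedBy {d : ℕ} (Ω : Set (Space d)) (T : ℝ) (v : Space d → ℝ → Space d)
    (Γ : ℝ → Set (Space d)) : Prop :=
  ∃ Φ : ℝ → Space d → Space d,
    (∀ x ∈ Γ 0, Φ 0 x = x ∧ ∀ t ∈ Icc 0 T, Φ t x ∈ Ω ∧
      HasDerivWithinAt (fun s => Φ s x) (v (Φ t x) t) (Icc 0 T) t) ∧
    ∀ t ∈ Icc 0 T, Γ t = Φ t '' Γ 0

/-! ### The data of the advection-diffusion problem with moving subdomains -/

/-- The set `⋃_{t ∈ (0,T)} A t × {t}`. -/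
def sweep {d : ℕ} (T : ℝ) (A : ℝ → Set (Space d)) : Set (SpaceTime d) :=
  {z | z.2 ∈ Ioo 0 T ∧ z.1 ∈ A z.2}

/-- The space-time cylinder `Ω × (0,T)`. -/
def cylinder {d : ℕ} (Ω : Set (Space d)) (T : ℝ) : Set (SpaceTime d) := Ω ×ˢ Ioo 0 T

/-- The data of the problem and the standing assumptions on them. -/
structure Setting (d : ℕ) where
  /-- the final time -/
  T : ℝ
  T_pos : 0 < T
  /-- the spatial domain -/
  Ω : Set (Space d)
  isLipschitzDomain : IsLipschitzDomain Ω
  isBounded : Bornology.IsBounded Ω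
  /-- the first moving subdomain -/
  Ω₁ : ℝ → Set (Space d)
  /-- the second moving subdomain -/
  Ω₂ : ℝ → Set (Space d)
  isOpen_Ω₁ : ∀ t ∈ Icc 0 T, IsOpen (Ω₁ t)
  isOpen_Ω₂ : ∀ t ∈ Icc 0 T, IsOpen (Ω₂ t)
  disjoint_Ω : ∀ t ∈ Icc 0 T, Disjoint (Ω₁ t) (Ω₂ t)
  split_Ω : ∀ t ∈ Icc 0 T, Ω = Ω₁ t ∪ interface (Ω₁ t) (Ω₂ t) ∪ Ω₂ t
  interface_boundary : ∀ t ∈ Icc 0 T, interface (Ω₁ t) (Ω₂ t) ∩ frontier Ω = ∅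
  isOpen_Q₁ : IsOpen (sweep T Ω₁)
  isOpen_Q₂ : IsOpen (sweep T Ω₂)
  interface_C2 : IsC2Hypersurface (sweep T fun t => interface (Ω₁ t) (Ω₂ t))
  /-- the velocity field `v(x, t)` -/
  v : Space d → ℝ → Space d
  v_regular : IsContinuousC2Field Ω T v
  v_incompressible : ∀ t ∈ Icc 0 T, ∀ x ∈ Ω, divergence (fun y => v y t) x = 0
  v_transport : IsTransportedBy Ω T v fun t => interface (Ω₁ t) (Ω₂ t)
  /-- the diffusion coefficient in the first subdomain -/
  κ₁ : ℝ
  /-- the diffusion coefficient in the second subdomain -/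
  κ₂ : ℝ
  κ₁_pos : 0 < κ₁
  κ₂_pos : 0 < κ₂
  /-- the observation subdomain -/
  ω : Set (Space d)
  isOpen_ω : IsOpen ω
  nonempty_ω : ω.Nonempty
  ω_subset : ∀ t ∈ Icc 0 T, ω ⊆ Ω₂ t
  /-- the known factor of the source -/
  ℓ : SpaceTime d → ℝ
  ℓ_bounded : MemLp ℓ ∞ (volume.restrict (cylinder Ω T))
  ℓ_lower : ∃ L > 0, ∀ᵐ z ∂(volume.restrict (cylinder Ω T)), L ≤ ℓ z

/-! ### Test functions -/

/-- The spatial gradient of a function on space-time. -/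
def spatialGradient {d : ℕ} (φ : SpaceTime d → ℝ) (z : SpaceTime d) : Space d :=
  gradient (fun x => φ (x, z.2)) z.1

/-- The time derivative of a function on space-time. -/
def timeDerivative {d : ℕ} (φ : SpaceTime d → ℝ) (z : SpaceTime d) : ℝ :=
  deriv (fun s => φ (z.1, s)) z.2

/-- `C¹` functions with compact support contained in `Q`. -/
def testFunctions {d : ℕ} (Q : Set (SpaceTime d)) : Submodule ℝ (SpaceTime d → ℝ) where
  carrier := {φ | ContDiff ℝ 1 φ ∧ HasCompactSupport φ ∧ tsupport φ ⊆ Q}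
  zero_mem' := by
    refine ⟨contDiff_const, HasCompactSupport.zero, ?_⟩
    simp [tsupport]
  add_mem' := by
    rintro φ ψ ⟨h1, h2, h3⟩ ⟨k1, k2, k3⟩
    exact ⟨h1.add k1, h2.add k2, (tsupport_add φ ψ).trans (union_subset h3 k3)⟩
  smul_mem' := by
    rintro c φ ⟨h1, h2, h3⟩
    exact ⟨contDiff_const.smul h1, h2.smul_left (f := fun _ => c),
      (tsupport_smul_subset_right (fun _ => c) φ).trans h3⟩

theorem hasGradientAt_slice {d : ℕ} {φ : SpaceTime d → ℝ} (h : ContDiff ℝ 1 φ) (z : SpaceTime d) :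
    HasGradientAt (fun x => φ (x, z.2)) (spatialGradient φ z) z.1 := by
  have h1 : Differentiable ℝ φ := h.differentiable (by norm_num)
  have h2 : DifferentiableAt ℝ (fun x : Space d => φ (x, z.2)) z.1 := by fun_prop
  exact h2.hasGradientAt

theorem spatialGradient_eq {d : ℕ} {φ : SpaceTime d → ℝ} (h : ContDiff ℝ 1 φ) (z : SpaceTime d) :
    spatialGradient φ z = (InnerProductSpace.toDual ℝ (Space d)).symm
      ((fderiv ℝ φ z).comp (ContinuousLinearMap.inl ℝ (Space d) ℝ)) := by
  have h1 : HasFDerivAt φ (fderiv ℝ φ (z.1, z.2)) (z.1, z.2) :=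
    ((h.differentiable (by norm_num)) _).hasFDerivAt
  have h2 : HasFDerivAt (fun x : Space d => φ (x, z.2))
      ((fderiv ℝ φ z).comp (ContinuousLinearMap.inl ℝ (Space d) ℝ)) z.1 :=
    h1.comp z.1 (hasFDerivAt_prodMk_left z.1 z.2)
  rw [spatialGradient, gradient, h2.fderiv]

theorem continuous_spatialGradient {d : ℕ} {φ : SpaceTime d → ℝ} (h : ContDiff ℝ 1 φ) :
    Continuous (spatialGradient φ) := by
  have h1 : Continuous (fderiv ℝ φ) := h.continuous_fderiv (by norm_num)
  have h2 : spatialGradient φ = fun z => (InnerProductSpace.toDual ℝ (Space d)).symm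
      ((fderiv ℝ φ z).comp (ContinuousLinearMap.inl ℝ (Space d) ℝ)) :=
    funext (spatialGradient_eq h)
  rw [h2]
  exact (InnerProductSpace.toDual ℝ (Space d)).symm.continuous.comp (h1.clm_comp continuous_const)

theorem hasCompactSupport_spatialGradient {d : ℕ} {φ : SpaceTime d → ℝ} (h : ContDiff ℝ 1 φ)
    (hc : HasCompactSupport φ) : HasCompactSupport (spatialGradient φ) := by
  refine (hc.fderiv (𝕜 := ℝ)).mono fun z hz => ?_
  rw [Function.mem_support] at hz ⊢
  intro h0
  apply hz
  rw [spatialGradient_eq h, h0]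
  simp

/-! ### Function spaces -/

/-- `L²(A)` for a set `A` of points of space-time or of space. -/
abbrev L2 {α : Type*} [MeasureSpace α] (A : Set α) : Type _ := Lp ℝ 2 (volume.restrict A)

/-- `L²(Q)` for vector fields with values in `ℝ^d`. -/
abbrev L2Vec {d : ℕ} (Q : Set (SpaceTime d)) : Type := Lp (Space d) 2 (volume.restrict Q)

/-- The Hilbert space `L²(Q) × L²(Q)^d`. The space `H^{1,0}(Q)` is identified with the subspace of
the pairs `(v, ∇v)`; the norm of a pair is then the `H^{1,0}`-norm of `v`. -/
abbrev FunGrad {d : ℕ} (Q : Set (SpaceTime d)) : Type := WithLp 2 (L2 Q × L2Vec Q)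

/-- The map `φ ↦ (φ, ∇φ)` on test functions. -/
def testEmbedding {d : ℕ} (Q : Set (SpaceTime d)) : testFunctions Q →ₗ[ℝ] FunGrad Q where
  toFun φ := WithLp.toLp 2
    (MemLp.toLp (φ : SpaceTime d → ℝ)
        (φ.2.1.continuous.memLp_of_hasCompactSupport φ.2.2.1),
      MemLp.toLp (spatialGradient (φ : SpaceTime d → ℝ))
        ((continuous_spatialGradient φ.2.1).memLp_of_hasCompactSupport
          (hasCompactSupport_spatialGradient φ.2.1 φ.2.2.1)))
  map_add' φ ψ := by
    rw [← WithLp.toLp_add, Prod.mk_add_mk, ← MemLp.toLp_add, ← MemLp.toLp_add]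
    congr 3
    funext z
    refine HasGradientAt.unique (hasGradientAt_slice (φ + ψ).2.1 z) ?_
    have h1 := (hasGradientAt_slice φ.2.1 z).hasFDerivAt.add
      (hasGradientAt_slice ψ.2.1 z).hasFDerivAt
    rw [← map_add] at h1
    exact h1
  map_smul' c φ := by
    rw [RingHom.id_apply, ← WithLp.toLp_smul, Prod.smul_mk, ← MemLp.toLp_const_smul,
      ← MemLp.toLp_const_smul]
    congr 3
    funext z
    refine HasGradientAt.unique (hasGradientAt_slice (c • φ).2.1 z) ?_
    have h1 := (hasGradientAt_slice φ.2.1 z).hasFDerivAt.const_smul c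
    have h2 : c • InnerProductSpace.toDual ℝ (Space d) (spatialGradient (φ : SpaceTime d → ℝ) z) =
        InnerProductSpace.toDual ℝ (Space d)
          (c • spatialGradient (φ : SpaceTime d → ℝ) z) := by
      ext w
      simp
    rw [h2] at h1
    exact h1

/-- The space `Y = H^{1,0}_0(Q)`: the closure of the test functions in `H^{1,0}(Q)`. An element is
the pair `(v, ∇v)`. -/
def Y {d : ℕ} (Q : Set (SpaceTime d)) : Submodule ℝ (FunGrad Q) :=
  (LinearMap.range (testEmbedding Q)).topologicalClosure

/-- A test function as an element of `Y`. -/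
def testY {d : ℕ} {Q : Set (SpaceTime d)} (φ : testFunctions Q) : Y Q :=
  ⟨testEmbedding Q φ, Submodule.le_topologicalClosure _ (LinearMap.mem_range_self _ φ)⟩

/-- The function underlying an element of `Y`. -/
def fnY {d : ℕ} {Q : Set (SpaceTime d)} (y : Y Q) : L2 Q := y.1.fst

/-- The gradient of an element of `Y`. -/
def gradY {d : ℕ} {Q : Set (SpaceTime d)} (y : Y Q) : L2Vec Q := y.1.snd

/-- The dual space `Y'`; the duality pairing is application. -/
abbrev YDual {d : ℕ} (Q : Set (SpaceTime d)) : Type := Y Q →L[ℝ] ℝ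

/-- `ζ ∈ Y'` is the weak time derivative of `y`. -/
def IsTimeDerivative {d : ℕ} {Q : Set (SpaceTime d)} (y : Y Q) (ζ : YDual Q) : Prop :=
  ∀ φ : testFunctions Q,
    ζ (testY φ) = -∫ z in Q, fnY y z * timeDerivative (φ : SpaceTime d → ℝ) z

/-- The space `X = {v ∈ Y | ∂ₜ v ∈ Y'}`. An element is `v` together with its time derivative (which
is determined by `v`, since test functions are dense in `Y`). -/
def X {d : ℕ} (Q : Set (SpaceTime d)) : Type := {u : Y Q × YDual Q // IsTimeDerivative u.1 u.2}

/-- An element of `X` as an element of `Y`. -/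
def X.toY {d : ℕ} {Q : Set (SpaceTime d)} (u : X Q) : Y Q := u.1.1

/-- The function underlying an element of `X`. -/
def X.fn {d : ℕ} {Q : Set (SpaceTime d)} (u : X Q) : L2 Q := fnY u.toY

/-- The spatial gradient of an element of `X`. -/
def X.grad {d : ℕ} {Q : Set (SpaceTime d)} (u : X Q) : L2Vec Q := gradY u.toY

/-- The time derivative of an element of `X`. -/
def X.dt {d : ℕ} {Q : Set (SpaceTime d)} (u : X Q) : YDual Q := u.1.2

/-- `u(·, t₀) = w` in `L²(Ω)`, for the representative of `u` in `C([0,T], L²(Ω))`. -/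
def HasTimeTrace {d : ℕ} {Ω : Set (Space d)} {T : ℝ} (u : X (cylinder Ω T)) (t₀ : ℝ)
    (w : L2 Ω) : Prop :=
  ∃ V : ℝ → L2 Ω, ContinuousOn V (Icc 0 T) ∧
    (∀ᵐ t ∂(volume.restrict (Ioo 0 T)), ∀ᵐ x ∂(volume.restrict Ω), V t x = u.fn (x, t)) ∧
    V t₀ = w

/-! ### The state equation, the adjoint equation and the regularized problem -/

namespace Setting

variable {d : ℕ} (S : Setting d)

/-- The space-time domain `Q_T`. -/
def Q : Set (SpaceTime d) := cylinder S.Ω S.T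

/-- The observation set `ω_T = ω × (0,T)`. -/
def ωT : Set (SpaceTime d) := cylinder S.ω S.T

open Classical in
/-- The diffusion coefficient: `κ₁` in `Q₁` and `κ₂` in `Q₂` (the value on the interface, a
null set, is immaterial). -/
def κ (z : SpaceTime d) : ℝ := if z ∈ sweep S.T S.Ω₁ then S.κ₁ else S.κ₂

/-- `X₀ = {u ∈ X | u(·, 0) = 0}`. -/
def X₀ : Set (X S.Q) := {u | HasTimeTrace (Ω := S.Ω) (T := S.T) u 0 0}

/-- `X_T = {p ∈ X | p(·, T) = 0}`. -/
def XT : Set (X S.Q) := {p | HasTimeTrace (Ω := S.Ω) (T := S.T) p S.T 0}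

/-- `a(u, φ) = ⟨∂ₜu, φ⟩ + ∫_Q (v · ∇u) φ + κ ∇u · ∇φ`. -/
def a (u : X S.Q) (φ : Y S.Q) : ℝ :=
  u.dt φ + ∫ z in S.Q, (⟪S.v z.1 z.2, u.grad z⟫ * fnY φ z + S.κ z * ⟪u.grad z, gradY φ z⟫)

/-- `a'(p, φ) = -⟨∂ₜp, φ⟩ + ∫_Q -(v · ∇p) φ + κ ∇p · ∇φ`. -/
def a' (p : X S.Q) (φ : Y S.Q) : ℝ :=
  -(p.dt φ) + ∫ z in S.Q, (-⟪S.v z.1 z.2, p.grad z⟫ * fnY φ z + S.κ z * ⟪p.grad z, gradY φ z⟫)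

/-- `u ∈ X₀` is the state `u(f)`: `a(u, φ) = (ℓ f, φ)` for all `φ ∈ Y`. -/
def IsState (f : L2 S.Q) (u : X S.Q) : Prop :=
  u ∈ S.X₀ ∧ ∀ φ : Y S.Q, S.a u φ = ∫ z in S.Q, S.ℓ z * f z * fnY φ z

/-- `p ∈ X_T` is the adjoint for the state `u` and the data `zd`:
`a'(p, φ) = (χ_{ω_T} (u - zd), φ)` for all `φ ∈ Y`. -/
def IsAdjoint (zd : L2 S.ωT) (u p : X S.Q) : Prop :=
  p ∈ S.XT ∧ ∀ φ : Y S.Q,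
    S.a' p φ = ∫ z in S.Q, S.ωT.indicator (fun y => u.fn y - zd y) z * fnY φ z

/-- The admissible set `F₊` of the a.e. nonnegative functions in `L²(Q_T)`. -/
def admissible : Set (L2 S.Q) := {f | ∀ᵐ z ∂(volume.restrict S.Q), 0 ≤ f z}

/-- The Tikhonov functional `½ ‖u - zd‖²_{L²(ω_T)} + (λ/2) ‖f‖²_{L²(Q_T)}`. -/
def tikhonov (zd : L2 S.ωT) (lam : ℝ) (f : L2 S.Q) (u : X S.Q) : ℝ :=
  1 / 2 * (∫ z in S.ωT, (u.fn z - zd z) ^ 2) + lam / 2 * (∫ z in S.Q, (f z) ^ 2)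

/-- `f` minimizes the Tikhonov functional over `F₊`, subject to the state equation. -/
def IsRegularizedSolution (zd : L2 S.ωT) (lam : ℝ) (f : L2 S.Q) : Prop :=
  f ∈ S.admissible ∧ ∃ u, S.IsState f u ∧
    ∀ g ∈ S.admissible, ∀ w, S.IsState g w → S.tikhonov zd lam f u ≤ S.tikhonov zd lam g w

/-- `(ℓ p + λ f, g - f)_{L²(Q_T)} ≥ 0` for all `g ∈ F₊`. -/
def VariationalInequality (lam : ℝ) (f p : L2 S.Q) : Prop :=
  ∀ g ∈ S.admissible, 0 ≤ ∫ z in S.Q, (S.ℓ z * p z + lam * f z) * (g z - f z)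

/-- `f = max {0, -ℓ p / λ}` almost everywhere in `Q_T`. -/
def ProjectionFormula (lam : ℝ) (f p : L2 S.Q) : Prop :=
  ∀ᵐ z ∂(volume.restrict S.Q), f z = max 0 (-(1 / lam) * (S.ℓ z * p z))

end Setting

end InverseSource

end

open MeasureTheory Set Topology
open scoped NNReal ENNReal RealInnerProductSpace

noncomputable section

open Filter

namespace InverseSource

section

/-! ### An abstract existence theorem for monotone linear relations -/

/-! The proof rests on the monotonicity of the time derivative. Say that `u` with derivative `ζ`
vanishes weakly at the start (`IsWeakStart`) if ζ(φ) = -(∂ₜφ, u) for all test functions φ that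
vanish near the end of the time interval, whatever they do near its start. Translating in time, away
from the end, does not increase the L² norm of the restriction to the cylinder. Differentiating the
pairing with `u` along such translations gives ⟨∂ₜu, u⟩ ≥ 0 (`IsWeakStart.nonneg`). A sign σ = ±1
treats both directions of time at once, so that the state and the adjoint are covered by the same
lemmas.

Let Z be the closure of the pairs (φ, σ∂ₜφ) with φ vanishing near the start (`startGraph`). Its
elements vanish weakly at the start. A pair (w, η) with ζ(w) = -η(v) for all (v, ζ) in Z vanishes
weakly at the other end. Thus Z and its adjoint relation are both monotone, and `exists_mem_add_eq`
solves the equation Z + B for every bounded coercive form B. The form of the problem is coercive: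
the advection term is skew because the velocity is divergence free (`exists_transport_operator`),
and the same integration by parts with the field x gives the Poincaré inequality.

The initial condition of the theorem concerns the continuous representative. An energy estimate
gives the elements of Z such a representative, zero at the start (`exists_trace`); conversely, a
zero trace implies weak vanishing (`isWeakStart_of_trace`). Existence comes from the first fact,
uniqueness from the second together with monotonicity, and the result is `existsUnique_evolution`.

The control problem is then a quadratic one, ½‖Cf - z‖² + (λ/2)‖f‖² over a closed convex cone,
solved by a Hilbert space projection (`exists_variational_inequality`). Integrating by parts in time
between state and adjoint (`inner_of_mem_startGraph`) identifies (Cf - z, Ch) with (ℓp, h), so that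
the first-order condition is the stated inequality. An exact quadratic expansion turns it into
minimality and uniqueness. Finally, max{0, -ℓp/λ} satisfies the inequality pointwise, and by strong
monotonicity in f no other element of F₊ does. -/

/-- The image of a closed subspace under a bounded operator that is bounded below on it. -/
theorem isClosed_image_of_bounded_below {E F : Type*} [NormedAddCommGroup E] [NormedSpace ℝ E]
    [CompleteSpace E] [NormedAddCommGroup F] [NormedSpace ℝ F] {Z : Submodule ℝ E}
    (hZ : IsClosed (Z : Set E)) (Λ : E →L[ℝ] F) {C : ℝ} (hC : ∀ x ∈ Z, ‖x‖ ≤ C * ‖Λ x‖) :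
    IsClosed ((Z.map (Λ : E →ₗ[ℝ] F) : Submodule ℝ F) : Set F) := by
  have h0 : ((Z.map (Λ : E →ₗ[ℝ] F) : Submodule ℝ F) : Set F) = Λ '' Z := rfl
  rw [h0]
  refine IsSeqClosed.isClosed fun y b hy hb => ?_
  choose x hxZ hxy using hy
  have h1 : CauchySeq x := by
    have h2 : CauchySeq y := hb.cauchySeq
    rw [Metric.cauchySeq_iff'] at h2 ⊢
    intro ε hε
    obtain ⟨N, hN⟩ := h2 (ε / (|C| + 1)) (by positivity)
    refine ⟨N, fun n hn => ?_⟩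
    have h3 := hN n hn
    rw [dist_eq_norm] at h3 ⊢
    have h4 := hC _ (Z.sub_mem (hxZ n) (hxZ N))
    rw [map_sub, hxy, hxy] at h4
    calc ‖x n - x N‖ ≤ C * ‖y n - y N‖ := h4
      _ ≤ |C| * ‖y n - y N‖ := by gcongr; exact le_abs_self C
      _ ≤ (|C| + 1) * ‖y n - y N‖ := by gcongr; linarith
      _ < (|C| + 1) * (ε / (|C| + 1)) := by gcongr
      _ = ε := by field_simp
  obtain ⟨a, ha⟩ := cauchySeq_tendsto_of_complete h1
  refine ⟨a, hZ.mem_of_tendsto ha (Eventually.of_forall hxZ), ?_⟩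
  refine tendsto_nhds_unique ((Λ.continuous.tendsto a).comp ha) ?_
  simpa [Function.comp_def, hxy] using hb

/-- If `Z` is a closed monotone linear relation from a Hilbert space to its dual whose adjoint
relation is monotone as well, and `B` is a bounded coercive form, then `Z + B` is surjective. -/
theorem exists_mem_add_eq {H : Type*} [NormedAddCommGroup H] [InnerProductSpace ℝ H]
    [CompleteSpace H] (Z : Submodule ℝ (H × (H →L[ℝ] ℝ)))
    (hZ : IsClosed (Z : Set (H × (H →L[ℝ] ℝ)))) (hmono : ∀ x ∈ Z, 0 ≤ x.2 x.1)
    (hadj : ∀ (w : H) (η : H →L[ℝ] ℝ), (∀ x ∈ Z, x.2 w = -η x.1) → η w ≤ 0)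
    (B : H →L[ℝ] H →L[ℝ] ℝ) {c : ℝ} (hc : 0 < c) (hB : ∀ u, c * ‖u‖ ^ 2 ≤ B u u)
    (F : H →L[ℝ] ℝ) : ∃ x ∈ Z, x.2 + B x.1 = F := by
  let J : (H →L[ℝ] ℝ) ≃ₗᵢ[ℝ] H := (InnerProductSpace.toDual ℝ H).symm
  have hJ : ∀ (ζ : H →L[ℝ] ℝ) (w : H), ⟪J ζ, w⟫ = ζ w := fun ζ w =>
    InnerProductSpace.toDual_symm_apply
  let Λ : H × (H →L[ℝ] ℝ) →L[ℝ] H := (J.toContinuousLinearEquiv : (H →L[ℝ] ℝ) →L[ℝ] H).comp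
    (ContinuousLinearMap.snd ℝ H (H →L[ℝ] ℝ) +
      B.comp (ContinuousLinearMap.fst ℝ H (H →L[ℝ] ℝ)))
  have hΛ : ∀ x, Λ x = J (x.2 + B x.1) := fun x => rfl
  have hfst : ∀ x ∈ Z, ‖x.1‖ ≤ ‖Λ x‖ / c := by
    intro x hx
    have h1 : c * ‖x.1‖ ^ 2 ≤ ‖Λ x‖ * ‖x.1‖ := by
      calc c * ‖x.1‖ ^ 2 ≤ (x.2 + B x.1) x.1 := by
            have := hmono x hx
            have := hB x.1
            simp only [add_apply]
            linarith
        _ = ⟪Λ x, x.1⟫ := by rw [hΛ, hJ]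
        _ ≤ _ := real_inner_le_norm _ _
    rw [le_div_iff₀ hc]
    rcases (norm_nonneg x.1).eq_or_lt with h0 | h0
    · rw [← h0, zero_mul]; exact norm_nonneg _
    · nlinarith
  have hsnd : ∀ x ∈ Z, ‖x.2‖ ≤ ‖Λ x‖ + ‖B‖ * (‖Λ x‖ / c) := by
    intro x hx
    have h1 : x.2 = (x.2 + B x.1) - B x.1 := by abel
    calc ‖x.2‖ ≤ ‖x.2 + B x.1‖ + ‖B x.1‖ := by
          conv_lhs => rw [h1]
          exact norm_sub_le _ _
      _ ≤ ‖Λ x‖ + ‖B‖ * (‖Λ x‖ / c) := by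
          rw [← J.norm_map (x.2 + B x.1), ← hΛ]
          gcongr
          exact (B.le_opNorm _).trans (by gcongr; exact hfst x hx)
  have hanti : ∀ x ∈ Z, ‖x‖ ≤ (1 / c + 1 + ‖B‖ / c) * ‖Λ x‖ := by
    intro x hx
    have h3 : 0 ≤ ‖Λ x‖ := norm_nonneg _
    have h4 : 0 ≤ ‖B‖ / c := by positivity
    have h5 : 0 ≤ 1 / c := by positivity
    refine (max_le ?_ ?_ : max ‖x.1‖ ‖x.2‖ ≤ _)
    · calc ‖x.1‖ ≤ ‖Λ x‖ / c := hfst x hx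
        _ = (1 / c) * ‖Λ x‖ := by ring
        _ ≤ _ := by gcongr; linarith
    · calc ‖x.2‖ ≤ ‖Λ x‖ + ‖B‖ * (‖Λ x‖ / c) := hsnd x hx
        _ = (1 + ‖B‖ / c) * ‖Λ x‖ := by ring
        _ ≤ _ := by gcongr; linarith
  have hcl := isClosed_image_of_bounded_below hZ Λ hanti
  have : CompleteSpace (Z.map (Λ : H × (H →L[ℝ] ℝ) →ₗ[ℝ] H)) := hcl.completeSpace_coe
  have htop : Z.map (Λ : H × (H →L[ℝ] ℝ) →ₗ[ℝ] H) = ⊤ := by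
    rw [← Submodule.orthogonal_eq_bot_iff, Submodule.eq_bot_iff]
    intro w hw
    -- Orthogonality to the range says exactly that w together with B(·, w) belongs to the adjoint
    -- relation. Monotonicity of the latter gives B(w, w) ≤ 0, and coercivity gives w = 0.
    have h1 : ∀ x ∈ Z, x.2 w = -(B.flip w) x.1 := by
      intro x hx
      have h2 := (Submodule.mem_orthogonal _ _).1 hw (Λ x) (Submodule.mem_map_of_mem hx)
      rw [hΛ, hJ] at h2
      simp only [add_apply] at h2
      rw [ContinuousLinearMap.flip_apply]
      linarith
    have h2 := hadj w _ h1
    rw [ContinuousLinearMap.flip_apply] at h2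
    have h3 := hB w
    have h4 : ‖w‖ ^ 2 ≤ 0 := by
      by_contra h
      push Not at h
      nlinarith
    have h5 : ‖w‖ = 0 := by nlinarith [norm_nonneg w, sq_nonneg ‖w‖]
    exact norm_eq_zero.1 h5
  obtain ⟨x, hxZ, hx⟩ : J F ∈ Z.map (Λ : H × (H →L[ℝ] ℝ) →ₗ[ℝ] H) := by rw [htop]; trivial
  exact ⟨x, hxZ, J.injective hx⟩

end

section

/-! ### Convergence in `L²` -/

section L2

variable {α E : Type*} [MeasurableSpace α] {μ : Measure α} [NormedAddCommGroup E]
  [InnerProductSpace ℝ E]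

theorem norm_sq_eq_integral (f : Lp E 2 μ) : ‖f‖ ^ 2 = ∫ x, ‖f x‖ ^ 2 ∂μ := by
  rw [← real_inner_self_eq_norm_sq, L2.inner_def]
  simp_rw [real_inner_self_eq_norm_sq]

/-- Dominated convergence for the squared norms of the differences; all L² limits of cutoffs,
translates and time slices below are taken through it. -/
theorem tendsto_Lp_two_of_dominated {ι : Type*} {l : Filter ι} [l.IsCountablyGenerated]
    {F : ι → Lp E 2 μ} {G : Lp E 2 μ} {bound : α → ℝ} (hb : MemLp bound 2 μ)
    (h : ∀ᶠ n in l, ∀ᵐ x ∂μ, ‖F n x - G x‖ ≤ bound x)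
    (hlim : ∀ᵐ x ∂μ, Tendsto (fun n => ‖F n x - G x‖) l (𝓝 0)) : Tendsto F l (𝓝 G) := by
  rw [tendsto_iff_norm_sub_tendsto_zero]
  have h1 : Tendsto (fun n => ∫ x, ‖F n x - G x‖ ^ 2 ∂μ) l (𝓝 (∫ _, (0 : ℝ) ∂μ)) := by
    refine tendsto_integral_filter_of_dominated_convergence (fun x => bound x ^ 2) ?_ ?_
      hb.integrable_sq ?_
    · exact Eventually.of_forall fun n =>
        ((Lp.aestronglyMeasurable _).sub (Lp.aestronglyMeasurable _)).norm.pow 2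
    · filter_upwards [h] with n hn
      filter_upwards [hn] with x hx
      rw [Real.norm_of_nonneg (by positivity)]
      gcongr
    · filter_upwards [hlim] with x hx
      simpa using hx.pow 2
  rw [integral_zero] at h1
  have h2 : ∀ n, ‖F n - G‖ ^ 2 = ∫ x, ‖F n x - G x‖ ^ 2 ∂μ := by
    intro n
    rw [norm_sq_eq_integral]
    refine integral_congr_ae ?_
    filter_upwards [Lp.coeFn_sub (F n) G] with x hx
    rw [hx, Pi.sub_apply]
  simp_rw [← h2] at h1
  have h3 := h1.sqrt
  simpa [Real.sqrt_sq] using h3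

end L2

/-! ### Operations on test functions -/

variable {d : ℕ}

theorem testFunctions_mono {Q Q' : Set (SpaceTime d)} (h : Q ⊆ Q') :
    testFunctions Q ≤ testFunctions Q' := fun _ hφ => ⟨hφ.1, hφ.2.1, hφ.2.2.trans h⟩

theorem hasDerivAt_slice {φ : SpaceTime d → ℝ} (h : ContDiff ℝ 1 φ) (z : SpaceTime d) :
    HasDerivAt (fun s => φ (z.1, s)) (fderiv ℝ φ z (0, 1)) z.2 := by
  have h1 : HasFDerivAt φ (fderiv ℝ φ (z.1, z.2)) (z.1, z.2) :=
    ((h.differentiable (by norm_num)) _).hasFDerivAt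
  have h2 := (h1.comp z.2 (hasFDerivAt_prodMk_right z.1 z.2)).hasDerivAt
  simpa [Function.comp_def] using h2

theorem timeDerivative_eq {φ : SpaceTime d → ℝ} (h : ContDiff ℝ 1 φ) (z : SpaceTime d) :
    timeDerivative φ z = fderiv ℝ φ z (0, 1) := (hasDerivAt_slice h z).deriv

theorem hasDerivAt_timeDerivative {φ : SpaceTime d → ℝ} (h : ContDiff ℝ 1 φ) (z : SpaceTime d) :
    HasDerivAt (fun s => φ (z.1, s)) (timeDerivative φ z) z.2 := by
  rw [timeDerivative_eq h]
  exact hasDerivAt_slice h z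

theorem continuous_timeDerivative {φ : SpaceTime d → ℝ} (h : ContDiff ℝ 1 φ) :
    Continuous (timeDerivative φ) := by
  rw [funext (timeDerivative_eq h)]
  exact (h.continuous_fderiv (by norm_num)).clm_apply continuous_const

theorem hasCompactSupport_timeDerivative {φ : SpaceTime d → ℝ} (h : ContDiff ℝ 1 φ)
    (hc : HasCompactSupport φ) : HasCompactSupport (timeDerivative φ) := by
  refine (hc.fderiv (𝕜 := ℝ)).mono fun z hz => ?_
  rw [Function.mem_support] at hz ⊢
  intro h0
  apply hz
  rw [timeDerivative_eq h, h0]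
  simp

theorem spatialGradient_add {φ ψ : SpaceTime d → ℝ} (h : ContDiff ℝ 1 φ) (k : ContDiff ℝ 1 ψ)
    (z : SpaceTime d) :
    spatialGradient (φ + ψ) z = spatialGradient φ z + spatialGradient ψ z := by
  rw [spatialGradient_eq (show ContDiff ℝ 1 (φ + ψ) from h.add k), spatialGradient_eq h, spatialGradient_eq k, fderiv_add
    (h.differentiable (by norm_num) z) (k.differentiable (by norm_num) z),
    ContinuousLinearMap.add_comp, map_add]

theorem spatialGradient_smul {φ : SpaceTime d → ℝ} (h : ContDiff ℝ 1 φ) (c : ℝ)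
    (z : SpaceTime d) : spatialGradient (c • φ) z = c • spatialGradient φ z := by
  rw [spatialGradient_eq (show ContDiff ℝ 1 (c • φ) from contDiff_const.smul h), spatialGradient_eq h,
    fderiv_const_smul (h.differentiable (by norm_num) z), ContinuousLinearMap.smul_comp]
  simp

theorem timeDerivative_add {φ ψ : SpaceTime d → ℝ} (h : ContDiff ℝ 1 φ) (k : ContDiff ℝ 1 ψ)
    (z : SpaceTime d) :
    timeDerivative (φ + ψ) z = timeDerivative φ z + timeDerivative ψ z :=
  ((hasDerivAt_timeDerivative h z).add (hasDerivAt_timeDerivative k z)).deriv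

theorem timeDerivative_smul {φ : SpaceTime d → ℝ} (h : ContDiff ℝ 1 φ) (c : ℝ)
    (z : SpaceTime d) : timeDerivative (c • φ) z = c * timeDerivative φ z :=
  ((hasDerivAt_timeDerivative h z).const_smul c).deriv

theorem inner_spatialGradient {φ : SpaceTime d → ℝ} (h : ContDiff ℝ 1 φ) (z : SpaceTime d)
    (w : Space d) : ⟪spatialGradient φ z, w⟫ = fderiv ℝ φ z (w, 0) := by
  rw [spatialGradient_eq h, InnerProductSpace.toDual_symm_apply]
  simp

theorem spatialGradient_mul {φ ψ : SpaceTime d → ℝ} (h : ContDiff ℝ 1 φ) (k : ContDiff ℝ 1 ψ)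
    (z : SpaceTime d) : spatialGradient (fun y => φ y * ψ y) z =
      φ z • spatialGradient ψ z + ψ z • spatialGradient φ z := by
  refine ext_inner_right ℝ fun w => ?_
  rw [inner_spatialGradient (h.mul k), inner_add_left, inner_smul_left, inner_smul_left,
    inner_spatialGradient h, inner_spatialGradient k,
    fderiv_fun_mul (h.differentiable (by norm_num) z) (k.differentiable (by norm_num) z)]
  simp

theorem timeDerivative_mul {φ ψ : SpaceTime d → ℝ} (h : ContDiff ℝ 1 φ) (k : ContDiff ℝ 1 ψ)
    (z : SpaceTime d) : timeDerivative (fun y => φ y * ψ y) z =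
      φ z * timeDerivative ψ z + timeDerivative φ z * ψ z := by
  rw [add_comm]
  exact ((hasDerivAt_timeDerivative h z).mul (hasDerivAt_timeDerivative k z)).deriv

theorem spatialGradient_time {η : ℝ → ℝ} (z : SpaceTime d) :
    spatialGradient (fun y : SpaceTime d => η y.2) z = 0 := by
  simp [spatialGradient]

/-- Multiplication of a test function by a function of time. -/
theorem timeMul_mem {Ω : Set (Space d)} {J J' : Set ℝ} {φ : SpaceTime d → ℝ}
    (hφ : φ ∈ testFunctions (Ω ×ˢ J)) {η : ℝ → ℝ} (hη : ContDiff ℝ 1 η) (hJ : tsupport η ⊆ J') :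
    (fun z => η z.2 * φ z) ∈ testFunctions (Ω ×ˢ (J ∩ J')) := by
  refine ⟨(hη.comp contDiff_snd).mul hφ.1, hφ.2.1.mul_left, fun z hz => ?_⟩
  have h1 := hφ.2.2 (tsupport_mul_subset_right (f := fun z : SpaceTime d => η z.2) hz)
  have h2 := tsupport_mul_subset_left (f := fun z : SpaceTime d => η z.2) (g := φ) hz
  exact ⟨h1.1, h1.2, hJ (tsupport_comp_subset_preimage η continuous_snd h2)⟩

theorem spatialGradient_timeMul {φ : SpaceTime d → ℝ} (h : ContDiff ℝ 1 φ) {η : ℝ → ℝ}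
    (hη : ContDiff ℝ 1 η) (z : SpaceTime d) :
    spatialGradient (fun y => η y.2 * φ y) z = η z.2 • spatialGradient φ z := by
  rw [spatialGradient_mul (show ContDiff ℝ 1 fun y : SpaceTime d => η y.2 from
    hη.comp contDiff_snd) h, spatialGradient_time,
    smul_zero, add_zero]

theorem timeDerivative_timeMul {φ : SpaceTime d → ℝ} (h : ContDiff ℝ 1 φ) {η : ℝ → ℝ}
    (hη : ContDiff ℝ 1 η) (z : SpaceTime d) :
    timeDerivative (fun y => η y.2 * φ y) z =
      η z.2 * timeDerivative φ z + deriv η z.2 * φ z := by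
  rw [timeDerivative_mul (show ContDiff ℝ 1 fun y : SpaceTime d => η y.2 from
    hη.comp contDiff_snd) h]
  rfl

/-- Translation in time. -/
def timeShift (r : ℝ) (φ : SpaceTime d → ℝ) : SpaceTime d → ℝ := fun z => φ (z.1, z.2 + r)

theorem contDiff_timeShift {φ : SpaceTime d → ℝ} (h : ContDiff ℝ 1 φ) (r : ℝ) :
    ContDiff ℝ 1 (timeShift r φ) :=
  h.comp (contDiff_fst.prodMk (contDiff_snd.add contDiff_const))

theorem spatialGradient_timeShift (φ : SpaceTime d → ℝ) (r : ℝ) (z : SpaceTime d) :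
    spatialGradient (timeShift r φ) z = spatialGradient φ (z.1, z.2 + r) := rfl

theorem timeDerivative_timeShift (φ : SpaceTime d → ℝ) (r : ℝ) (z : SpaceTime d) :
    timeDerivative (timeShift r φ) z = timeDerivative φ (z.1, z.2 + r) :=
  deriv_comp_add_const (f := fun s => φ (z.1, s)) r z.2

theorem timeShift_mem {Ω : Set (Space d)} {J J' : Set ℝ} {φ : SpaceTime d → ℝ}
    (hφ : φ ∈ testFunctions (Ω ×ˢ J)) {r : ℝ} (hJ : ∀ t, t + r ∈ J → t ∈ J') :
    timeShift r φ ∈ testFunctions (Ω ×ˢ J') := by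
  refine ⟨contDiff_timeShift hφ.1 r, ?_, fun z hz => ?_⟩
  · exact hφ.2.1.comp_homeomorph ((Homeomorph.refl (Space d)).prodCongr (Homeomorph.addRight r))
  · have h1 : Continuous fun z : SpaceTime d => (z.1, z.2 + r) := by fun_prop
    have h2 := hφ.2.2 (tsupport_comp_subset_preimage φ h1 hz)
    exact ⟨h2.1, hJ _ h2.2⟩

/-! ### Cutoff in time -/

/-- A smooth function of time with values in `[0,1]` that vanishes for `t ≤ a`, and equals `1` for
`t ≥ a + 2 / (n + 1)`. -/
def ramp (a : ℝ) (n : ℕ) (t : ℝ) : ℝ := Real.smoothTransition ((n + 1) * (t - a) - 1)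

theorem contDiff_ramp (a : ℝ) (n : ℕ) : ContDiff ℝ 1 (ramp a n) :=
  Real.smoothTransition.contDiff.comp (by fun_prop)

theorem ramp_nonneg (a : ℝ) (n : ℕ) (t : ℝ) : 0 ≤ ramp a n t := Real.smoothTransition.nonneg _

theorem ramp_le_one (a : ℝ) (n : ℕ) (t : ℝ) : ramp a n t ≤ 1 := Real.smoothTransition.le_one _

theorem ramp_eq_zero {a : ℝ} {n : ℕ} {t : ℝ} (h : (n + 1) * (t - a) ≤ 1) : ramp a n t = 0 :=
  Real.smoothTransition.zero_of_nonpos (by linarith)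

theorem ramp_eq_one {a : ℝ} {n : ℕ} {t : ℝ} (h : 2 ≤ (n + 1) * (t - a)) : ramp a n t = 1 :=
  Real.smoothTransition.one_of_one_le (by linarith)

theorem tsupport_ramp_subset (a : ℝ) (n : ℕ) : tsupport (ramp a n) ⊆ Ioi a := by
  have h1 : tsupport (ramp a n) ⊆ {t | 1 ≤ (n + 1) * (t - a)} := by
    refine closure_minimal (fun t ht => ?_) (isClosed_le continuous_const (by fun_prop))
    by_contra h
    exact ht (ramp_eq_zero (not_le.1 h).le)
  intro t ht
  have h2 : (1 : ℝ) ≤ (n + 1) * (t - a) := h1 ht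
  by_contra h3
  have h4 : t - a ≤ 0 := by simpa using h3
  nlinarith [(Nat.cast_nonneg n : (0 : ℝ) ≤ n)]

theorem tendsto_ramp (a t : ℝ) :
    ∀ᶠ n in atTop, ramp a n t = (Ioi a).indicator (fun _ => 1) t := by
  by_cases h : a < t
  · have h1 : Tendsto (fun n : ℕ => ((n : ℝ) + 1) * (t - a)) atTop atTop :=
      (tendsto_atTop_add_const_right _ _ tendsto_natCast_atTop_atTop).atTop_mul_const
        (sub_pos.2 h)
    filter_upwards [h1.eventually_ge_atTop 2] with n hn
    rw [ramp_eq_one hn, indicator_of_mem (show t ∈ Ioi a from h)]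
  · refine Eventually.of_forall fun n => ?_
    rw [indicator_of_notMem (show t ∉ Ioi a from h), ramp_eq_zero]
    have : t - a ≤ 0 := by linarith
    nlinarith [(Nat.cast_nonneg n : (0 : ℝ) ≤ n)]

/-- The ramps are affine rescalings of one fixed transition function, so a single constant, the
bound of its derivative on [0,1], serves for all `a` and `n`. -/
theorem deriv_ramp_bound : ∃ C : ℝ, 0 ≤ C ∧ ∀ (a : ℝ) (n : ℕ) (t : ℝ), |deriv (ramp a n) t| ≤
    {t | 0 < t - a ∧ (n + 1) * (t - a) ≤ 2}.indicator (fun _ => C * (n + 1)) t := by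
  have hs : ContDiff ℝ 1 Real.smoothTransition := Real.smoothTransition.contDiff
  have hcont : Continuous (deriv Real.smoothTransition) := hs.continuous_deriv le_rfl
  obtain ⟨C, hC⟩ := isCompact_Icc.exists_bound_of_continuousOn (s := Icc (0 : ℝ) 1)
    hcont.continuousOn
  have hd : ∀ (a : ℝ) (n : ℕ) (t : ℝ), deriv (ramp a n) t =
      deriv Real.smoothTransition ((n + 1) * (t - a) - 1) * (n + 1) := by
    intro a n t
    have h1 : HasDerivAt (fun t : ℝ => ((n : ℝ) + 1) * (t - a) - 1) (((n : ℝ) + 1) * 1) t :=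
      (((hasDerivAt_id t).sub_const a).const_mul _).sub_const 1
    rw [mul_one] at h1
    exact ((hs.differentiable (by norm_num) _).hasDerivAt.comp t h1).deriv
  refine ⟨C, (norm_nonneg _).trans (hC 0 (by simp)), fun a n t => ?_⟩
  have hn : (0 : ℝ) < n + 1 := by positivity
  rw [hd, abs_mul, abs_of_pos hn]
  by_cases h0 : (n + 1) * (t - a) < 1
  · have h1 : deriv Real.smoothTransition ((n + 1) * (t - a) - 1) = 0 := by
      have h2 : Real.smoothTransition =ᶠ[𝓝 ((n + 1) * (t - a) - 1)] fun _ => 0 := by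
        filter_upwards [Iio_mem_nhds (show (n + 1) * (t - a) - 1 < 0 by linarith)] with s hs
        exact Real.smoothTransition.zero_of_nonpos (le_of_lt hs)
      rw [h2.deriv_eq, deriv_const]
    rw [h1, abs_zero, zero_mul]
    exact indicator_nonneg (fun _ _ => mul_nonneg ((norm_nonneg _).trans (hC 0 (by simp))) hn.le) _
  by_cases h3 : 2 < (n + 1) * (t - a)
  · have h1 : deriv Real.smoothTransition ((n + 1) * (t - a) - 1) = 0 := by
      have h2 : Real.smoothTransition =ᶠ[𝓝 ((n + 1) * (t - a) - 1)] fun _ => 1 := by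
        filter_upwards [Ioi_mem_nhds (show 1 < (n + 1) * (t - a) - 1 by linarith)] with s hs
        exact Real.smoothTransition.one_of_one_le (le_of_lt hs)
      rw [h2.deriv_eq, deriv_const]
    rw [h1, abs_zero, zero_mul]
    exact indicator_nonneg (fun _ _ => mul_nonneg ((norm_nonneg _).trans (hC 0 (by simp))) hn.le) _
  · push Not at h0 h3
    have h4 : 0 < t - a := by
      by_contra h5
      push Not at h5
      nlinarith
    rw [indicator_of_mem (show t ∈ {t | 0 < t - a ∧ (n + 1) * (t - a) ≤ 2} from ⟨h4, h3⟩)]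
    gcongr
    exact hC _ ⟨by linarith, by linarith⟩

end

section

/-! ### The space `Y` -/

section Y

variable {d : ℕ} {Q : Set (SpaceTime d)}

instance : CompleteSpace (Y Q) :=
  (Submodule.isClosed_topologicalClosure (LinearMap.range (testEmbedding Q))).completeSpace_coe

theorem Y_ext {y y' : Y Q} (h1 : fnY y = fnY y') (h2 : gradY y = gradY y') : y = y' :=
  Subtype.ext (WithLp.ofLp_injective 2 (Prod.ext h1 h2))

theorem Y_ext_ae {y y' : Y Q} (h : ∀ᵐ z ∂(volume.restrict Q), fnY y z = fnY y' z ∧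
    gradY y z = gradY y' z) : y = y' :=
  Y_ext (Lp.ext (h.mono fun _ hz => hz.1)) (Lp.ext (h.mono fun _ hz => hz.2))

theorem norm_sq_Y (y : Y Q) : ‖y‖ ^ 2 = ‖fnY y‖ ^ 2 + ‖gradY y‖ ^ 2 :=
  WithLp.prod_norm_sq_eq_of_L2 y.1

theorem norm_fnY_le (y : Y Q) : ‖fnY y‖ ≤ ‖y‖ := WithLp.norm_fst_le (L2 Q) y.1

theorem norm_gradY_le (y : Y Q) : ‖gradY y‖ ≤ ‖y‖ := WithLp.norm_snd_le (L2 Q) y.1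

/-- The map `(y, ∇y) ↦ y`. -/
def fnL (Q : Set (SpaceTime d)) : Y Q →L[ℝ] L2 Q :=
  LinearMap.mkContinuous { toFun := fnY, map_add' := fun _ _ => rfl, map_smul' := fun _ _ => rfl } 1
    fun y => by rw [one_mul]; exact norm_fnY_le y

/-- The map `(y, ∇y) ↦ ∇y`. -/
def gradL (Q : Set (SpaceTime d)) : Y Q →L[ℝ] L2Vec Q :=
  LinearMap.mkContinuous { toFun := gradY, map_add' := fun _ _ => rfl, map_smul' := fun _ _ => rfl }
    1 fun y => by rw [one_mul]; exact norm_gradY_le y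

@[simp] theorem fnL_apply (y : Y Q) : fnL Q y = fnY y := rfl

@[simp] theorem gradL_apply (y : Y Q) : gradL Q y = gradY y := rfl

theorem tendsto_Y_iff {ι : Type*} {l : Filter ι} {y : ι → Y Q} {y' : Y Q} :
    Tendsto y l (𝓝 y') ↔ Tendsto (fun i => fnY (y i)) l (𝓝 (fnY y')) ∧
      Tendsto (fun i => gradY (y i)) l (𝓝 (gradY y')) := by
  refine ⟨fun h => ⟨((fnL Q).continuous.tendsto _).comp h, ((gradL Q).continuous.tendsto _).comp h⟩,
    fun ⟨h1, h2⟩ => ?_⟩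
  rw [tendsto_subtype_rng]
  exact ((WithLp.prod_continuous_toLp 2 _ _).tendsto (fnY y', gradY y')).comp (h1.prodMk_nhds h2)

/-- `f ∈ L²(Q)` as an element of `Y'`. -/
def toDualL (Q : Set (SpaceTime d)) : L2 Q →L[ℝ] YDual Q :=
  LinearMap.mkContinuous
    { toFun := fun f => (innerSL ℝ f).comp (fnL Q)
      map_add' := fun f g => by ext y; simp
      map_smul' := fun c f => by ext y; simp } 1 fun f => by
    refine ContinuousLinearMap.opNorm_le_bound _ (by positivity) fun y => ?_
    rw [one_mul]
    exact (norm_inner_le_norm f (fnY y)).trans (by gcongr; exact norm_fnY_le y)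

@[simp] theorem toDualL_apply (f : L2 Q) (y : Y Q) : toDualL Q f y = ⟪f, fnY y⟫ := rfl

theorem inner_L2 {α : Type*} [MeasureSpace α] {A : Set α} (f g : L2 A) :
    ⟪f, g⟫ = ∫ z in A, f z * g z := by
  rw [L2.inner_def]
  simp [mul_comm]

theorem fnY_testY (φ : testFunctions Q) :
    fnY (testY φ) =ᵐ[volume.restrict Q] (φ : SpaceTime d → ℝ) :=
  MemLp.coeFn_toLp (φ.2.1.continuous.memLp_of_hasCompactSupport φ.2.2.1)

theorem gradY_testY (φ : testFunctions Q) :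
    gradY (testY φ) =ᵐ[volume.restrict Q] spatialGradient (φ : SpaceTime d → ℝ) :=
  MemLp.coeFn_toLp ((continuous_spatialGradient φ.2.1).memLp_of_hasCompactSupport
    (hasCompactSupport_spatialGradient φ.2.1 φ.2.2.1))

theorem exists_seq_testY (y : Y Q) :
    ∃ φ : ℕ → testFunctions Q, Tendsto (fun n => testY (φ n)) atTop (𝓝 y) := by
  have h1 : (y : FunGrad Q) ∈ closure (LinearMap.range (testEmbedding Q) : Set (FunGrad Q)) := y.2
  obtain ⟨x, hx, hlim⟩ := mem_closure_iff_seq_limit.1 h1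
  choose φ hφ using hx
  refine ⟨φ, ?_⟩
  rw [tendsto_subtype_rng]
  refine hlim.congr fun n => ?_
  rw [← hφ]
  rfl

theorem dense_testY : DenseRange (testY : testFunctions Q → Y Q) := by
  intro y
  obtain ⟨φ, hφ⟩ := exists_seq_testY y
  exact mem_closure_of_tendsto hφ (Eventually.of_forall fun n => mem_range_self _)

end Y

/-! ### Test functions on Ω × ℝ restricted to the cylinder -/

section Strip

variable {d : ℕ} {Ω : Set (Space d)} {T : ℝ}

theorem measurableSet_cylinder (hΩ : IsOpen Ω) : MeasurableSet (cylinder Ω T) :=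
  hΩ.measurableSet.prod measurableSet_Ioo

theorem memLp_test {Q Q' : Set (SpaceTime d)} {φ : SpaceTime d → ℝ} (hφ : φ ∈ testFunctions Q')
    {p : ℝ≥0∞} : MemLp φ p (volume.restrict Q) :=
  hφ.1.continuous.memLp_of_hasCompactSupport hφ.2.1

theorem memLp_spatialGradient {Q Q' : Set (SpaceTime d)} {φ : SpaceTime d → ℝ}
    (hφ : φ ∈ testFunctions Q') {p : ℝ≥0∞} : MemLp (spatialGradient φ) p (volume.restrict Q) :=
  (continuous_spatialGradient hφ.1).memLp_of_hasCompactSupport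
    (hasCompactSupport_spatialGradient hφ.1 hφ.2.1)

theorem memLp_timeDerivative {Q Q' : Set (SpaceTime d)} {φ : SpaceTime d → ℝ}
    (hφ : φ ∈ testFunctions Q') {p : ℝ≥0∞} : MemLp (timeDerivative φ) p (volume.restrict Q) :=
  (continuous_timeDerivative hφ.1).memLp_of_hasCompactSupport
    (hasCompactSupport_timeDerivative hφ.1 hφ.2.1)

theorem tendsto_cutoff (a b t : ℝ) : ∀ᶠ n in atTop,
    ramp a n t * ramp (-b) n (-t) = (Ioo a b).indicator (fun _ => 1) t := by
  filter_upwards [tendsto_ramp a t, tendsto_ramp (-b) (-t)] with n h1 h2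
  rw [h1, h2]
  by_cases h3 : a < t <;> by_cases h4 : t < b <;> simp [indicator, h3, h4]

theorem cutoff_mem {J : Set ℝ} {φ : SpaceTime d → ℝ} (hφ : φ ∈ testFunctions (Ω ×ˢ J)) (a b : ℝ)
    (n : ℕ) : (fun z => (ramp a n z.2 * ramp (-b) n (-z.2)) * φ z) ∈
      testFunctions (Ω ×ˢ (J ∩ Ioo a b)) := by
  refine timeMul_mem hφ (η := fun t => ramp a n t * ramp (-b) n (-t))
    ((contDiff_ramp a n).mul ((contDiff_ramp (-b) n).comp contDiff_neg)) fun t ht => ?_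
  have h1 := tsupport_ramp_subset _ _ (tsupport_mul_subset_left ht)
  have h2 := tsupport_ramp_subset _ _ (tsupport_comp_subset_preimage (ramp (-b) n) continuous_neg
    (tsupport_mul_subset_right (f := ramp a n) (g := fun t => ramp (-b) n (-t)) ht))
  exact ⟨h1, by simpa using h2⟩

/-- Restrictions of test functions to time intervals belong to `Y`. -/
theorem exists_Y_indicator (φ : testFunctions (Ω ×ˢ (univ : Set ℝ))) {a b : ℝ} (ha : 0 ≤ a)
    (hb : b ≤ T) : ∃ y : Y (cylinder Ω T), ∀ᵐ z ∂(volume.restrict (cylinder Ω T)),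
      fnY y z = (Ioo a b).indicator (fun _ => φ.1 z) z.2 ∧
      gradY y z = (Ioo a b).indicator (fun _ => spatialGradient φ.1 z) z.2 := by
  set μ := volume.restrict (cylinder Ω T) with hμ
  have hI : MeasurableSet ((univ : Set (Space d)) ×ˢ Ioo a b) :=
    MeasurableSet.univ.prod measurableSet_Ioo
  have hf : MemLp (((univ : Set (Space d)) ×ˢ Ioo a b).indicator φ.1) 2 μ :=
    (memLp_test φ.2).indicator hI
  have hg : MemLp (((univ : Set (Space d)) ×ˢ Ioo a b).indicator (spatialGradient φ.1)) 2 μ :=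
    (memLp_spatialGradient φ.2).indicator hI
  -- A rising and a falling ramp multiply to a smooth cutoff supported in (a, b) that is eventually
  -- equal to the indicator at each time.
  let η : ℕ → ℝ → ℝ := fun n t => ramp a n t * ramp (-b) n (-t)
  have hη : ∀ n, ContDiff ℝ 1 (η n) := fun n =>
    (contDiff_ramp a n).mul ((contDiff_ramp (-b) n).comp contDiff_neg)
  have hη0 : ∀ n t, 0 ≤ η n t := fun n t => mul_nonneg (ramp_nonneg _ _ _) (ramp_nonneg _ _ _)
  have hη1 : ∀ n t, η n t ≤ 1 := fun n t =>
    mul_le_one₀ (ramp_le_one _ _ _) (ramp_nonneg _ _ _) (ramp_le_one _ _ _)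
  have hηI : ∀ n t, |η n t - (Ioo a b).indicator (fun _ => 1) t| ≤ 1 := by
    intro n t
    rw [abs_le]
    have := hη0 n t
    have := hη1 n t
    by_cases ht : t ∈ Ioo a b
    · rw [indicator_of_mem ht]; constructor <;> linarith
    · rw [indicator_of_notMem ht]; constructor <;> linarith
  have hηt : ∀ t, ∀ᶠ n in atTop, η n t - (Ioo a b).indicator (fun _ => 1) t = 0 := fun t =>
    (tendsto_cutoff a b t).mono fun n hn => sub_eq_zero.2 hn
  have hind : ∀ {E : Type} [AddCommGroup E] [Module ℝ E] (f : SpaceTime d → E) (z : SpaceTime d),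
      ((univ : Set (Space d)) ×ˢ Ioo a b).indicator f z =
        (Ioo a b).indicator (fun _ => (1 : ℝ)) z.2 • f z := by
    intro E _ _ f z
    by_cases hz : z.2 ∈ Ioo a b
    · rw [indicator_of_mem hz, indicator_of_mem (s := univ ×ˢ Ioo a b) ⟨trivial, hz⟩, one_smul]
    · rw [indicator_of_notMem hz, indicator_of_notMem (s := univ ×ˢ Ioo a b) (fun h => hz h.2),
        zero_smul]
  have hsub : Ω ×ˢ (univ ∩ Ioo a b) ⊆ cylinder Ω T := by
    rintro z ⟨h1, -, h2⟩
    exact ⟨h1, lt_of_le_of_lt ha h2.1, lt_of_lt_of_le h2.2 hb⟩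
  let ψ : ℕ → testFunctions (cylinder Ω T) := fun n =>
    ⟨fun z => η n z.2 * φ.1 z, testFunctions_mono hsub (cutoff_mem φ.2 a b n)⟩
  have hlim1 : Tendsto (fun n => fnY (testY (ψ n))) atTop (𝓝 (hf.toLp _)) := by
    have hae : ∀ᵐ z ∂μ, ∀ n, fnY (testY (ψ n)) z - hf.toLp _ z =
        (η n z.2 - (Ioo a b).indicator (fun _ => 1) z.2) * φ.1 z := by
      filter_upwards [ae_all_iff.2 fun n => fnY_testY (ψ n), hf.coeFn_toLp] with z h1 h2 n
      rw [h1, h2, hind, smul_eq_mul, sub_mul]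
    refine tendsto_Lp_two_of_dominated (bound := fun z => ‖φ.1 z‖) (memLp_test φ.2).norm ?_ ?_
    · refine Eventually.of_forall fun n => ?_
      filter_upwards [hae] with z hz
      rw [hz, norm_mul]
      exact mul_le_of_le_one_left (norm_nonneg _) (hηI _ _)
    · filter_upwards [hae] with z hz
      refine tendsto_const_nhds.congr' ?_
      filter_upwards [hηt z.2] with n hn
      rw [hz, hn, zero_mul, norm_zero]
  have hlim2 : Tendsto (fun n => gradY (testY (ψ n))) atTop (𝓝 (hg.toLp _)) := by
    have hae : ∀ᵐ z ∂μ, ∀ n, gradY (testY (ψ n)) z - hg.toLp _ z =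
        (η n z.2 - (Ioo a b).indicator (fun _ => 1) z.2) • spatialGradient φ.1 z := by
      filter_upwards [ae_all_iff.2 fun n => gradY_testY (ψ n), hg.coeFn_toLp] with z h1 h2 n
      rw [h1, h2, hind, sub_smul, spatialGradient_timeMul φ.2.1 (hη n)]
    refine tendsto_Lp_two_of_dominated (bound := fun z => ‖spatialGradient φ.1 z‖)
      (memLp_spatialGradient φ.2).norm ?_ ?_
    · refine Eventually.of_forall fun n => ?_
      filter_upwards [hae] with z hz
      rw [hz, norm_smul]
      exact mul_le_of_le_one_left (norm_nonneg _) (hηI _ _)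
    · filter_upwards [hae] with z hz
      refine tendsto_const_nhds.congr' ?_
      filter_upwards [hηt z.2] with n hn
      rw [hz, hn, zero_smul, norm_zero]
  -- Only values and spatial gradients have to converge, so a jump in time is harmless in `Y`.
  have hY : (WithLp.toLp 2 (hf.toLp _, hg.toLp _) : FunGrad (cylinder Ω T)) ∈ Y (cylinder Ω T) := by
    refine (Submodule.isClosed_topologicalClosure
      (LinearMap.range (testEmbedding (cylinder Ω T)))).mem_of_tendsto
      (((WithLp.prod_continuous_toLp 2 _ _).tendsto (hf.toLp _, hg.toLp _)).comp
        (hlim1.prodMk_nhds hlim2)) (Eventually.of_forall fun n => (testY (ψ n)).2)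
  refine ⟨⟨_, hY⟩, ?_⟩
  filter_upwards [hf.coeFn_toLp, hg.coeFn_toLp] with z h1 h2
  refine ⟨h1.trans ?_, h2.trans ?_⟩
  · rw [hind]
    by_cases hz : z.2 ∈ Ioo a b <;> simp [indicator, hz]
  · rw [hind]
    by_cases hz : z.2 ∈ Ioo a b <;> simp [indicator, hz]

theorem exists_Y_strip (hΩ : IsOpen Ω) (T : ℝ) (φ : testFunctions (Ω ×ˢ (univ : Set ℝ))) :
    ∃ y : Y (cylinder Ω T), ∀ᵐ z ∂(volume.restrict (cylinder Ω T)),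
      fnY y z = φ.1 z ∧ gradY y z = spatialGradient φ.1 z := by
  obtain ⟨y, hy⟩ := exists_Y_indicator (T := T) φ le_rfl le_rfl
  refine ⟨y, ?_⟩
  filter_upwards [hy, ae_restrict_mem (measurableSet_cylinder hΩ)] with z hz hzQ
  rwa [indicator_of_mem hzQ.2, indicator_of_mem hzQ.2] at hz

/-- The restriction to the space-time cylinder of a test function on `Ω × ℝ`. -/
def stripY (hΩ : IsOpen Ω) (T : ℝ) :
    testFunctions (Ω ×ˢ (univ : Set ℝ)) →ₗ[ℝ] Y (cylinder Ω T) where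
  toFun φ := (exists_Y_strip hΩ T φ).choose
  map_add' φ ψ := by
    refine Y_ext_ae ?_
    set a := (exists_Y_strip hΩ T φ).choose
    set b := (exists_Y_strip hΩ T ψ).choose
    filter_upwards [(exists_Y_strip hΩ T φ).choose_spec, (exists_Y_strip hΩ T ψ).choose_spec,
      (exists_Y_strip hΩ T (φ + ψ)).choose_spec, Lp.coeFn_add (fnY a) (fnY b),
      Lp.coeFn_add (gradY a) (gradY b)] with z h1 h2 h3 h4 h5
    refine ⟨h3.1.trans (Eq.trans ?_ h4.symm), h3.2.trans (Eq.trans ?_ h5.symm)⟩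
    · rw [Pi.add_apply, h1.1, h2.1]
      rfl
    · rw [Pi.add_apply, h1.2, h2.2]
      exact spatialGradient_add φ.2.1 ψ.2.1 z
  map_smul' c φ := by
    refine Y_ext_ae ?_
    set a := (exists_Y_strip hΩ T φ).choose
    filter_upwards [(exists_Y_strip hΩ T φ).choose_spec,
      (exists_Y_strip hΩ T (c • φ)).choose_spec, Lp.coeFn_smul c (fnY a),
      Lp.coeFn_smul c (gradY a)] with z h1 h3 h4 h5
    refine ⟨h3.1.trans (Eq.trans ?_ h4.symm), h3.2.trans (Eq.trans ?_ h5.symm)⟩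
    · rw [Pi.smul_apply, h1.1]
      rfl
    · rw [Pi.smul_apply, h1.2]
      exact spatialGradient_smul φ.2.1 c z

theorem stripY_ae (hΩ : IsOpen Ω) (T : ℝ) (φ : testFunctions (Ω ×ˢ (univ : Set ℝ))) :
    ∀ᵐ z ∂(volume.restrict (cylinder Ω T)), fnY (stripY hΩ T φ) z = φ.1 z ∧
      gradY (stripY hΩ T φ) z = spatialGradient φ.1 z :=
  (exists_Y_strip hΩ T φ).choose_spec

theorem stripY_eq_testY (hΩ : IsOpen Ω) (φ : testFunctions (cylinder Ω T))
    (hφ : φ.1 ∈ testFunctions (Ω ×ˢ (univ : Set ℝ))) : stripY hΩ T ⟨φ.1, hφ⟩ = testY φ := by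
  refine Y_ext_ae ?_
  filter_upwards [stripY_ae hΩ T ⟨φ.1, hφ⟩, fnY_testY φ, gradY_testY φ] with z h1 h2 h3
  exact ⟨h1.1.trans h2.symm, h1.2.trans h3.symm⟩

/-- The time derivative of a test function on `Ω × ℝ` as an element of `L²(Q)`. -/
def stripDt (Ω : Set (Space d)) (T : ℝ) :
    testFunctions (Ω ×ˢ (univ : Set ℝ)) →ₗ[ℝ] L2 (cylinder Ω T) where
  toFun φ := (memLp_timeDerivative φ.2).toLp (timeDerivative φ.1)
  map_add' φ ψ := by
    rw [← MemLp.toLp_add]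
    congr 1
    exact funext fun z => timeDerivative_add φ.2.1 ψ.2.1 z
  map_smul' c φ := by
    rw [RingHom.id_apply, ← MemLp.toLp_const_smul]
    congr 1
    exact funext fun z => timeDerivative_smul φ.2.1 c z

theorem stripDt_ae (φ : testFunctions (Ω ×ˢ (univ : Set ℝ))) :
    stripDt Ω T φ =ᵐ[volume.restrict (cylinder Ω T)] timeDerivative φ.1 :=
  MemLp.coeFn_toLp (memLp_timeDerivative φ.2)

theorem inner_stripDt (φ : testFunctions (Ω ×ˢ (univ : Set ℝ))) (f : L2 (cylinder Ω T)) :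
    ⟪stripDt Ω T φ, f⟫ = ∫ z in cylinder Ω T, f z * timeDerivative φ.1 z := by
  rw [real_inner_comm, inner_L2]
  refine integral_congr_ae ?_
  filter_upwards [stripDt_ae φ] with z hz
  rw [hz]

end Strip

end

section

variable {d : ℕ} {Ω : Set (Space d)} {T : ℝ}

/-! ### The two ends of the time interval -/

/-- The times after `t₀` for the direction of time given by the sign `σ`. -/
def after (σ t₀ : ℝ) : Set ℝ := {t | 0 < σ * (t - t₀)}

/-- The time interval `(0,T)`, run through in the direction `σ = ±1`, starts at `t₀` and ends at
`t₁`. -/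
def IsDirection (T σ t₀ t₁ : ℝ) : Prop := (σ = 1 ∧ t₀ = 0 ∧ t₁ = T) ∨ (σ = -1 ∧ t₀ = T ∧ t₁ = 0)

theorem IsDirection.reverse {σ t₀ t₁ : ℝ} (h : IsDirection T σ t₀ t₁) :
    IsDirection T (-σ) t₁ t₀ := by
  rcases h with ⟨rfl, rfl, rfl⟩ | ⟨rfl, rfl, rfl⟩
  · exact Or.inr ⟨rfl, rfl, rfl⟩
  · exact Or.inl ⟨neg_neg 1, rfl, rfl⟩

theorem IsDirection.mul_self {σ t₀ t₁ : ℝ} (h : IsDirection T σ t₀ t₁) : σ * σ = 1 := by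
  rcases h with ⟨rfl, rfl, rfl⟩ | ⟨rfl, rfl, rfl⟩ <;> norm_num

theorem IsDirection.abs_eq {σ t₀ t₁ : ℝ} (h : IsDirection T σ t₀ t₁) : |σ| = 1 := by
  rcases h with ⟨rfl, rfl, rfl⟩ | ⟨rfl, rfl, rfl⟩ <;> norm_num

theorem IsDirection.after_inter {σ t₀ t₁ : ℝ} (h : IsDirection T σ t₀ t₁) :
    after (-σ) t₁ ∩ after σ t₀ = Ioo 0 T := by
  ext t
  rcases h with ⟨rfl, rfl, rfl⟩ | ⟨rfl, rfl, rfl⟩ <;>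
  simp only [after, mem_inter_iff, mem_ofPred_eq, mem_Ioo] <;>
  constructor <;> rintro ⟨h1, h2⟩ <;> constructor <;> linarith

theorem IsDirection.mem_Icc {σ t₀ t₁ : ℝ} (h : IsDirection T σ t₀ t₁) (hT : 0 < T) :
    t₀ ∈ Icc 0 T := by
  rcases h with ⟨rfl, rfl, rfl⟩ | ⟨rfl, rfl, rfl⟩ <;> simp [hT.le]

theorem cylinder_subset_after {σ t₀ t₁ : ℝ} (h : IsDirection T σ t₀ t₁) :
    cylinder Ω T ⊆ Ω ×ˢ after σ t₀ := fun _ hz =>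
  ⟨hz.1, (h.after_inter.ge hz.2).2⟩

theorem prod_subset_strip (J : Set ℝ) : Ω ×ˢ J ⊆ Ω ×ˢ (univ : Set ℝ) :=
  prod_mono le_rfl (subset_univ _)

theorem cylinder_subset_strip : cylinder Ω T ⊆ Ω ×ˢ (univ : Set ℝ) := prod_subset_strip _

theorem isFiniteMeasure_cylinder (hb : Bornology.IsBounded Ω) :
    IsFiniteMeasure (volume.restrict (cylinder Ω T)) := by
  refine ⟨?_⟩
  rw [Measure.restrict_apply_univ]
  exact (hb.prod (Metric.isBounded_Ioo 0 T)).measure_lt_top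

/-- `ζ` is the time derivative of `u`, and `u` vanishes at the start in the weak sense: the test
functions need not vanish there. -/
def IsWeakStart (hΩ : IsOpen Ω) (T σ t₁ : ℝ) (u : Y (cylinder Ω T)) (ζ : YDual (cylinder Ω T)) :
    Prop :=
  ∀ φ : testFunctions (Ω ×ˢ (univ : Set ℝ)), φ.1 ∈ testFunctions (Ω ×ˢ after (-σ) t₁) →
    ζ (stripY hΩ T φ) = -⟪stripDt Ω T φ, fnY u⟫

theorem IsWeakStart.isTimeDerivative {hΩ : IsOpen Ω} {σ t₀ t₁ : ℝ} (h : IsDirection T σ t₀ t₁)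
    {u : Y (cylinder Ω T)} {ζ : YDual (cylinder Ω T)} (hu : IsWeakStart hΩ T σ t₁ u ζ) :
    IsTimeDerivative u ζ := by
  intro φ
  have h1 := testFunctions_mono cylinder_subset_strip φ.2
  rw [← stripY_eq_testY hΩ φ h1, hu ⟨φ.1, h1⟩
    (testFunctions_mono (cylinder_subset_after h.reverse) φ.2), inner_stripDt]

/-! ### Translation in time and monotonicity of the time derivative -/

instance : (volume : Measure (SpaceTime d)).IsAddHaarMeasure :=
  inferInstanceAs ((volume : Measure (Space d)).prod (volume : Measure ℝ)).IsAddHaarMeasure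

/-- The integral over the whole space is translation invariant, and only the part that is moved out
of Q is lost. -/
theorem integral_shift_le {E : Type*} [NormedAddCommGroup E] {f : SpaceTime d → E}
    (hf : Continuous f) (hc : HasCompactSupport f) {Q : Set (SpaceTime d)}
    (hQ : Function.support f ⊆ Q) (s : ℝ) :
    ∫ z in Q, ‖f (z.1, z.2 + s)‖ ^ 2 ≤ ∫ z in Q, ‖f z‖ ^ 2 := by
  have hint : Integrable fun z => ‖f z‖ ^ 2 :=
    (hf.memLp_of_hasCompactSupport (p := 2) hc).integrable_norm_pow (by norm_num)
  have h1 : (fun z : SpaceTime d => ‖f (z.1, z.2 + s)‖ ^ 2) =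
      fun z => (fun y => ‖f y‖ ^ 2) (z + (0, s)) := by
    funext z
    simp [Prod.add_def]
  calc ∫ z in Q, ‖f (z.1, z.2 + s)‖ ^ 2 ≤ ∫ z : SpaceTime d, ‖f (z.1, z.2 + s)‖ ^ 2 := by
        refine setIntegral_le_integral ?_ (Eventually.of_forall fun z => by positivity)
        rw [h1]
        exact hint.comp_add_right _
    _ = ∫ z : SpaceTime d, ‖f z‖ ^ 2 := by
        rw [h1, integral_add_right_eq_self (fun y => ‖f y‖ ^ 2)]
    _ = ∫ z in Q, ‖f z‖ ^ 2 := by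
        refine (setIntegral_eq_integral_of_forall_compl_eq_zero fun z hz => ?_).symm
        have : f z = 0 := by
          by_contra h
          exact hz (hQ h)
        simp [this]

/-- The restriction to the cylinder of a translate of a test function. -/
def shiftY (hΩ : IsOpen Ω) (s : ℝ) (φ : testFunctions (cylinder Ω T)) : Y (cylinder Ω T) :=
  stripY hΩ T ⟨timeShift s φ.1, timeShift_mem φ.2 fun _ _ => mem_univ _⟩

theorem shiftY_sub (hΩ : IsOpen Ω) (s : ℝ) (φ ψ : testFunctions (cylinder Ω T)) :
    shiftY hΩ s (φ - ψ) = shiftY hΩ s φ - shiftY hΩ s ψ := by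
  unfold shiftY
  rw [← map_sub]
  rfl

theorem testY_sub {Q : Set (SpaceTime d)} (φ ψ : testFunctions Q) :
    testY (φ - ψ) = testY φ - testY ψ :=
  Subtype.ext (map_sub (testEmbedding Q) φ ψ)

theorem norm_fnY_shiftY_le (hΩ : IsOpen Ω) (s : ℝ) (φ : testFunctions (cylinder Ω T)) :
    ‖fnY (shiftY hΩ s φ)‖ ≤ ‖fnY (testY φ)‖ := by
  refine le_of_sq_le_sq ?_ (norm_nonneg _)
  rw [norm_sq_eq_integral, norm_sq_eq_integral]
  refine (integral_congr_ae ?_).trans_le ((integral_shift_le φ.2.1.continuous φ.2.2.1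
    ((subset_tsupport _).trans φ.2.2.2) s).trans_eq (integral_congr_ae ?_))
  · filter_upwards [stripY_ae hΩ T ⟨timeShift s φ.1, timeShift_mem φ.2 fun _ _ => mem_univ _⟩]
      with z hz
    rw [shiftY, hz.1]
    rfl
  · filter_upwards [fnY_testY φ] with z hz
    rw [hz]

theorem norm_gradY_shiftY_le (hΩ : IsOpen Ω) (s : ℝ) (φ : testFunctions (cylinder Ω T)) :
    ‖gradY (shiftY hΩ s φ)‖ ≤ ‖gradY (testY φ)‖ := by
  refine le_of_sq_le_sq ?_ (norm_nonneg _)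
  rw [norm_sq_eq_integral, norm_sq_eq_integral]
  have hsupp : Function.support (spatialGradient φ.1) ⊆ cylinder Ω T := by
    intro z hz
    refine φ.2.2.2 (tsupport_fderiv_subset ℝ (subset_tsupport _ ?_))
    rw [Function.mem_support] at hz ⊢
    intro h0
    apply hz
    rw [spatialGradient_eq φ.2.1, h0]
    simp
  refine (integral_congr_ae ?_).trans_le ((integral_shift_le (continuous_spatialGradient φ.2.1)
    (hasCompactSupport_spatialGradient φ.2.1 φ.2.2.1) hsupp s).trans_eq (integral_congr_ae ?_))
  · filter_upwards [stripY_ae hΩ T ⟨timeShift s φ.1, timeShift_mem φ.2 fun _ _ => mem_univ _⟩]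
      with z hz
    rw [shiftY, hz.2, spatialGradient_timeShift]
  · filter_upwards [gradY_testY φ] with z hz
    rw [hz]

theorem norm_shiftY_le (hΩ : IsOpen Ω) (s : ℝ) (φ : testFunctions (cylinder Ω T)) :
    ‖shiftY hΩ s φ‖ ≤ ‖testY φ‖ := by
  refine le_of_sq_le_sq ?_ (norm_nonneg _)
  rw [norm_sq_Y, norm_sq_Y]
  gcongr
  · exact norm_fnY_shiftY_le hΩ s φ
  · exact norm_gradY_shiftY_le hΩ s φ

theorem tendsto_Lp_shift {E : Type*} [NormedAddCommGroup E] [InnerProductSpace ℝ E]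
    {Q : Set (SpaceTime d)} [IsFiniteMeasure (volume.restrict Q)] {f : SpaceTime d → E}
    (hf : Continuous f) (hc : HasCompactSupport f) {F : ℝ → Lp E 2 (volume.restrict Q)}
    {G : Lp E 2 (volume.restrict Q)} (hF : ∀ s, ∀ᵐ z ∂(volume.restrict Q), F s z = f (z.1, z.2 + s))
    (hG : ∀ᵐ z ∂(volume.restrict Q), G z = f z) : Tendsto F (𝓝 0) (𝓝 G) := by
  rw [tendsto_iff_seq_tendsto]
  intro s hs
  obtain ⟨C, hC⟩ := hf.bounded_above_of_compact_support hc
  refine tendsto_Lp_two_of_dominated (bound := fun _ => C + C) (memLp_const _) ?_ ?_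
  · refine Eventually.of_forall fun n => ?_
    filter_upwards [hF (s n), hG] with z h1 h2
    rw [Function.comp_apply, h1, h2]
    exact (norm_sub_le _ _).trans (add_le_add (hC _) (hC _))
  · filter_upwards [ae_all_iff.2 fun n => hF (s n), hG] with z h1 h2
    simp_rw [Function.comp_apply, h1, h2]
    rw [← tendsto_iff_norm_sub_tendsto_zero]
    have h3 : Tendsto (fun n => ((z.1, z.2 + s n) : SpaceTime d)) atTop (𝓝 (z.1, z.2 + 0)) :=
      tendsto_const_nhds.prodMk_nhds (tendsto_const_nhds.add hs)
    rw [add_zero] at h3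
    exact (hf.tendsto z).comp h3

theorem tendsto_shiftY (hΩ : IsOpen Ω) (hb : Bornology.IsBounded Ω)
    (φ : testFunctions (cylinder Ω T)) :
    Tendsto (fun s => shiftY hΩ s φ) (𝓝 0) (𝓝 (testY φ)) := by
  have := isFiniteMeasure_cylinder (T := T) hb
  rw [tendsto_Y_iff]
  refine ⟨tendsto_Lp_shift φ.2.1.continuous φ.2.2.1 (fun s => ?_) (fnY_testY φ),
    tendsto_Lp_shift (continuous_spatialGradient φ.2.1)
      (hasCompactSupport_spatialGradient φ.2.1 φ.2.2.1) (fun s => ?_) (gradY_testY φ)⟩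
  · exact (stripY_ae hΩ T ⟨timeShift s φ.1, timeShift_mem φ.2 fun _ _ => mem_univ _⟩).mono
      fun z hz => hz.1
  · exact (stripY_ae hΩ T ⟨timeShift s φ.1, timeShift_mem φ.2 fun _ _ => mem_univ _⟩).mono
      fun z hz => hz.2

/-- Differentiation under the integral sign; the compact support of the time derivative gives a
bound uniform in the translation. -/
theorem hasDerivAt_inner_shiftY (hΩ : IsOpen Ω) (hb : Bornology.IsBounded Ω)
    (φ : testFunctions (cylinder Ω T)) (f : L2 (cylinder Ω T)) (σ r : ℝ) :
    HasDerivAt (fun r => ⟪fnY (shiftY hΩ (σ * r) φ), f⟫)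
      (σ * ⟪stripDt Ω T ⟨timeShift (σ * r) φ.1, timeShift_mem φ.2 fun _ _ => mem_univ _⟩, f⟫) r := by
  have := isFiniteMeasure_cylinder (T := T) hb
  have h1 : ∀ r, ⟪fnY (shiftY hΩ (σ * r) φ), f⟫ =
      ∫ z in cylinder Ω T, φ.1 (z.1, z.2 + σ * r) * f z := by
    intro r
    rw [inner_L2]
    refine integral_congr_ae ?_
    filter_upwards [stripY_ae hΩ T ⟨timeShift (σ * r) φ.1, timeShift_mem φ.2 fun _ _ => mem_univ _⟩]
      with z hz
    rw [shiftY, hz.1]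
    rfl
  rw [funext h1, inner_stripDt, ← integral_const_mul]
  simp only [timeDerivative_timeShift]
  have hd : Continuous (timeDerivative φ.1) := continuous_timeDerivative φ.2.1
  obtain ⟨C, hC⟩ := hd.bounded_above_of_compact_support
    (hasCompactSupport_timeDerivative φ.2.1 φ.2.2.1)
  have hf : Integrable f (volume.restrict (cylinder Ω T)) :=
    (Lp.memLp f).integrable (by norm_num)
  have hs : ∀ r : ℝ, Continuous fun z : SpaceTime d => (z.1, z.2 + σ * r) := fun r => by fun_prop
  refine (hasDerivAt_integral_of_dominated_loc_of_deriv_le (bound := fun z => |σ| * C * ‖f z‖)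
    (s := univ) (F' := fun r z => σ * (f z * timeDerivative φ.1 (z.1, z.2 + σ * r)))
    univ_mem ?_ ?_ ?_ ?_ ?_ ?_).2
  · exact Eventually.of_forall fun r =>
      ((φ.2.1.continuous.comp (hs r)).aestronglyMeasurable).mul hf.1
  · obtain ⟨K, hK⟩ := φ.2.1.continuous.bounded_above_of_compact_support φ.2.2.1
    exact hf.bdd_mul (c := K) ((φ.2.1.continuous.comp (hs r)).aestronglyMeasurable)
      (Eventually.of_forall fun z => hK _)
  · exact (hf.1.mul ((hd.comp (hs r)).aestronglyMeasurable)).const_mul _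
  · refine Eventually.of_forall fun z r _ => ?_
    rw [norm_mul, norm_mul, Real.norm_eq_abs σ, mul_assoc, mul_comm C]
    gcongr
    exact hC _
  · exact hf.norm.const_mul _
  · refine Eventually.of_forall fun z r _ => ?_
    have h2 := hasDerivAt_timeDerivative φ.2.1 (z.1, z.2 + σ * r)
    have h3 : HasDerivAt (fun r => z.2 + σ * r) (σ * 1) r :=
      ((hasDerivAt_id r).const_mul σ).const_add _
    refine ((h2.comp r h3).mul_const (f z)).congr_deriv ?_
    ring

/-- Along translations the pairing with `u` has derivative -σζ(φ translated), which stays within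
‖ζ‖δ of the constant -σζ(φ). The mean value inequality compares the pairing at r = 0 and r = R, and
the contraction property bounds the latter. As φ tends to `u` the first and last terms cancel,
leaving a lower bound for σζ(u). -/
theorem IsWeakStart.shift_estimate {hΩ : IsOpen Ω} (hb : Bornology.IsBounded Ω) {σ t₀ t₁ : ℝ}
    (h : IsDirection T σ t₀ t₁) {u : Y (cylinder Ω T)} {ζ : YDual (cylinder Ω T)}
    (hu : IsWeakStart hΩ T σ t₁ u ζ) (φ : testFunctions (cylinder Ω T)) {R δ : ℝ} (hR : 0 ≤ R)
    (hδ : ∀ r ∈ Icc 0 R, ‖shiftY hΩ (σ * r) φ - testY φ‖ ≤ δ) :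
    ⟪fnY (testY φ), fnY u⟫ - R * (σ * ζ (testY φ)) - ‖ζ‖ * δ * R ≤
      ‖fnY (testY φ)‖ * ‖fnY u‖ := by
  have hder : ∀ r ∈ Icc 0 R, HasDerivWithinAt
      (fun r => ⟪fnY (shiftY hΩ (σ * r) φ), fnY u⟫ + r * (σ * ζ (testY φ)))
      (-(σ * ζ (shiftY hΩ (σ * r) φ - testY φ))) (Icc 0 R) r := by
    intro r hr
    have h1 := ((hasDerivAt_inner_shiftY hΩ hb φ (fnY u) σ r).add
      ((hasDerivAt_id r).mul_const (σ * ζ (testY φ)))).hasDerivWithinAt (s := Icc 0 R)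
    -- The translate may leave the cylinder through the start, but its support moves away from t₁,
    -- so it remains an admissible test function.
    have h2 : ζ (shiftY hΩ (σ * r) φ) = _ := hu _ (timeShift_mem φ.2 (r := σ * r) (fun t ht => by
      have h3 := (h.reverse.after_inter.ge ht).2
      have h4 := h.mul_self
      have h5 : 0 < -σ * (t + σ * r - t₁) := h3
      have h6 : -σ * (t + σ * r - t₁) = -σ * (t - t₁) - (σ * σ) * r := by ring
      have h7 := hr.1
      show 0 < -σ * (t - t₁)
      rw [h6, h4] at h5
      linarith))
    refine h1.congr_deriv ?_
    rw [map_sub, h2]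
    ring
  have hbound : ∀ r ∈ Icc 0 R, ‖-(σ * ζ (shiftY hΩ (σ * r) φ - testY φ))‖ ≤ ‖ζ‖ * δ := by
    intro r hr
    rw [norm_neg, norm_mul, Real.norm_eq_abs σ, h.abs_eq, one_mul]
    exact (ζ.le_opNorm _).trans (by gcongr; exact hδ r hr)
  have h1 := (convex_Icc 0 R).norm_image_sub_le_of_norm_hasDerivWithin_le hder hbound
    (left_mem_Icc.2 hR) (right_mem_Icc.2 hR)
  have h2 : shiftY hΩ (σ * 0) φ = testY φ := by
    rw [← stripY_eq_testY hΩ φ (testFunctions_mono cylinder_subset_strip φ.2), shiftY]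
    congr 2
    funext z
    simp [timeShift]
  rw [h2, sub_zero, Real.norm_eq_abs, Real.norm_of_nonneg hR, zero_mul, add_zero] at h1
  have h3 := (abs_le.1 h1).1
  have h4 : ⟪fnY (shiftY hΩ (σ * R) φ), fnY u⟫ ≤ ‖fnY (testY φ)‖ * ‖fnY u‖ :=
    (real_inner_le_norm _ _).trans (by gcongr; exact norm_fnY_shiftY_le hΩ _ φ)
  linarith

/-- The time derivative is monotone on the functions that vanish at the start. -/
theorem IsWeakStart.nonneg {hΩ : IsOpen Ω} (hb : Bornology.IsBounded Ω) {σ t₀ t₁ : ℝ}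
    (h : IsDirection T σ t₀ t₁) {u : Y (cylinder Ω T)} {ζ : YDual (cylinder Ω T)}
    (hu : IsWeakStart hΩ T σ t₁ u ζ) : 0 ≤ σ * ζ u := by
  obtain ⟨φ, hφ⟩ := exists_seq_testY u
  have key : ∀ ε > 0, -(σ * ζ u) ≤ ‖ζ‖ * (3 * ε) := by
    intro ε hε
    obtain ⟨m, hm⟩ := ((tendsto_iff_norm_sub_tendsto_zero.1 hφ).eventually_lt_const hε).exists
    have h1 : Tendsto (fun r => ‖shiftY hΩ (σ * r) (φ m) - testY (φ m)‖) (𝓝 0) (𝓝 0) := by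
      rw [← tendsto_iff_norm_sub_tendsto_zero]
      refine (tendsto_shiftY hΩ hb (φ m)).comp ?_
      have : Tendsto (fun r => σ * r) (𝓝 0) (𝓝 (σ * 0)) := tendsto_id.const_mul σ
      rwa [mul_zero] at this
    obtain ⟨R, hR, hball⟩ := Metric.eventually_nhds_iff.1 (h1.eventually_lt_const hε)
    have h2 : ∀ r ∈ Icc 0 (R / 2), ‖shiftY hΩ (σ * r) (φ m) - testY (φ m)‖ ≤ ε := by
      intro r hr
      refine (hball ?_).le
      rw [dist_zero_right, Real.norm_of_nonneg hr.1]
      linarith [hr.2]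
    -- The continuity of translations is used for the single function φ m only. Contractivity
    -- transfers it to every φ n with the same R, as is needed to let n tend to infinity with R
    -- fixed.
    have h3 : ∀ n, ∀ r ∈ Icc 0 (R / 2), ‖shiftY hΩ (σ * r) (φ n) - testY (φ n)‖ ≤
        2 * ‖testY (φ n) - testY (φ m)‖ + ε := by
      intro n r hr
      have h4 : shiftY hΩ (σ * r) (φ n) - testY (φ n) = shiftY hΩ (σ * r) (φ n - φ m) +
          (shiftY hΩ (σ * r) (φ m) - testY (φ m)) - testY (φ n - φ m) := by
        rw [shiftY_sub, testY_sub]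
        abel
      have h5 := norm_shiftY_le hΩ (σ * r) (φ n - φ m)
      have h6 := h2 r hr
      rw [h4]
      refine (norm_sub_le _ _).trans ?_
      rw [← testY_sub]
      linarith [norm_add_le (shiftY hΩ (σ * r) (φ n - φ m))
        (shiftY hΩ (σ * r) (φ m) - testY (φ m))]
    have h4 := fun n => hu.shift_estimate hb h (φ n) (by positivity : 0 ≤ R / 2) (h3 n)
    have hfn : Tendsto (fun n => fnY (testY (φ n))) atTop (𝓝 (fnY u)) := (tendsto_Y_iff.1 hφ).1
    -- In the limit both sides contain ‖u‖², which cancels; dividing by R / 2 then removes R from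
    -- the estimate.
    have h5 : ⟪fnY u, fnY u⟫ - R / 2 * (σ * ζ u) - ‖ζ‖ * (2 * ‖u - testY (φ m)‖ + ε) * (R / 2) ≤
        ‖fnY u‖ * ‖fnY u‖ := by
      refine le_of_tendsto_of_tendsto' (b := atTop) ?_ ?_ h4
      · refine ((hfn.inner tendsto_const_nhds).sub
          ((((ζ.continuous.tendsto _).comp hφ).const_mul σ).const_mul _)).sub ?_
        exact ((((hφ.sub_const _).norm.const_mul 2).add_const ε).const_mul _).mul_const _
      · exact hfn.norm.mul_const _
    rw [real_inner_self_eq_norm_mul_norm] at h5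
    have h6 : ‖ζ‖ * (2 * ‖u - testY (φ m)‖ + ε) ≤ ‖ζ‖ * (3 * ε) := by
      gcongr
      rw [norm_sub_rev]
      linarith
    have h7 : R / 2 * (-(σ * ζ u)) ≤ R / 2 * (‖ζ‖ * (2 * ‖u - testY (φ m)‖ + ε)) := by linarith
    exact (le_of_mul_le_mul_left h7 (by positivity)).trans h6
  by_contra hneg
  push Not at hneg
  -- With this ε the right-hand side of `key` is at most half of the left-hand side, which
  -- contradicts the positivity of the latter.
  have h1 := key (-(σ * ζ u) / (6 * (‖ζ‖ + 1))) (by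
    have := norm_nonneg ζ
    have : 0 < -(σ * ζ u) := by linarith
    positivity)
  have h2 : ‖ζ‖ * (3 * (-(σ * ζ u) / (6 * (‖ζ‖ + 1)))) = (‖ζ‖ / (‖ζ‖ + 1)) * (-(σ * ζ u) / 2) := by
    have := norm_nonneg ζ
    field_simp
    ring
  have h3 : ‖ζ‖ / (‖ζ‖ + 1) ≤ 1 := by
    rw [div_le_one (by positivity)]
    linarith
  rw [h2] at h1
  nlinarith

end

section

variable {d : ℕ} {Ω : Set (Space d)} {T : ℝ}

/-! ### Fubini on the space-time cylinder -/

theorem restrict_cylinder (Ω : Set (Space d)) (T : ℝ) : volume.restrict (cylinder Ω T) =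
    (volume.restrict Ω).prod (volume.restrict (Ioo 0 T)) := by
  rw [cylinder, Measure.volume_eq_prod, Measure.prod_restrict]

theorem ae_ae_of_ae_cylinder {p : SpaceTime d → Prop}
    (h : ∀ᵐ z ∂(volume.restrict (cylinder Ω T)), p z) :
    ∀ᵐ t ∂(volume.restrict (Ioo 0 T)), ∀ᵐ x ∂(volume.restrict Ω), p (x, t) := by
  rw [restrict_cylinder] at h
  exact Measure.ae_ae_of_ae_prod
    ((Measure.measurePreserving_swap (μ := volume.restrict (Ioo 0 T))
      (ν := volume.restrict Ω)).quasiMeasurePreserving.ae h)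

theorem integral_cylinder {f : SpaceTime d → ℝ}
    (hf : Integrable f (volume.restrict (cylinder Ω T))) :
    ∫ z in cylinder Ω T, f z = ∫ t in Ioo 0 T, ∫ x in Ω, f (x, t) := by
  rw [restrict_cylinder] at hf ⊢
  exact integral_prod_symm f hf

theorem integral_cylinder' {f : SpaceTime d → ℝ}
    (hf : Integrable f (volume.restrict (cylinder Ω T))) :
    ∫ z in cylinder Ω T, f z = ∫ x in Ω, ∫ t in Ioo 0 T, f (x, t) := by
  rw [restrict_cylinder] at hf ⊢
  exact integral_prod f hf

theorem integrable_mul_L2 {α : Type*} [MeasureSpace α] {A : Set α} (f g : L2 A) :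
    Integrable (fun z => f z * g z) (volume.restrict A) :=
  (Lp.memLp f).integrable_mul (Lp.memLp g)

theorem integral_fderiv_eq_zero {φ : SpaceTime d → ℝ} (h : ContDiff ℝ 1 φ)
    (hc : HasCompactSupport φ) (v : SpaceTime d) : ∫ z, fderiv ℝ φ z v = 0 := by
  have hd : Differentiable ℝ φ := h.differentiable (by norm_num)
  have h1 : Continuous fun z => fderiv ℝ φ z v :=
    (h.continuous_fderiv (by norm_num)).clm_apply continuous_const
  have h2 : HasCompactSupport fun z => fderiv ℝ φ z v := hc.fderiv_apply ℝ v
  have h3 := integral_mul_fderiv_eq_neg_fderiv_mul_of_integrable (μ := volume)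
    (f := fun _ : SpaceTime d => (1 : ℝ)) (g := φ) (v := v) (by simp)
    (by simpa using h1.integrable_of_hasCompactSupport h2)
    (by simpa using h.continuous.integrable_of_hasCompactSupport hc)
    (fun _ _ => differentiableAt_const _) (fun x _ => hd x)
  simpa using h3

/-! ### The closure of the functions that vanish near the start -/

section graphClosure

variable {V H : Type*} [AddCommGroup V] [Module ℝ V] [NormedAddCommGroup H]
  [InnerProductSpace ℝ H]

/-- The closure of the set of the pairs `(f v, g v)`, where `v` runs through `S`. -/
def graphClosure (S : Submodule ℝ V) (f : V →ₗ[ℝ] H) (g : V →ₗ[ℝ] (H →L[ℝ] ℝ)) :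
    Submodule ℝ (H × (H →L[ℝ] ℝ)) := (S.map (f.prod g)).topologicalClosure

theorem isClosed_graphClosure (S : Submodule ℝ V) (f : V →ₗ[ℝ] H) (g : V →ₗ[ℝ] (H →L[ℝ] ℝ)) :
    IsClosed (graphClosure S f g : Set (H × (H →L[ℝ] ℝ))) :=
  Submodule.isClosed_topologicalClosure _

theorem mem_graphClosure {S : Submodule ℝ V} (f : V →ₗ[ℝ] H) (g : V →ₗ[ℝ] (H →L[ℝ] ℝ)) {v : V}
    (hv : v ∈ S) : (f v, g v) ∈ graphClosure S f g :=
  Submodule.le_topologicalClosure _ ⟨v, hv, rfl⟩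

theorem exists_seq_graphClosure {S : Submodule ℝ V} {f : V →ₗ[ℝ] H} {g : V →ₗ[ℝ] (H →L[ℝ] ℝ)}
    {x : H × (H →L[ℝ] ℝ)} (hx : x ∈ graphClosure S f g) :
    ∃ v : ℕ → V, (∀ n, v n ∈ S) ∧ Tendsto (fun n => (f (v n), g (v n))) atTop (𝓝 x) := by
  obtain ⟨y, hy, hlim⟩ := mem_closure_iff_seq_limit.1
    (show x ∈ closure ((S.map (f.prod g) : Submodule ℝ _) : Set (H × (H →L[ℝ] ℝ))) from hx)
  choose v hv using hy
  exact ⟨v, fun n => (hv n).1, hlim.congr fun n => (hv n).2.symm⟩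

end graphClosure

/-- The closure of the set of the pairs `(φ, σ ∂ₜφ)`, where `φ` is a test function that vanishes
near the start (for the direction `σ` of time) but need not vanish near the end. -/
def startGraph (hΩ : IsOpen Ω) (T σ t₀ : ℝ) :
    Submodule ℝ (Y (cylinder Ω T) × YDual (cylinder Ω T)) :=
  graphClosure ((testFunctions (Ω ×ˢ after σ t₀)).comap
    (testFunctions (Ω ×ˢ (univ : Set ℝ))).subtype) (stripY hΩ T)
    (σ • ((toDualL (cylinder Ω T) : _ →ₗ[ℝ] _).comp (stripDt Ω T)))

theorem isClosed_startGraph (hΩ : IsOpen Ω) (T σ t₀ : ℝ) :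
    IsClosed (startGraph hΩ T σ t₀ : Set (Y (cylinder Ω T) × YDual (cylinder Ω T))) :=
  isClosed_graphClosure _ _ _

theorem mem_startGraph (hΩ : IsOpen Ω) (T : ℝ) {σ t₀ : ℝ}
    (φ : testFunctions (Ω ×ˢ (univ : Set ℝ))) (hφ : φ.1 ∈ testFunctions (Ω ×ˢ after σ t₀)) :
    (stripY hΩ T φ, σ • toDualL (cylinder Ω T) (stripDt Ω T φ)) ∈ startGraph hΩ T σ t₀ :=
  mem_graphClosure _ _ hφ

theorem exists_seq_startGraph {hΩ : IsOpen Ω} {σ t₀ : ℝ}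
    {x : Y (cylinder Ω T) × YDual (cylinder Ω T)} (hx : x ∈ startGraph hΩ T σ t₀) :
    ∃ φ : ℕ → testFunctions (Ω ×ˢ (univ : Set ℝ)),
      (∀ n, (φ n).1 ∈ testFunctions (Ω ×ˢ after σ t₀)) ∧
      Tendsto (fun n => (stripY hΩ T (φ n), σ • toDualL (cylinder Ω T) (stripDt Ω T (φ n)))) atTop
        (𝓝 x) :=
  exists_seq_graphClosure hx

theorem mul_mem_testFunctions {J J' : Set ℝ} {φ ψ : SpaceTime d → ℝ}
    (hφ : φ ∈ testFunctions (Ω ×ˢ J)) (hψ : ψ ∈ testFunctions (Ω ×ˢ J')) :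
    (fun z => φ z * ψ z) ∈ testFunctions (Ω ×ˢ (J ∩ J')) := by
  refine ⟨hφ.1.mul hψ.1, hφ.2.1.mul_right, fun z hz => ?_⟩
  have h1 := hφ.2.2 (tsupport_mul_subset_left hz)
  have h2 := hψ.2.2 (tsupport_mul_subset_right (f := φ) hz)
  exact ⟨h1.1, h1.2, h2.2⟩

/-- One factor vanishes near the start and the other near the end, so the product is a test function
on the cylinder and its time derivative integrates to zero. -/
theorem inner_stripDt_comm (hΩ : IsOpen Ω) {σ t₀ t₁ : ℝ} (h : IsDirection T σ t₀ t₁)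
    (φ ψ : testFunctions (Ω ×ˢ (univ : Set ℝ))) (hφ : φ.1 ∈ testFunctions (Ω ×ˢ after σ t₀))
    (hψ : ψ.1 ∈ testFunctions (Ω ×ˢ after (-σ) t₁)) :
    ⟪stripDt Ω T φ, fnY (stripY hΩ T ψ)⟫ = -⟪stripDt Ω T ψ, fnY (stripY hΩ T φ)⟫ := by
  have hp := mul_mem_testFunctions hψ hφ
  rw [h.after_inter] at hp
  have h0 : ∫ z in cylinder Ω T, timeDerivative (fun z => ψ.1 z * φ.1 z) z = 0 := by
    rw [setIntegral_eq_integral_of_forall_compl_eq_zero]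
    · simp_rw [timeDerivative_eq hp.1]
      exact integral_fderiv_eq_zero hp.1 hp.2.1 _
    · intro z hz
      rw [timeDerivative_eq hp.1, fderiv_of_notMem_tsupport (𝕜 := ℝ) fun h => hz (hp.2.2 h)]
      rfl
  have h1 : ⟪stripDt Ω T φ, fnY (stripY hΩ T ψ)⟫ + ⟪stripDt Ω T ψ, fnY (stripY hΩ T φ)⟫ = 0 := by
    rw [← h0, inner_L2, inner_L2, ← integral_add]
    · refine integral_congr_ae ?_
      filter_upwards [stripDt_ae φ, stripDt_ae ψ, stripY_ae hΩ T φ, stripY_ae hΩ T ψ]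
        with z h1 h2 h3 h4
      rw [h1, h2, h3.1, h4.1, timeDerivative_mul ψ.2.1 φ.2.1]
      ring
    · exact integrable_mul_L2 _ _
    · exact integrable_mul_L2 _ _
  linarith

/-- Integration by parts on the generating pairs, which survives limits because both sides are
continuous for the graph norm. As σ² = 1, the factor σ recovers the time derivative itself. -/
theorem isWeakStart_of_mem_startGraph {hΩ : IsOpen Ω} {σ t₀ t₁ : ℝ} (h : IsDirection T σ t₀ t₁)
    {x : Y (cylinder Ω T) × YDual (cylinder Ω T)} (hx : x ∈ startGraph hΩ T σ t₀) :
    IsWeakStart hΩ T σ t₁ x.1 (σ • x.2) := by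
  intro ψ hψ
  obtain ⟨φ, hφ, hlim⟩ := exists_seq_startGraph hx
  have h1 : Tendsto (fun n => stripY hΩ T (φ n)) atTop (𝓝 x.1) :=
    (continuous_fst.tendsto x).comp hlim
  have h2 : Tendsto (fun n => σ • toDualL (cylinder Ω T) (stripDt Ω T (φ n))) atTop (𝓝 x.2) :=
    (continuous_snd.tendsto x).comp hlim
  refine tendsto_nhds_unique
    (((ContinuousLinearMap.apply ℝ ℝ (stripY hΩ T ψ)).continuous.tendsto _).comp
      (h2.const_smul σ)) (((tendsto_const_nhds.inner (tendsto_Y_iff.1 h1).1).neg).congr fun n => ?_)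
  rw [← inner_stripDt_comm hΩ h (φ n) ψ (hφ n) hψ]
  show _ = σ * (σ * ⟪stripDt Ω T (φ n), fnY (stripY hΩ T ψ)⟫)
  rw [← mul_assoc, h.mul_self, one_mul]

/-- Tested on the generating pairs alone, the adjoint relation is already weak vanishing for
reversed time. Its monotonicity thus follows from the same theorem, and the adjoint need not be
identified as a closure of smooth functions. -/
theorem startGraph_adjoint {hΩ : IsOpen Ω} {σ t₀ t₁ : ℝ} (h : IsDirection T σ t₀ t₁)
    {w : Y (cylinder Ω T)} {η : YDual (cylinder Ω T)}
    (hw : ∀ x ∈ startGraph hΩ T σ t₀, x.2 w = -η x.1) :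
    IsWeakStart hΩ T (-σ) t₀ w (σ • η) := by
  intro φ hφ
  rw [neg_neg] at hφ
  have h1 := hw _ (mem_startGraph hΩ T φ hφ)
  have h2 : σ * ⟪stripDt Ω T φ, fnY w⟫ = -η (stripY hΩ T φ) := h1
  show σ * η (stripY hΩ T φ) = -⟪stripDt Ω T φ, fnY w⟫
  have h3 := h.mul_self
  linear_combination σ * h2 - ⟪stripDt Ω T φ, fnY w⟫ * h3

/-- Solvability of the evolution equation, in both directions of time. -/
theorem exists_startGraph_solution {hΩ : IsOpen Ω} (hb : Bornology.IsBounded Ω) {σ t₀ t₁ : ℝ}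
    (h : IsDirection T σ t₀ t₁) (B : Y (cylinder Ω T) →L[ℝ] Y (cylinder Ω T) →L[ℝ] ℝ) {c : ℝ}
    (hc : 0 < c) (hB : ∀ u, c * ‖u‖ ^ 2 ≤ B u u) (F : YDual (cylinder Ω T)) :
    ∃ x ∈ startGraph hΩ T σ t₀, x.2 + B x.1 = F := by
  refine exists_mem_add_eq _ (isClosed_startGraph hΩ T σ t₀) ?_ ?_ B hc hB F
  · intro x hx
    have h1 := (isWeakStart_of_mem_startGraph h hx).nonneg hb h
    rwa [smul_apply, smul_eq_mul, ← mul_assoc, h.mul_self, one_mul] at h1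
  · intro w η hw
    have h1 := (startGraph_adjoint h hw).nonneg hb h.reverse
    rw [smul_apply, smul_eq_mul, ← mul_assoc, neg_mul, h.mul_self] at h1
    linarith

/-! ### Values at a fixed time -/

theorem isFiniteMeasure_restrict (hb : Bornology.IsBounded Ω) :
    IsFiniteMeasure (volume.restrict Ω) :=
  ⟨by rw [Measure.restrict_apply_univ]; exact hb.measure_lt_top⟩

theorem hasCompactSupport_slice {φ : SpaceTime d → ℝ} (hφ : HasCompactSupport φ) (t : ℝ) :
    HasCompactSupport fun x => φ (x, t) := by
  have h1 : IsClosedEmbedding fun x : Space d => (x, t) :=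
    ⟨isEmbedding_prodMkLeft t, by
      have : range (fun x : Space d => (x, t)) = univ ×ˢ {t} := by
        ext ⟨x, s⟩
        simp [eq_comm]
      rw [this]
      exact isClosed_univ.prod isClosed_singleton⟩
  exact hφ.comp_isClosedEmbedding h1

theorem memLp_slice {Q : Set (SpaceTime d)} {φ : SpaceTime d → ℝ} (hφ : φ ∈ testFunctions Q)
    (t : ℝ) {p : ℝ≥0∞} : MemLp (fun x => φ (x, t)) p (volume.restrict Ω) :=
  (hφ.1.continuous.comp (continuous_id.prodMk continuous_const)).memLp_of_hasCompactSupport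
    (hasCompactSupport_slice hφ.2.1 t)

/-- The value of a test function at time `t`. -/
def slice (Ω : Set (Space d)) (t : ℝ) (φ : testFunctions (Ω ×ˢ (univ : Set ℝ))) : L2 Ω :=
  (memLp_slice φ.2 t).toLp _

theorem slice_ae (t : ℝ) (φ : testFunctions (Ω ×ˢ (univ : Set ℝ))) :
    ∀ᵐ x ∂(volume.restrict Ω), slice Ω t φ x = φ.1 (x, t) := MemLp.coeFn_toLp (memLp_slice φ.2 t)

theorem slice_sub (t : ℝ) (φ ψ : testFunctions (Ω ×ˢ (univ : Set ℝ))) :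
    slice Ω t (φ - ψ) = slice Ω t φ - slice Ω t ψ := rfl

theorem continuous_slice (hb : Bornology.IsBounded Ω) (φ : testFunctions (Ω ×ˢ (univ : Set ℝ))) :
    Continuous fun t => slice Ω t φ := by
  have := isFiniteMeasure_restrict hb
  rw [continuous_iff_seqContinuous]
  intro s t hs
  obtain ⟨C, hC⟩ := φ.2.1.continuous.bounded_above_of_compact_support φ.2.2.1
  have hae : ∀ᵐ x ∂(volume.restrict Ω), ∀ n, slice Ω (s n) φ x - slice Ω t φ x =
      φ.1 (x, s n) - φ.1 (x, t) := by
    filter_upwards [ae_all_iff.2 fun n => slice_ae (s n) φ, slice_ae t φ] with x h1 h2 n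
    rw [h1, h2]
  refine tendsto_Lp_two_of_dominated (bound := fun _ => C + C) (memLp_const _) ?_ ?_
  · refine Eventually.of_forall fun n => ?_
    filter_upwards [hae] with x hx
    rw [Function.comp_apply, hx]
    exact (norm_sub_le _ _).trans (add_le_add (hC _) (hC _))
  · filter_upwards [hae] with x hx
    simp_rw [Function.comp_apply, hx]
    rw [← tendsto_iff_norm_sub_tendsto_zero]
    exact (φ.2.1.continuous.tendsto (x, t)).comp (tendsto_const_nhds.prodMk_nhds hs)

theorem IsDirection.intervalIntegral_eq {σ t₀ t₁ : ℝ} (h : IsDirection T σ t₀ t₁) {t : ℝ}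
    (ht : t ∈ Icc 0 T) (f : ℝ → ℝ) :
    ∫ s in t₀..t, f s = σ * ∫ s in Ioo (min t₀ t) (max t₀ t), f s := by
  rcases h with ⟨rfl, rfl, rfl⟩ | ⟨rfl, rfl, rfl⟩
  · rw [min_eq_left ht.1, max_eq_right ht.1, intervalIntegral.integral_of_le ht.1,
      integral_Ioc_eq_integral_Ioo, one_mul]
  · rw [min_eq_right ht.2, max_eq_left ht.2, intervalIntegral.integral_of_ge ht.2,
      integral_Ioc_eq_integral_Ioo, neg_one_mul]

theorem eq_zero_at_start {σ t₀ : ℝ} {φ : SpaceTime d → ℝ}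
    (hφ : φ ∈ testFunctions (Ω ×ˢ after σ t₀)) (x : Space d) : φ (x, t₀) = 0 := by
  refine image_eq_zero_of_notMem_tsupport fun h => ?_
  have h1 : 0 < σ * (t₀ - t₀) := (hφ.2.2 h).2
  simp at h1

/-- Energy estimate: integrate ∂ₜ(φ²/2) from t₀ to t, where t₀ contributes nothing. To involve only
the dual norm of ∂ₜφ, the time integral is read as the pairing of ∂ₜφ with φ restricted to the times
between t₀ and t. This restriction lies in `Y` and has no larger norm than φ. -/
theorem norm_slice_sq_le (hΩ : IsOpen Ω) (hT : 0 < T) {σ t₀ t₁ : ℝ} (h : IsDirection T σ t₀ t₁)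
    (φ : testFunctions (Ω ×ˢ (univ : Set ℝ))) (hφ : φ.1 ∈ testFunctions (Ω ×ˢ after σ t₀))
    {t : ℝ} (ht : t ∈ Icc 0 T) :
    ‖slice Ω t φ‖ ^ 2 ≤
      2 * (‖σ • toDualL (cylinder Ω T) (stripDt Ω T φ)‖ * ‖stripY hΩ T φ‖) := by
  set I := Ioo (min t₀ t) (max t₀ t) with hI
  have ht₀ := h.mem_Icc hT
  obtain ⟨y, hy⟩ := exists_Y_indicator (T := T) φ (le_min ht₀.1 ht.1) (max_le ht₀.2 ht.2)
  have hIT : I ⊆ Ioo 0 T := Ioo_subset_Ioo (le_min ht₀.1 ht.1) (max_le ht₀.2 ht.2)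
  have hynorm : ‖y‖ ≤ ‖stripY hΩ T φ‖ := by
    refine le_of_sq_le_sq ?_ (norm_nonneg _)
    rw [norm_sq_Y, norm_sq_Y]
    have key : ∀ {E : Type} [NormedAddCommGroup E] [InnerProductSpace ℝ E]
        (f g : Lp E 2 (volume.restrict (cylinder Ω T))) (e : SpaceTime d → E),
        (∀ᵐ z ∂(volume.restrict (cylinder Ω T)), f z = I.indicator (fun _ => e z) z.2) →
        (∀ᵐ z ∂(volume.restrict (cylinder Ω T)), g z = e z) → ‖f‖ ≤ ‖g‖ := by
      intro E _ _ f g e hf hg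
      refine Lp.norm_le_norm_of_ae_le ?_
      filter_upwards [hf, hg] with z h1 h2
      rw [h1, h2]
      exact norm_indicator_le_norm_self _ _
    gcongr
    · exact key _ _ φ.1 (hy.mono fun z hz => hz.1) ((stripY_ae hΩ T φ).mono fun z hz => hz.1)
    · exact key _ _ (spatialGradient φ.1) (hy.mono fun z hz => hz.2)
        ((stripY_ae hΩ T φ).mono fun z hz => hz.2)
  have hint : Integrable (fun z => stripDt Ω T φ z * fnY y z)
      (volume.restrict (cylinder Ω T)) := integrable_mul_L2 _ _
  have hae : (fun z => stripDt Ω T φ z * fnY y z) =ᵐ[volume.restrict (cylinder Ω T)]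
      fun z => I.indicator (fun s => φ.1 (z.1, s) * timeDerivative φ.1 (z.1, s)) z.2 := by
    filter_upwards [stripDt_ae φ, hy] with z h1 h2
    rw [h1, h2.1]
    by_cases hz : z.2 ∈ I
    · rw [indicator_of_mem hz, indicator_of_mem hz]
      exact mul_comm _ _
    · rw [indicator_of_notMem hz, indicator_of_notMem hz, mul_zero]
  have hx : ∀ x : Space d, σ * ∫ s in Ioo 0 T, I.indicator (fun s => φ.1 (x, s) *
      timeDerivative φ.1 (x, s)) s = 1 / 2 * φ.1 (x, t) ^ 2 := by
    intro x
    rw [setIntegral_indicator measurableSet_Ioo, inter_eq_right.2 hIT,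
      ← h.intervalIntegral_eq ht]
    have h2 : ∀ s, HasDerivAt (fun s => 1 / 2 * φ.1 (x, s) ^ 2)
        (φ.1 (x, s) * timeDerivative φ.1 (x, s)) s := by
      intro s
      have h3 := ((hasDerivAt_timeDerivative φ.2.1 (x, s)).pow 2).const_mul (1 / 2)
      refine h3.congr_deriv ?_
      simp
      ring
    have hcs : Continuous fun s : ℝ => (x, s) := by fun_prop
    rw [intervalIntegral.integral_eq_sub_of_hasDerivAt (fun s _ => h2 s)
      (((φ.2.1.continuous.comp hcs).mul
        ((continuous_timeDerivative φ.2.1).comp hcs)).intervalIntegrable _ _),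
      eq_zero_at_start hφ]
    ring
  have hval : σ * ⟪stripDt Ω T φ, fnY y⟫ = 1 / 2 * ‖slice Ω t φ‖ ^ 2 := by
    rw [inner_L2, integral_congr_ae hae, integral_cylinder' (hint.congr hae), ← integral_const_mul,
      norm_sq_eq_integral, ← integral_const_mul]
    refine integral_congr_ae ?_
    filter_upwards [slice_ae t φ] with x hx'
    rw [hx x, hx', Real.norm_eq_abs, sq_abs]
  have h3 : σ * ⟪stripDt Ω T φ, fnY y⟫ ≤
      ‖σ • toDualL (cylinder Ω T) (stripDt Ω T φ)‖ * ‖stripY hΩ T φ‖ :=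
    calc σ * ⟪stripDt Ω T φ, fnY y⟫ = (σ • toDualL (cylinder Ω T) (stripDt Ω T φ)) y := rfl
      _ ≤ ‖(σ • toDualL (cylinder Ω T) (stripDt Ω T φ)) y‖ := le_abs_self _
      _ ≤ ‖σ • toDualL (cylinder Ω T) (stripDt Ω T φ)‖ * ‖y‖ := ContinuousLinearMap.le_opNorm _ _
      _ ≤ _ := by gcongr
  linarith

end

/-! ### Continuous representatives in time and the initial condition -/

section

variable {d : ℕ} {Ω : Set (Space d)} {T : ℝ}

theorem norm_slice_le_graph (hΩ : IsOpen Ω) (hT : 0 < T) {σ t₀ t₁ : ℝ}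
    (h : IsDirection T σ t₀ t₁) (φ : testFunctions (Ω ×ˢ (univ : Set ℝ)))
    (hφ : φ.1 ∈ testFunctions (Ω ×ˢ after σ t₀)) {t : ℝ} (ht : t ∈ Icc 0 T) :
    ‖slice Ω t φ‖ ≤
      2 * ‖(stripY hΩ T φ, σ • toDualL (cylinder Ω T) (stripDt Ω T φ))‖ := by
  have h1 := norm_slice_sq_le hΩ hT h φ hφ ht
  set y := (stripY hΩ T φ, σ • toDualL (cylinder Ω T) (stripDt Ω T φ))
  have h2 : ‖y.1‖ ≤ ‖y‖ := norm_fst_le y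
  have h3 : ‖y.2‖ ≤ ‖y‖ := norm_snd_le y
  have h4 : ‖y.2‖ * ‖y.1‖ ≤ ‖y‖ * ‖y‖ := by gcongr
  refine le_of_sq_le_sq ?_ (by positivity)
  calc ‖slice Ω t φ‖ ^ 2 ≤ 2 * (‖y.2‖ * ‖y.1‖) := h1
    _ ≤ (2 * ‖y‖) ^ 2 := by nlinarith [norm_nonneg y]

/-- Control of the differences by a convergent sequence makes the functions uniformly Cauchy on `I`;
with the energy estimate this yields the continuous representative. -/
theorem exists_tendstoUniformlyOn {W G : Type*} [NormedAddCommGroup W] [NormedAddCommGroup G]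
    [CompleteSpace G] {y : ℕ → W} {x : W} (hlim : Tendsto y atTop (𝓝 x)) {s : ℕ → ℝ → G}
    {I : Set ℝ} {C : ℝ} (hs : ∀ n m, ∀ t ∈ I, ‖s n t - s m t‖ ≤ C * ‖y n - y m‖) :
    ∃ V : ℝ → G, TendstoUniformlyOn s V atTop I := by
  have h0 : UniformCauchySeqOn s atTop I := by
    rw [Metric.uniformCauchySeqOn_iff]
    intro ε hε
    obtain ⟨N, hN⟩ := Metric.cauchySeq_iff.1 hlim.cauchySeq (ε / (|C| + 1)) (by positivity)
    refine ⟨N, fun m hm n hn t ht => ?_⟩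
    have h1 := hN m hm n hn
    rw [dist_eq_norm] at h1 ⊢
    calc ‖s m t - s n t‖ ≤ C * ‖y m - y n‖ := hs m n t ht
      _ ≤ (|C| + 1) * ‖y m - y n‖ := by gcongr; linarith [le_abs_self C]
      _ < (|C| + 1) * (ε / (|C| + 1)) := by gcongr
      _ = ε := by field_simp
  have hex : ∀ t, ∃ v : G, t ∈ I → Tendsto (fun n => s n t) atTop (𝓝 v) := by
    intro t
    by_cases ht : t ∈ I
    · obtain ⟨v, hv⟩ := cauchySeq_tendsto_of_complete (h0.cauchySeq ht)
      exact ⟨v, fun _ => hv⟩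
    · exact ⟨0, fun h => absurd h ht⟩
  choose V hV using hex
  exact ⟨V, h0.tendstoUniformlyOn_of_tendsto hV⟩

/-- The limits of test functions that vanish near the start have a representative that is
continuous in time and vanishes at the start. -/
theorem exists_trace {hΩ : IsOpen Ω} (hb : Bornology.IsBounded Ω) (hT : 0 < T) {σ t₀ t₁ : ℝ}
    (h : IsDirection T σ t₀ t₁) {x : Y (cylinder Ω T) × YDual (cylinder Ω T)}
    (hx : x ∈ startGraph hΩ T σ t₀) :
    ∃ V : ℝ → L2 Ω, ContinuousOn V (Icc 0 T) ∧
      (∀ᵐ t ∂(volume.restrict (Ioo 0 T)), ∀ᵐ y ∂(volume.restrict Ω), V t y = fnY x.1 (y, t)) ∧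
      V t₀ = 0 := by
  obtain ⟨φ, hφ, hlim⟩ := exists_seq_startGraph hx
  set y : ℕ → Y (cylinder Ω T) × YDual (cylinder Ω T) :=
    fun n => (stripY hΩ T (φ n), σ • toDualL (cylinder Ω T) (stripDt Ω T (φ n))) with hy
  have hdiff : ∀ n m, ∀ t ∈ Icc 0 T, ‖slice Ω t (φ n) - slice Ω t (φ m)‖ ≤ 2 * ‖y n - y m‖ := by
    intro n m t ht
    rw [← slice_sub]
    refine (norm_slice_le_graph hΩ hT h (φ n - φ m) (Submodule.sub_mem _ (hφ n) (hφ m)) ht).trans_eq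
      ?_
    simp only [hy, Prod.mk_sub_mk, map_sub, smul_sub]
  obtain ⟨V, hunif⟩ := exists_tendstoUniformlyOn (W := Y (cylinder Ω T) × YDual (cylinder Ω T))
    (s := fun n t => slice Ω t (φ n)) hlim hdiff
  have hV : ∀ t ∈ Icc 0 T, Tendsto (fun n => slice Ω t (φ n)) atTop (𝓝 (V t)) :=
    fun t ht => hunif.tendsto_at ht
  refine ⟨V, hunif.continuousOn (Eventually.of_forall fun n =>
    (continuous_slice hb (φ n)).continuousOn).frequently, ?_, ?_⟩
  · have h1 : Tendsto (fun n => fnY (stripY hΩ T (φ n))) atTop (𝓝 (fnY x.1)) :=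
      (tendsto_Y_iff.1 ((continuous_fst.tendsto x).comp hlim)).1
    -- Two extractions: a subsequence converges a.e. on the cylinder, hence on almost every slice;
    -- for each such t a further one converges a.e. to V t. The two limits then agree a.e. in space.
    obtain ⟨ns, hns, hae⟩ := (tendstoInMeasure_of_tendsto_Lp h1).exists_seq_tendsto_ae
    have hae' : ∀ᵐ z ∂(volume.restrict (cylinder Ω T)),
        Tendsto (fun n => (φ (ns n)).1 z) atTop (𝓝 (fnY x.1 z)) := by
      filter_upwards [hae, ae_all_iff.2 fun n => stripY_ae hΩ T (φ (ns n))] with z h2 h3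
      refine h2.congr fun n => (h3 n).1
    filter_upwards [ae_ae_of_ae_cylinder hae', ae_restrict_mem measurableSet_Ioo] with t h2 ht
    have h3 := (hV t (Ioo_subset_Icc_self ht)).comp hns.tendsto_atTop
    obtain ⟨ms, hms, hae2⟩ := (tendstoInMeasure_of_tendsto_Lp h3).exists_seq_tendsto_ae
    filter_upwards [hae2, h2, ae_all_iff.2 fun n => slice_ae (Ω := Ω) t (φ (ns (ms n)))]
      with z h4 h5 h6
    refine tendsto_nhds_unique h4 ((h5.comp hms.tendsto_atTop).congr fun n => (h6 n).symm)
  · refine tendsto_nhds_unique (hV t₀ (h.mem_Icc hT)) (tendsto_const_nhds.congr fun n => ?_)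
    refine Lp.ext ?_
    filter_upwards [slice_ae (Ω := Ω) t₀ (φ n), Lp.coeFn_zero ℝ 2 (volume.restrict Ω)] with z h1 h2
    rw [h1, h2, eq_zero_at_start (hφ n)]
    rfl

/-! ### Functions with vanishing trace vanish weakly -/

/-- A smooth cutoff function that vanishes near the start. -/
def startCutoff (σ t₀ : ℝ) (n : ℕ) (t : ℝ) : ℝ := ramp 0 n (σ * (t - t₀))

theorem contDiff_startCutoff (σ t₀ : ℝ) (n : ℕ) : ContDiff ℝ 1 (startCutoff σ t₀ n) :=
  (contDiff_ramp 0 n).comp (by fun_prop)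

theorem startCutoff_mul_mem {σ t₀ : ℝ} {J : Set ℝ} {φ : SpaceTime d → ℝ}
    (hφ : φ ∈ testFunctions (Ω ×ˢ J)) (n : ℕ) :
    (fun z => startCutoff σ t₀ n z.2 * φ z) ∈ testFunctions (Ω ×ˢ (J ∩ after σ t₀)) := by
  refine timeMul_mem hφ (contDiff_startCutoff σ t₀ n) fun t ht => ?_
  have h1 : Continuous fun t => σ * (t - t₀) := by fun_prop
  exact tsupport_ramp_subset _ _ (tsupport_comp_subset_preimage (ramp 0 n) h1 ht)

/-- Since |σ| = 1, the window of the rescaled ramp becomes a ball about t₀ of radius 2/(n+1), with a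
constant independent of t₀ and n. -/
theorem deriv_startCutoff {σ : ℝ} (hσ : |σ| = 1) : ∃ C : ℝ, 0 ≤ C ∧ ∀ (t₀ : ℝ) (n : ℕ) (t : ℝ),
    |deriv (startCutoff σ t₀ n) t| ≤
      (Metric.closedBall t₀ (2 / (n + 1))).indicator (fun _ => C * (n + 1)) t := by
  obtain ⟨C, hC0, hC⟩ := deriv_ramp_bound
  refine ⟨C, hC0, fun t₀ n t => ?_⟩
  have h1 : HasDerivAt (fun t => σ * (t - t₀)) (σ * 1) t :=
    ((hasDerivAt_id t).sub_const t₀).const_mul σ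
  have h2 : deriv (startCutoff σ t₀ n) t = deriv (ramp 0 n) (σ * (t - t₀)) * (σ * 1) :=
    ((((contDiff_ramp 0 n).differentiable (by norm_num)) _).hasDerivAt.comp t h1).deriv
  rw [h2, abs_mul, mul_one, hσ, mul_one]
  refine (hC 0 n _).trans ?_
  by_cases h3 : σ * (t - t₀) ∈ {t : ℝ | 0 < t - 0 ∧ (n + 1) * (t - 0) ≤ 2}
  · rw [indicator_of_mem h3, indicator_of_mem]
    obtain ⟨h4, h5⟩ := h3
    rw [sub_zero] at h4 h5
    have h6 : |t - t₀| = σ * (t - t₀) := by rw [← abs_of_pos h4, abs_mul, hσ, one_mul]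
    rw [Metric.mem_closedBall, Real.dist_eq, h6, le_div_iff₀ (by positivity)]
    linarith
  · rw [indicator_of_notMem h3]
    exact indicator_nonneg (fun _ _ => by positivity) _

theorem tendsto_startCutoff {σ t₀ t : ℝ} (ht : t ∈ after σ t₀) :
    ∀ᶠ n in atTop, startCutoff σ t₀ n t = 1 := by
  filter_upwards [tendsto_ramp 0 (σ * (t - t₀))] with n hn
  rw [startCutoff, hn, indicator_of_mem (show σ * (t - t₀) ∈ Ioi 0 from ht)]

/-- The derivative is of order n on a window of length of order 1/n, so its integral stays bounded,
while `g` is small near t₀. -/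
theorem tendsto_integral_deriv_startCutoff (hT : 0 < T) {σ t₀ t₁ : ℝ}
    (h : IsDirection T σ t₀ t₁) {g : ℝ → ℝ} (hg : ContinuousOn g (Icc 0 T)) (hg0 : g t₀ = 0) :
    Tendsto (fun n => ∫ t in Ioo 0 T, deriv (startCutoff σ t₀ n) t * g t) atTop (𝓝 0) := by
  obtain ⟨C, hC0, hC⟩ := deriv_startCutoff h.abs_eq
  rw [Metric.tendsto_atTop]
  intro ε hε
  -- The window has length 4/(n+1) and the derivative is at most C(n+1), so this tolerance gives
  -- C/(C+1) · ε/2; the 1 in C + 1 allows C = 0.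
  obtain ⟨δ, hδ, hball⟩ := Metric.continuousOn_iff.1 hg t₀ (h.mem_Icc hT) (ε / (8 * (C + 1)))
    (by positivity)
  obtain ⟨N, hN⟩ := exists_nat_gt (2 / δ)
  refine ⟨N, fun n hn => ?_⟩
  have hn1 : (0 : ℝ) < n + 1 := by positivity
  have hr : 2 / ((n : ℝ) + 1) < δ := by
    rw [div_lt_iff₀ hn1]
    rw [div_lt_iff₀ hδ] at hN
    have : (N : ℝ) ≤ n := by exact_mod_cast hn
    nlinarith
  set r := 2 / ((n : ℝ) + 1) with hrdef
  set K := C * (n + 1) * (ε / (8 * (C + 1))) with hK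
  have hK0 : 0 ≤ K := by positivity
  have hint : Integrable ((Metric.closedBall t₀ r).indicator fun _ => K) :=
    (integrable_indicator_iff Metric.isClosed_closedBall.measurableSet).2
      (integrableOn_const (measure_closedBall_lt_top.ne))
  have hbd : ∀ t ∈ Ioo 0 T, ‖deriv (startCutoff σ t₀ n) t * g t‖ ≤
      (Metric.closedBall t₀ r).indicator (fun _ => K) t := by
    intro t ht
    rw [norm_mul, Real.norm_eq_abs]
    have h1 := hC t₀ n t
    by_cases h2 : t ∈ Metric.closedBall t₀ r
    · rw [indicator_of_mem h2] at h1 ⊢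
      have h3 := hball t (Ioo_subset_Icc_self ht) (lt_of_le_of_lt h2 hr)
      rw [hg0, dist_zero_right] at h3
      rw [hK]
      gcongr
    · rw [indicator_of_notMem h2] at h1 ⊢
      rw [le_antisymm h1 (abs_nonneg _), zero_mul]
  rw [dist_zero_right]
  calc ‖∫ t in Ioo 0 T, deriv (startCutoff σ t₀ n) t * g t‖
      ≤ ∫ t in Ioo 0 T, (Metric.closedBall t₀ r).indicator (fun _ => K) t := by
        refine norm_integral_le_of_norm_le hint.integrableOn ?_
        filter_upwards [ae_restrict_mem measurableSet_Ioo] with t ht using hbd t ht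
    _ ≤ ∫ t, (Metric.closedBall t₀ r).indicator (fun _ => K) t :=
        setIntegral_le_integral hint (Eventually.of_forall fun t =>
          indicator_nonneg (fun _ _ => hK0) _)
    _ = 2 * r * K := by
        rw [integral_indicator Metric.isClosed_closedBall.measurableSet, setIntegral_const,
          measureReal_def, Real.volume_closedBall, ENNReal.toReal_ofReal (by positivity),
          smul_eq_mul]
    _ = C / (C + 1) * (ε / 2) := by
        rw [hK, hrdef]
        field_simp
        ring
    _ < ε := by
        have : C / (C + 1) ≤ 1 := by
          rw [div_le_one (by positivity)]
          linarith
        nlinarith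

/-- Every time in (0,T) lies strictly after t₀, so the cutoff is eventually 1 at each point of the
cylinder. -/
theorem tendsto_startCutoff_mul {E : Type*} [NormedAddCommGroup E] [InnerProductSpace ℝ E]
    (hΩ : IsOpen Ω) {σ t₀ t₁ : ℝ} (h : IsDirection T σ t₀ t₁)
    {F : ℕ → Lp E 2 (volume.restrict (cylinder Ω T))} {G : Lp E 2 (volume.restrict (cylinder Ω T))}
    (hF : ∀ n, ∀ᵐ z ∂(volume.restrict (cylinder Ω T)), F n z = startCutoff σ t₀ n z.2 • G z) :
    Tendsto F atTop (𝓝 G) := by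
  refine tendsto_Lp_two_of_dominated (bound := fun z => ‖G z‖) (Lp.memLp G).norm ?_ ?_
  · refine Eventually.of_forall fun n => ?_
    filter_upwards [hF n] with z hz
    rw [hz, show startCutoff σ t₀ n z.2 • G z - G z = (startCutoff σ t₀ n z.2 - 1) • G z by
      rw [sub_smul, one_smul], norm_smul]
    refine mul_le_of_le_one_left (norm_nonneg _) ?_
    rw [Real.norm_eq_abs, abs_le]
    have h1 : 0 ≤ startCutoff σ t₀ n z.2 := ramp_nonneg _ _ _
    have h2 : startCutoff σ t₀ n z.2 ≤ 1 := ramp_le_one _ _ _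
    constructor <;> linarith
  · filter_upwards [ae_all_iff.2 hF, ae_restrict_mem (measurableSet_cylinder hΩ)] with z hz hzQ
    refine tendsto_const_nhds.congr' ?_
    filter_upwards [tendsto_startCutoff (cylinder_subset_after h hzQ).2] with n hn
    rw [hz, hn, one_smul, sub_self, norm_zero]

/-- A function whose representative in `C([0,T], L²(Ω))` vanishes at the start vanishes there in
the weak sense. -/
theorem isWeakStart_of_trace (hΩ : IsOpen Ω) (hb : Bornology.IsBounded Ω) (hT : 0 < T)
    {σ t₀ t₁ : ℝ} (h : IsDirection T σ t₀ t₁) {u : Y (cylinder Ω T)} {ζ : YDual (cylinder Ω T)}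
    (hu : IsTimeDerivative u ζ) {V : ℝ → L2 Ω} (hV : ContinuousOn V (Icc 0 T))
    (hVu : ∀ᵐ t ∂(volume.restrict (Ioo 0 T)), ∀ᵐ x ∂(volume.restrict Ω), V t x = fnY u (x, t))
    (hV0 : V t₀ = 0) : IsWeakStart hΩ T σ t₁ u ζ := by
  intro φ hφ
  have hmem : ∀ n, (fun z => startCutoff σ t₀ n z.2 * φ.1 z) ∈ testFunctions (cylinder Ω T) := by
    intro n
    have h1 := startCutoff_mul_mem (σ := σ) (t₀ := t₀) hφ n
    rwa [h.after_inter] at h1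
  let ψ : ℕ → testFunctions (cylinder Ω T) := fun n => ⟨_, hmem n⟩
  have hη := contDiff_startCutoff σ t₀
  have hlim : Tendsto (fun n => testY (ψ n)) atTop (𝓝 (stripY hΩ T φ)) := by
    rw [tendsto_Y_iff]
    constructor
    · refine tendsto_startCutoff_mul hΩ h fun n => ?_
      filter_upwards [fnY_testY (ψ n), stripY_ae hΩ T φ] with z h1 h2
      rw [h1, h2.1]
      rfl
    · refine tendsto_startCutoff_mul hΩ h fun n => ?_
      filter_upwards [gradY_testY (ψ n), stripY_ae hΩ T φ] with z h1 h2
      rw [h1, h2.2]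
      exact spatialGradient_timeMul φ.2.1 (hη n) z
  have hcont : ∀ n, Continuous fun z : SpaceTime d => deriv (startCutoff σ t₀ n) z.2 * φ.1 z :=
    fun n => (((hη n).continuous_deriv le_rfl).comp continuous_snd).mul φ.2.1.continuous
  have hmemE : ∀ n, MemLp (fun z : SpaceTime d => deriv (startCutoff σ t₀ n) z.2 * φ.1 z) 2
      (volume.restrict (cylinder Ω T)) := fun n =>
    (hcont n).memLp_of_hasCompactSupport φ.2.2.1.mul_left
  let E : ℕ → L2 (cylinder Ω T) := fun n => (hmemE n).toLp _
  have hmemD : ∀ n, MemLp (fun z : SpaceTime d => startCutoff σ t₀ n z.2 * timeDerivative φ.1 z) 2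
      (volume.restrict (cylinder Ω T)) := fun n =>
    (((hη n).continuous.comp continuous_snd).mul
      (continuous_timeDerivative φ.2.1)).memLp_of_hasCompactSupport
      (hasCompactSupport_timeDerivative φ.2.1 φ.2.2.1).mul_left
  let D : ℕ → L2 (cylinder Ω T) := fun n => (hmemD n).toLp _
  have hD : Tendsto D atTop (𝓝 (stripDt Ω T φ)) := by
    refine tendsto_startCutoff_mul hΩ h fun n => ?_
    filter_upwards [(hmemD n).coeFn_toLp, stripDt_ae φ] with z h1 h2
    rw [h1, h2]
    rfl
  -- Product rule: `D n` tends to the time derivative of φ, and only `E n` contains the derivative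
  -- of the cutoff.
  have heq : ∀ n, ζ (testY (ψ n)) = -(⟪D n, fnY u⟫ + ⟪E n, fnY u⟫) := by
    intro n
    rw [hu (ψ n), inner_L2, inner_L2, ← integral_add (integrable_mul_L2 _ _)
      (integrable_mul_L2 _ _)]
    congr 1
    refine integral_congr_ae ?_
    filter_upwards [(hmemD n).coeFn_toLp, (hmemE n).coeFn_toLp] with z h1 h2
    rw [h1, h2]
    have h3 : timeDerivative (ψ n).1 z = _ := timeDerivative_timeMul φ.2.1 (hη n) z
    rw [h3]
    ring
  have hE : Tendsto (fun n => ⟪E n, fnY u⟫) atTop (𝓝 0) := by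
    -- By Fubini the term with `E n` is the integral of the cutoff's derivative against this scalar
    -- function, which vanishes at t₀ because V does. This is the only use of the zero trace.
    have hgc : ContinuousOn (fun t => ⟪slice Ω t φ, V t⟫) (Icc 0 T) :=
      (continuous_slice hb φ).continuousOn.inner hV
    refine (tendsto_integral_deriv_startCutoff hT h hgc (by simp [hV0])).congr fun n => ?_
    have hint : Integrable (fun z => deriv (startCutoff σ t₀ n) z.2 * φ.1 z * fnY u z)
        (volume.restrict (cylinder Ω T)) := (hmemE n).integrable_mul (Lp.memLp (fnY u))
    have h1 : ⟪E n, fnY u⟫ =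
        ∫ z in cylinder Ω T, deriv (startCutoff σ t₀ n) z.2 * φ.1 z * fnY u z := by
      rw [inner_L2]
      refine integral_congr_ae ?_
      filter_upwards [(hmemE n).coeFn_toLp] with z h2
      rw [h2]
    rw [h1, integral_cylinder hint]
    refine integral_congr_ae ?_
    filter_upwards [hVu] with t ht
    rw [inner_L2, ← integral_const_mul]
    refine integral_congr_ae ?_
    filter_upwards [ht, slice_ae t φ] with x h2 h3
    rw [h2, h3]
    ring
  have h1 : Tendsto (fun n => ζ (testY (ψ n))) atTop (𝓝 (ζ (stripY hΩ T φ))) :=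
    (ζ.continuous.tendsto _).comp hlim
  have h2 := ((hD.inner (𝕜 := ℝ) (tendsto_const_nhds (x := fnY u))).add hE).neg
  rw [add_zero] at h2
  exact tendsto_nhds_unique (h1.congr heq) h2

end

section

/-! ### Pointwise operators on `L²` -/

section Pointwise

variable {α E F : Type*} [MeasurableSpace α] {μ : Measure α} [NormedAddCommGroup E]
  [NormedSpace ℝ E] [NormedAddCommGroup F] [NormedSpace ℝ F]

theorem memLp_clm_apply {A : α → E →L[ℝ] F} (hA : AEStronglyMeasurable A μ) {C : ℝ}
    (hC : ∀ᵐ x ∂μ, ‖A x‖ ≤ C) (f : Lp E 2 μ) : MemLp (fun x => A x (f x)) 2 μ := by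
  refine (Lp.memLp f).of_le_mul (c := C)
    ((ContinuousLinearMap.id ℝ (E →L[ℝ] F)).aestronglyMeasurable_comp₂ hA
      (Lp.aestronglyMeasurable f)) ?_
  filter_upwards [hC] with x hx
  exact (A x).le_of_opNorm_le hx _

/-- All coefficients enter through such operators: the velocity, κ, ℓ and the indicator of the
observation set. -/
theorem exists_pointwise {A : α → E →L[ℝ] F} (hA : AEStronglyMeasurable A μ) {C : ℝ}
    (hC : ∀ᵐ x ∂μ, ‖A x‖ ≤ C) :
    ∃ M : Lp E 2 μ →L[ℝ] Lp F 2 μ, ∀ f, ∀ᵐ x ∂μ, M f x = A x (f x) := by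
  refine ⟨LinearMap.mkContinuous
    { toFun := fun f => (memLp_clm_apply hA hC f).toLp _
      map_add' := fun f g => ?_
      map_smul' := fun c f => ?_ } C fun f => ?_, fun f => ?_⟩
  · refine Lp.ext ?_
    filter_upwards [(memLp_clm_apply hA hC (f + g)).coeFn_toLp,
      (memLp_clm_apply hA hC f).coeFn_toLp, (memLp_clm_apply hA hC g).coeFn_toLp,
      Lp.coeFn_add f g, Lp.coeFn_add ((memLp_clm_apply hA hC f).toLp _)
        ((memLp_clm_apply hA hC g).toLp _)] with x h1 h2 h3 h4 h5
    rw [h1, h5, Pi.add_apply, h2, h3, h4, Pi.add_apply, map_add]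
  · refine Lp.ext ?_
    filter_upwards [(memLp_clm_apply hA hC (c • f)).coeFn_toLp,
      (memLp_clm_apply hA hC f).coeFn_toLp, Lp.coeFn_smul c f,
      Lp.coeFn_smul c ((memLp_clm_apply hA hC f).toLp _)] with x h1 h2 h3 h4
    rw [h1, RingHom.id_apply, h4, Pi.smul_apply, h2, h3, Pi.smul_apply, map_smul]
  · refine Lp.norm_le_mul_norm_of_ae_le_mul ?_
    filter_upwards [hC, (memLp_clm_apply hA hC f).coeFn_toLp] with x h1 h2
    exact (congrArg norm h2).trans_le ((A x).le_of_opNorm_le h1 _)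
  · exact (memLp_clm_apply hA hC f).coeFn_toLp

theorem exists_pointwise_smul {c : α → ℝ} (hc : AEStronglyMeasurable c μ) {C : ℝ}
    (hC : ∀ᵐ x ∂μ, |c x| ≤ C) :
    ∃ M : Lp E 2 μ →L[ℝ] Lp E 2 μ, ∀ f, ∀ᵐ x ∂μ, M f x = c x • f x := by
  obtain ⟨M, hM⟩ := exists_pointwise (A := fun x => c x • ContinuousLinearMap.id ℝ E)
    (hc.smul aestronglyMeasurable_const) (C := C) (by
      filter_upwards [hC] with x hx
      rw [norm_smul]
      exact (mul_le_of_le_one_right (norm_nonneg _) ContinuousLinearMap.norm_id_le).trans hx)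
  exact ⟨M, fun f => (hM f).mono fun x hx => by simpa using hx⟩

end Pointwise

/-! ### Integration by parts in the space variable -/

section Parts

variable {d : ℕ} {Ω : Set (Space d)} {T : ℝ}

theorem integrable_mul_of_tsupport_subset (hΩ : IsOpen Ω) {f k : Space d → ℝ}
    (hf : ContinuousOn f Ω) (hk : Continuous k) (hc : HasCompactSupport k) (hs : tsupport k ⊆ Ω) :
    Integrable fun x => f x * k x := by
  refine Continuous.integrable_of_hasCompactSupport ?_ hc.mul_left
  refine continuous_of_tsupport fun x hx => ?_
  have h1 : x ∈ Ω := hs (tsupport_mul_subset_right hx)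
  exact (hf.continuousAt (hΩ.mem_nhds h1)).mul hk.continuousAt

/-- Integration by parts in each coordinate and summation. Smoothness of `w` on Ω alone suffices,
since `g` and its derivative are supported there. -/
theorem integral_fderiv_apply_field (hΩ : IsOpen Ω) {w : Space d → Space d}
    (hw : ContDiffOn ℝ 1 w Ω) {g : Space d → ℝ} (hg : ContDiff ℝ 1 g) (hc : HasCompactSupport g)
    (hs : tsupport g ⊆ Ω) : ∫ x, fderiv ℝ g x (w x) = -∫ x, divergence w x * g x := by
  have hgd : Differentiable ℝ g := hg.differentiable (by norm_num)
  have hgf : Continuous (fderiv ℝ g) := hg.continuous_fderiv (by norm_num)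
  have hwd : ∀ x ∈ Ω, DifferentiableAt ℝ w x := fun x hx =>
    (hw.differentiableOn (by norm_num)).differentiableAt (hΩ.mem_nhds hx)
  let e : Fin d → Space d := fun i => EuclideanSpace.single i 1
  have hcomp : ∀ i, ∀ x ∈ Ω, HasFDerivAt (fun y => w y i)
      ((EuclideanSpace.proj i : Space d →L[ℝ] ℝ).comp (fderiv ℝ w x)) x := fun i x hx =>
    (EuclideanSpace.proj i : Space d →L[ℝ] ℝ).hasFDerivAt.comp x (hwd x hx).hasFDerivAt
  have hwf : ContinuousOn (fderiv ℝ w) Ω := hw.continuousOn_fderiv_of_isOpen hΩ (by norm_num)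
  have hint1 : ∀ i, Integrable fun x => w x i * fderiv ℝ g x (e i) := fun i =>
    integrable_mul_of_tsupport_subset hΩ
      ((EuclideanSpace.proj i : Space d →L[ℝ] ℝ).continuous.comp_continuousOn hw.continuousOn)
      (hgf.clm_apply continuous_const) (hc.fderiv_apply ℝ _)
      ((tsupport_fderiv_apply_subset ℝ _).trans hs)
  have hint2 : ∀ i, Integrable fun x => (fderiv ℝ w x (e i)) i * g x := fun i =>
    integrable_mul_of_tsupport_subset hΩ
      ((EuclideanSpace.proj i : Space d →L[ℝ] ℝ).continuous.comp_continuousOn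
        (hwf.clm_apply continuousOn_const)) hg.continuous hc hs
  have hder : ∀ i x, fderiv ℝ (fun y => w y i) x (e i) * g x = (fderiv ℝ w x (e i)) i * g x := by
    intro i x
    by_cases hx : x ∈ tsupport g
    · rw [(hcomp i x (hs hx)).fderiv]
      rfl
    · rw [image_eq_zero_of_notMem_tsupport hx, mul_zero, mul_zero]
  have hparts : ∀ i, ∫ x, w x i * fderiv ℝ g x (e i) = -∫ x, (fderiv ℝ w x (e i)) i * g x := by
    intro i
    rw [integral_mul_fderiv_eq_neg_fderiv_mul_of_integrable]
    · simp_rw [hder]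
    · simp_rw [hder]
      exact hint2 i
    · exact hint1 i
    · exact integrable_mul_of_tsupport_subset hΩ
        ((EuclideanSpace.proj i : Space d →L[ℝ] ℝ).continuous.comp_continuousOn hw.continuousOn)
        hg.continuous hc hs
    · exact fun x hx => (hcomp i x (hs hx)).differentiableAt
    · exact fun x _ => hgd x
  have hsum : ∀ x, fderiv ℝ g x (w x) = ∑ i, w x i * fderiv ℝ g x (e i) := by
    intro x
    have h1 : w x = ∑ i, w x i • e i := by
      ext j
      simp [e, Pi.single_apply]
    conv_lhs => rw [h1, map_sum]
    simp
  simp_rw [hsum, divergence, Finset.sum_mul]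
  rw [integral_finsetSum _ fun i _ => hint1 i, integral_finsetSum _ fun i _ => hint2 i,
    ← Finset.sum_neg_distrib]
  exact Finset.sum_congr rfl fun i _ => hparts i

/-- Fubini reduces this to the spatial identity at each time. The constant `c` is 0 for the velocity
field, and d for the field x that gives the Poincaré inequality. -/
theorem integral_inner_spatialGradient (hΩ : IsOpen Ω) {w : SpaceTime d → Space d} {C c : ℝ}
    (hwm : AEStronglyMeasurable w (volume.restrict (cylinder Ω T)))
    (hwC : ∀ z ∈ cylinder Ω T, ‖w z‖ ≤ C)
    (hw1 : ∀ t ∈ Ioo 0 T, ContDiffOn ℝ 1 (fun x => w (x, t)) Ω)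
    (hdiv : ∀ t ∈ Ioo 0 T, ∀ x ∈ Ω, divergence (fun x => w (x, t)) x = c) {φ : SpaceTime d → ℝ}
    (hφ : φ ∈ testFunctions (cylinder Ω T)) :
    ∫ z in cylinder Ω T, ⟪w z, spatialGradient φ z⟫ = -(c * ∫ z in cylinder Ω T, φ z) := by
  have hφi : Integrable φ (volume.restrict (cylinder Ω T)) := memLp_one_iff_integrable.1
    (memLp_test hφ)
  have hgi : Integrable (spatialGradient φ) (volume.restrict (cylinder Ω T)) :=
    memLp_one_iff_integrable.1 (memLp_spatialGradient hφ)
  have hint : Integrable (fun z => ⟪w z, spatialGradient φ z⟫)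
      (volume.restrict (cylinder Ω T)) := by
    refine (hgi.norm.const_mul C).mono' (hwm.inner hgi.1) ?_
    filter_upwards [ae_restrict_mem (measurableSet_cylinder hΩ)] with z hz
    exact (norm_inner_le_norm _ _).trans (by gcongr; exact hwC z hz)
  rw [integral_cylinder hint, integral_cylinder hφi, ← integral_const_mul, ← integral_neg]
  refine setIntegral_congr_fun measurableSet_Ioo fun t ht => ?_
  have hg : ContDiff ℝ 1 fun x : Space d => φ (x, t) :=
    hφ.1.comp (contDiff_id.prodMk contDiff_const)
  have hcont : Continuous fun x : Space d => (x, t) := by fun_prop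
  have hs : tsupport (fun x : Space d => φ (x, t)) ⊆ Ω := fun x hx =>
    (hφ.2.2 (tsupport_comp_subset_preimage φ hcont hx)).1
  have h1 := integral_fderiv_apply_field hΩ (hw1 t ht) hg (hasCompactSupport_slice hφ.2.1 t) hs
  have h2 : ∀ x, fderiv ℝ (fun x => φ (x, t)) x (w (x, t)) =
      ⟪w (x, t), spatialGradient φ (x, t)⟫ := by
    intro x
    rw [(hasGradientAt_slice hφ.1 (x, t)).hasFDerivAt.fderiv, real_inner_comm]
    rfl
  have h3 : ∫ x in Ω, ⟪w (x, t), spatialGradient φ (x, t)⟫ =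
      ∫ x, fderiv ℝ (fun x => φ (x, t)) x (w (x, t)) := by
    simp_rw [← h2]
    refine setIntegral_eq_integral_of_forall_compl_eq_zero fun x hx => ?_
    rw [fderiv_of_notMem_tsupport (𝕜 := ℝ) fun h => hx (hs h)]
    rfl
  have h4 : ∫ x, divergence (fun x => w (x, t)) x * φ (x, t) = c * ∫ x in Ω, φ (x, t) := by
    rw [← integral_const_mul, ← setIntegral_eq_integral_of_forall_compl_eq_zero (s := Ω)]
    · exact setIntegral_congr_fun hΩ.measurableSet fun x hx => by simp only [hdiv t ht x hx]
    · intro x hx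
      have : φ (x, t) = 0 :=
        image_eq_zero_of_notMem_tsupport (f := fun x => φ (x, t)) fun h => hx (hs h)
      rw [this, mul_zero]
  show ∫ x in Ω, ⟪w (x, t), spatialGradient φ (x, t)⟫ = -(c * ∫ x in Ω, φ (x, t))
  rw [h3, h1, h4]

/-- Integration by parts in `Y` for a vector field with constant divergence. -/
theorem exists_transport_operator (hΩ : IsOpen Ω) {w : SpaceTime d → Space d} {C c : ℝ}
    (hwm : AEStronglyMeasurable w (volume.restrict (cylinder Ω T)))
    (hwC : ∀ z ∈ cylinder Ω T, ‖w z‖ ≤ C)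
    (hw1 : ∀ t ∈ Ioo 0 T, ContDiffOn ℝ 1 (fun x => w (x, t)) Ω)
    (hdiv : ∀ t ∈ Ioo 0 T, ∀ x ∈ Ω, divergence (fun x => w (x, t)) x = c) :
    ∃ N : L2Vec (cylinder Ω T) →L[ℝ] L2 (cylinder Ω T),
      (∀ g, ∀ᵐ z ∂(volume.restrict (cylinder Ω T)), N g z = ⟪w z, g z⟫) ∧
      ∀ u y : Y (cylinder Ω T), ⟪N (gradY u), fnY y⟫ + ⟪N (gradY y), fnY u⟫ =
        -(c * ⟪fnY u, fnY y⟫) := by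
  obtain ⟨N, hN⟩ := exists_pointwise (A := fun z => innerSL ℝ (w z))
    ((innerSL ℝ).continuous.comp_aestronglyMeasurable hwm) (C := C) (by
      filter_upwards [ae_restrict_mem (measurableSet_cylinder hΩ)] with z hz
      rw [innerSL_apply_norm]
      exact hwC z hz)
  refine ⟨N, hN, ?_⟩
  have htest : ∀ φ ψ : testFunctions (cylinder Ω T),
      ⟪N (gradY (testY φ)), fnY (testY ψ)⟫ + ⟪N (gradY (testY ψ)), fnY (testY φ)⟫ =
        -(c * ⟪fnY (testY φ), fnY (testY ψ)⟫) := by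
    intro φ ψ
    have hp : (fun z => φ.1 z * ψ.1 z) ∈ testFunctions (cylinder Ω T) := by
      have := mul_mem_testFunctions φ.2 ψ.2
      rwa [inter_self] at this
    have h1 := integral_inner_spatialGradient hΩ hwm hwC hw1 hdiv hp
    rw [inner_L2, inner_L2, inner_L2, ← integral_add (integrable_mul_L2 _ _)
      (integrable_mul_L2 _ _)]
    refine Eq.trans ?_ (h1.trans ?_)
    · refine integral_congr_ae ?_
      filter_upwards [hN (gradY (testY φ)), hN (gradY (testY ψ)), fnY_testY φ, fnY_testY ψ,
        gradY_testY φ, gradY_testY ψ] with z h2 h3 h4 h5 h6 h7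
      rw [h2, h3, h4, h5, h6, h7, spatialGradient_mul φ.2.1 ψ.2.1, inner_add_right,
        inner_smul_right, inner_smul_right]
      simp only [innerSL_apply_apply]
      ring
    · congr 2
      refine integral_congr_ae ?_
      filter_upwards [fnY_testY φ, fnY_testY ψ] with z h2 h3
      rw [h2, h3]
  have hc1 : ∀ y : Y (cylinder Ω T), Continuous fun u : Y (cylinder Ω T) =>
      ⟪N (gradY u), fnY y⟫ + ⟪N (gradY y), fnY u⟫ := fun y =>
    ((N.continuous.comp (gradL _).continuous).inner continuous_const).add
      (continuous_const.inner (fnL _).continuous)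
  have hc2 : ∀ y : Y (cylinder Ω T), Continuous fun u : Y (cylinder Ω T) =>
      -(c * ⟪fnY u, fnY y⟫) := fun y =>
    (((fnL _).continuous.inner continuous_const).const_mul c).neg
  -- Both sides are continuous in each argument separately, so density of the test functions is
  -- applied first in `u`, then in `y`.
  have h1 : ∀ (u : Y (cylinder Ω T)) (ψ : testFunctions (cylinder Ω T)),
      ⟪N (gradY u), fnY (testY ψ)⟫ + ⟪N (gradY (testY ψ)), fnY u⟫ =
        -(c * ⟪fnY u, fnY (testY ψ)⟫) := fun u ψ =>
    congrFun (dense_testY.equalizer (hc1 (testY ψ)) (hc2 (testY ψ))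
      (funext fun φ => htest φ ψ)) u
  intro u y
  have h2 := congrFun (dense_testY.equalizer (hc1 u) (hc2 u) (funext fun ψ => by
    show ⟪N (gradY (testY ψ)), fnY u⟫ + ⟪N (gradY u), fnY (testY ψ)⟫ =
      -(c * ⟪fnY (testY ψ), fnY u⟫)
    rw [add_comm, real_inner_comm (fnY u) (fnY (testY ψ))]
    exact h1 u ψ)) y
  rw [add_comm, real_inner_comm (fnY y) (fnY u)]
  exact h2

theorem divergence_id (x : Space d) : divergence (fun y : Space d => y) x = d := by
  simp [divergence]

/-- Poincaré inequality. -/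
theorem exists_poincare (hd : 0 < d) (hΩ : IsOpen Ω) (hb : Bornology.IsBounded Ω) (T : ℝ) :
    ∃ C : ℝ, 0 ≤ C ∧ ∀ y : Y (cylinder Ω T), ‖fnY y‖ ≤ C * ‖gradY y‖ := by
  obtain ⟨R, hR⟩ := hb.exists_norm_le
  -- With the field x, of divergence d and bounded on Ω, integration by parts reads 2(x·∇y, y) =
  -- -d‖y‖². Cauchy–Schwarz and d ≥ 1 finish the proof.
  obtain ⟨N, -, hN⟩ := exists_transport_operator (T := T) hΩ (w := Prod.fst) (C := R) (c := d)
    measurable_fst.aestronglyMeasurable (fun z hz => hR _ hz.1) (fun _ _ => contDiffOn_id)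
    (fun _ _ x _ => divergence_id x)
  refine ⟨2 * ‖N‖, by positivity, fun y => ?_⟩
  have h1 := hN y y
  rw [real_inner_self_eq_norm_sq] at h1
  have h2 : |⟪N (gradY y), fnY y⟫| ≤ ‖N‖ * ‖gradY y‖ * ‖fnY y‖ :=
    (abs_real_inner_le_norm _ _).trans (by gcongr; exact N.le_opNorm _)
  have h3 := (abs_le.1 h2).1
  have h4 : (1 : ℝ) ≤ d := by exact_mod_cast hd
  have h5 : ‖fnY y‖ * ‖fnY y‖ ≤ (2 * ‖N‖ * ‖gradY y‖) * ‖fnY y‖ := by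
    nlinarith [sq_nonneg ‖fnY y‖]
  rcases (norm_nonneg (fnY y)).eq_or_lt with h0 | h0
  · rw [← h0]
    positivity
  · exact le_of_mul_le_mul_right h5 h0

end Parts

end

section

/-! ### The velocity field -/

section Velocity

variable {d : ℕ} {Ω : Set (Space d)} {T : ℝ} {v : Space d → ℝ → Space d}

theorem norm_iteratedFDeriv_zero_sub (f g : Space d → Space d) (x : Space d) :
    ‖iteratedFDeriv ℝ 0 f x - iteratedFDeriv ℝ 0 g x‖ = ‖f x - g x‖ := by
  rw [iteratedFDeriv_zero_eq_comp, iteratedFDeriv_zero_eq_comp, Function.comp_apply,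
    Function.comp_apply, ← map_sub, LinearIsometryEquiv.norm_map]

theorem IsContinuousC2Field.norm_sub_lt (hv : IsContinuousC2Field Ω T v) {t : ℝ}
    (ht : t ∈ Icc 0 T) {ε : ℝ} (hε : 0 < ε) :
    ∃ δ > 0, ∀ s ∈ Icc 0 T, |s - t| < δ → ∀ x ∈ Ω, ‖v x s - v x t‖ ≤ ε := by
  obtain ⟨δ, hδ, h⟩ := hv.2.2 t ht ε hε
  refine ⟨δ, hδ, fun s hs hst x hx => ?_⟩
  rw [← norm_iteratedFDeriv_zero_sub (fun y => v y s) (fun y => v y t)]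
  exact h s hs hst 0 (by norm_num) x hx

/-- Compactness of [0,T]: near each time t the field stays within 1 of v(·, t), uniformly on Ω. -/
theorem IsContinuousC2Field.exists_bound (hv : IsContinuousC2Field Ω T v) :
    ∃ C : ℝ, ∀ t ∈ Icc 0 T, ∀ x ∈ Ω, ‖v x t‖ ≤ C := by
  refine isCompact_Icc.induction_on (p := fun s => ∃ C : ℝ, ∀ t ∈ s, ∀ x ∈ Ω, ‖v x t‖ ≤ C)
    ⟨0, fun t ht => absurd ht (notMem_empty t)⟩ ?_ ?_ ?_
  · rintro s s' hss ⟨C, hC⟩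
    exact ⟨C, fun t ht => hC t (hss ht)⟩
  · rintro s s' ⟨C, hC⟩ ⟨C', hC'⟩
    exact ⟨max C C', fun t ht x hx => ht.elim (fun h => (hC t h x hx).trans (le_max_left _ _))
      fun h => (hC' t h x hx).trans (le_max_right _ _)⟩
  · intro t ht
    obtain ⟨C, hC⟩ := hv.2.1 t ht
    obtain ⟨δ, hδ, h⟩ := hv.norm_sub_lt ht one_pos
    refine ⟨Icc 0 T ∩ Metric.ball t δ, inter_mem_nhdsWithin _ (Metric.ball_mem_nhds t hδ), C + 1,
      fun s hs x hx => ?_⟩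
    have h1 := h s hs.1 hs.2 x hx
    have h2 := hC 0 (by norm_num) x hx
    rw [norm_iteratedFDeriv_zero] at h2
    calc ‖v x s‖ = ‖v x t + (v x s - v x t)‖ := by rw [add_sub_cancel]
      _ ≤ ‖v x t‖ + ‖v x s - v x t‖ := norm_add_le _ _
      _ ≤ C + 1 := add_le_add h2 h1

/-- Continuity in time is uniform in x, so it combines with continuity in x at a fixed time. This
supplies the measurability of the velocity on the cylinder. -/
theorem IsContinuousC2Field.continuousOn (hv : IsContinuousC2Field Ω T v) :
    ContinuousOn (fun z : SpaceTime d => v z.1 z.2) (cylinder Ω T) := by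
  rw [Metric.continuousOn_iff]
  intro z hz ε hε
  have hzt := Ioo_subset_Icc_self hz.2
  obtain ⟨δ, hδ, h⟩ := hv.norm_sub_lt hzt (show (0 : ℝ) < ε / 2 by positivity)
  obtain ⟨δ', hδ', h'⟩ := Metric.continuousOn_iff.1 (hv.1 z.2 hzt).continuousOn z.1 hz.1 (ε / 2)
    (by positivity)
  refine ⟨min δ δ', lt_min hδ hδ', fun y hy hyz => ?_⟩
  rw [Prod.dist_eq] at hyz
  have h1 := h y.2 (Ioo_subset_Icc_self hy.2)
    ((le_max_right _ _).trans_lt (hyz.trans_le (min_le_left _ _))) y.1 hy.1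
  have h2 := h' y.1 hy.1 ((le_max_left _ _).trans_lt (hyz.trans_le (min_le_right _ _)))
  rw [← dist_eq_norm] at h1
  calc dist (v y.1 y.2) (v z.1 z.2)
      ≤ dist (v y.1 y.2) (v y.1 z.2) + dist (v y.1 z.2) (v z.1 z.2) := dist_triangle _ _ _
    _ < ε := by linarith

end Velocity

/-! ### Abstract evolution and control problems -/

section Abstract

/-- The expansion is exact: value at `f`, directional derivative, and a nonnegative remainder when λ
≥ 0. The first-order condition therefore gives global minimality, and for λ > 0 also uniqueness. -/
theorem quadratic_expansion {H G : Type*} [NormedAddCommGroup H] [InnerProductSpace ℝ H]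
    [NormedAddCommGroup G] [InnerProductSpace ℝ G] (C : H →L[ℝ] G) (z : G) (lam : ℝ) (f g : H) :
    1 / 2 * ‖C g - z‖ ^ 2 + lam / 2 * ‖g‖ ^ 2 =
      1 / 2 * ‖C f - z‖ ^ 2 + lam / 2 * ‖f‖ ^ 2 + (⟪C f - z, C (g - f)⟫ + lam * ⟪f, g - f⟫) +
        (1 / 2 * ‖C (g - f)‖ ^ 2 + lam / 2 * ‖g - f‖ ^ 2) := by
  have h1 : C g - z = (C f - z) + C (g - f) := by rw [map_sub]; abel
  have h2 : ‖g‖ ^ 2 = ‖f + (g - f)‖ ^ 2 := by rw [add_sub_cancel]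
  rw [h1, h2, norm_add_sq_real, norm_add_sq_real]
  ring

variable {H : Type*} [NormedAddCommGroup H] [InnerProductSpace ℝ H]

/-- The solution operator of an abstract evolution equation. -/
theorem exists_solution_operator (Z : Submodule ℝ (H × (H →L[ℝ] ℝ)))
    (hmono : ∀ x ∈ Z, 0 ≤ x.2 x.1) (B : H →L[ℝ] H →L[ℝ] ℝ) {c : ℝ} (hc : 0 < c)
    (hB : ∀ u, c * ‖u‖ ^ 2 ≤ B u u) (hex : ∀ F : H →L[ℝ] ℝ, ∃ x ∈ Z, x.2 + B x.1 = F) :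
    ∃ R : (H →L[ℝ] ℝ) →L[ℝ] H, ∀ F, (R F, F - B (R F)) ∈ Z := by
  have hest : ∀ x ∈ Z, c * ‖x.1‖ ≤ ‖x.2 + B x.1‖ := by
    intro x hx
    have h1 : c * ‖x.1‖ ^ 2 ≤ ‖x.2 + B x.1‖ * ‖x.1‖ :=
      calc c * ‖x.1‖ ^ 2 ≤ x.2 x.1 + B x.1 x.1 := by linarith [hmono x hx, hB x.1]
        _ = (x.2 + B x.1) x.1 := rfl
        _ ≤ ‖x.2 + B x.1‖ * ‖x.1‖ := (le_abs_self _).trans ((x.2 + B x.1).le_opNorm _)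
    rcases (norm_nonneg x.1).eq_or_lt with h0 | h0
    · rw [← h0, mul_zero]
      exact norm_nonneg _
    · refine le_of_mul_le_mul_right ?_ h0
      linarith [h1, pow_two ‖x.1‖]
  -- By `hest` the first component of a solution is determined by the right-hand side, so any choice
  -- is linear in it and bounded by 1 / c.
  choose X hXZ hX using hex
  have huniq : ∀ x ∈ Z, ∀ y ∈ Z, x.2 + B x.1 = y.2 + B y.1 → x.1 = y.1 := by
    intro x hx y hy hxy
    have h1 := hest _ (Z.sub_mem hx hy)
    have h2 : (x - y).2 + B (x - y).1 = 0 := by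
      rw [Prod.snd_sub, Prod.fst_sub, map_sub, sub_add_sub_comm, hxy, sub_self]
    rw [h2, norm_zero] at h1
    have h3 : ‖(x - y).1‖ ≤ 0 := by
      by_contra h
      push Not at h
      nlinarith
    exact sub_eq_zero.1 (norm_le_zero_iff.1 h3)
  refine ⟨LinearMap.mkContinuous
    { toFun := fun F => (X F).1
      map_add' := fun F G => ?_
      map_smul' := fun a F => ?_ } (1 / c) fun F => ?_, fun F => ?_⟩
  · refine huniq _ (hXZ _) _ (Z.add_mem (hXZ F) (hXZ G)) ?_
    rw [hX, Prod.snd_add, Prod.fst_add, map_add, add_add_add_comm, hX, hX]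
  · refine huniq _ (hXZ _) _ (Z.smul_mem a (hXZ F)) ?_
    rw [hX, Prod.smul_snd, Prod.smul_fst, map_smul, ← smul_add, hX]
  · have h1 := hest _ (hXZ F)
    rw [hX] at h1
    rw [one_div, inv_mul_eq_div, le_div_iff₀ hc, mul_comm]
    exact h1
  · have h1 : F - B (X F).1 = (X F).2 := by
      rw [sub_eq_iff_eq_add, hX]
    show ((X F).1, F - B (X F).1) ∈ Z
    rw [h1]
    exact hXZ F

variable {G : Type*} [NormedAddCommGroup G] [InnerProductSpace ℝ G]

/-- The first-order condition of a linear-quadratic problem over a closed convex set is solvable. -/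
theorem exists_variational_inequality [CompleteSpace H] (C : H →L[ℝ] G) (z : G) {lam : ℝ} (hlam : 0 < lam)
    {K : Set H} (hne : K.Nonempty) (hK : IsClosed K) (hconv : Convex ℝ K) :
    ∃ f ∈ K, ∀ g ∈ K, 0 ≤ ⟪C f - z, C (g - f)⟫ + lam * ⟪f, g - f⟫ := by
  -- ‖P f - (z, 0)‖² is twice the functional, so a minimizer is a nearest point of P(K) to (z, 0).
  -- The second component bounds P below by √λ, which makes P(K) complete without assuming G
  -- complete.
  let P : H →L[ℝ] WithLp 2 (G × H) :=
    ((WithLp.prodContinuousLinearEquiv 2 ℝ G H).symm : G × H →L[ℝ] WithLp 2 (G × H)).comp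
      (C.prod (√lam • ContinuousLinearMap.id ℝ H))
  have hP : ∀ f, P f = WithLp.toLp 2 (C f, √lam • f) := fun f => rfl
  have hs : 0 < √lam := Real.sqrt_pos.2 hlam
  have hanti : AntilipschitzWith (1 / √lam).toNNReal P := by
    refine P.antilipschitz_of_bound fun f => ?_
    have h1 : ‖√lam • f‖ ≤ ‖P f‖ := WithLp.norm_snd_le G (P f)
    rw [norm_smul, Real.norm_of_nonneg hs.le] at h1
    rw [Real.coe_toNNReal _ (by positivity), one_div, inv_mul_eq_div, le_div_iff₀ hs, mul_comm]
    exact h1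
  have hcomp : IsComplete (P '' K) :=
    ((hanti.isUniformInducing P.uniformContinuous).isComplete_iff).2 hK.isComplete
  obtain ⟨w, ⟨f, hf, rfl⟩, hmin⟩ := exists_norm_eq_iInf_of_complete_convex (hne.image P) hcomp
    (hconv.is_linear_image (f := P) P.isBoundedLinearMap.toIsLinearMap) (WithLp.toLp 2 (z, (0 : H)))
  rw [norm_eq_iInf_iff_real_inner_le_zero
    (hconv.is_linear_image (f := P) P.isBoundedLinearMap.toIsLinearMap) ⟨f, hf, rfl⟩] at hmin
  refine ⟨f, hf, fun g hg => ?_⟩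
  have h1 := hmin (P g) ⟨g, hg, rfl⟩
  rw [WithLp.prod_inner_apply] at h1
  have h2 : (WithLp.toLp 2 (z, (0 : H)) - P f).fst = -(C f - z) := by simp [hP]
  have h3 : (WithLp.toLp 2 (z, (0 : H)) - P f).snd = -(√lam • f) := by simp [hP]
  have h4 : (P g - P f).fst = C (g - f) := by simp [hP]
  have h5 : (P g - P f).snd = √lam • (g - f) := by simp [hP, smul_sub]
  have h6 : ⟪-(C f - z), C (g - f)⟫ + ⟪-(√lam • f), √lam • (g - f)⟫ ≤ 0 := by
    rw [← h2, ← h3, ← h4, ← h5]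
    exact h1
  rw [inner_neg_left, inner_neg_left, inner_smul_left, inner_smul_right, ← mul_assoc] at h6
  simp only [conj_trivial, Real.mul_self_sqrt hlam.le] at h6
  linarith

end Abstract

/-! ### The evolution equation -/

section Evolution

variable {d : ℕ} {Ω : Set (Space d)} {T : ℝ}

/-- Integration by parts in time with no boundary term: one element is a limit of functions
vanishing near the start, the other vanishes weakly at the opposite end. It is the duality between
state and adjoint. -/
theorem inner_of_mem_startGraph {hΩ : IsOpen Ω} {σ t₀ : ℝ}
    {x : Y (cylinder Ω T) × YDual (cylinder Ω T)} (hx : x ∈ startGraph hΩ T σ t₀)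
    {w : Y (cylinder Ω T)} {ζ : YDual (cylinder Ω T)} (hw : IsWeakStart hΩ T (-σ) t₀ w ζ) :
    x.2 w = -(σ * ζ x.1) := by
  obtain ⟨φ, hφ, hlim⟩ := exists_seq_startGraph hx
  have h1 : Tendsto (fun n => stripY hΩ T (φ n)) atTop (𝓝 x.1) :=
    (continuous_fst.tendsto x).comp hlim
  have h2 : Tendsto (fun n => σ • toDualL (cylinder Ω T) (stripDt Ω T (φ n))) atTop (𝓝 x.2) :=
    (continuous_snd.tendsto x).comp hlim
  refine tendsto_nhds_unique
    (((ContinuousLinearMap.apply ℝ ℝ w).continuous.tendsto _).comp h2)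
    (((((ζ.continuous.tendsto _).comp h1).const_mul σ).neg).congr fun n => ?_)
  have h3 := hw (φ n) (by rw [neg_neg]; exact hφ n)
  show -(σ * ζ (stripY hΩ T (φ n))) = σ * ⟪stripDt Ω T (φ n), fnY w⟫
  rw [h3]
  ring

theorem HasTimeTrace.isWeakStart (hΩ : IsOpen Ω) (hb : Bornology.IsBounded Ω) (hT : 0 < T)
    {σ t₀ t₁ : ℝ} (h : IsDirection T σ t₀ t₁) {u : X (cylinder Ω T)} (hu : HasTimeTrace u t₀ 0) :
    IsWeakStart hΩ T σ t₁ u.toY u.dt := by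
  obtain ⟨V, hV, hVu, hV0⟩ := hu
  exact isWeakStart_of_trace hΩ hb hT h u.2 hV hVu hV0

/-- The element of `X` given by an element of the closure of the functions that vanish near the
start. -/
theorem exists_X_of_mem_startGraph {hΩ : IsOpen Ω} (hb : Bornology.IsBounded Ω) (hT : 0 < T)
    {σ t₀ t₁ : ℝ} (h : IsDirection T σ t₀ t₁) {x : Y (cylinder Ω T) × YDual (cylinder Ω T)}
    (hx : x ∈ startGraph hΩ T σ t₀) :
    ∃ u : X (cylinder Ω T), HasTimeTrace u t₀ 0 ∧ u.toY = x.1 ∧ u.dt = σ • x.2 :=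
  ⟨⟨(x.1, σ • x.2), (isWeakStart_of_mem_startGraph h hx).isTimeDerivative h⟩,
    by
      obtain ⟨V, h1, h2, h3⟩ := exists_trace hb hT h hx
      exact ⟨V, h1, h2, h3⟩, rfl, rfl⟩

/-- The difference of two solutions vanishes weakly at the start. Testing its equation with itself,
monotonicity and coercivity force it to be zero in `Y`; the equation then gives equality of the time
derivatives. -/
theorem eq_of_evolution (hΩ : IsOpen Ω) (hb : Bornology.IsBounded Ω) (hT : 0 < T) {σ t₀ t₁ : ℝ}
    (h : IsDirection T σ t₀ t₁) (B : Y (cylinder Ω T) →L[ℝ] Y (cylinder Ω T) →L[ℝ] ℝ) {c : ℝ}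
    (hc : 0 < c) (hB : ∀ u, c * ‖u‖ ^ 2 ≤ B u u) {u w : X (cylinder Ω T)}
    (hu : HasTimeTrace u t₀ 0) (hw : HasTimeTrace w t₀ 0)
    (huw : σ • u.dt + B u.toY = σ • w.dt + B w.toY) : u = w := by
  have h1 : IsWeakStart hΩ T σ t₁ (u.toY - w.toY) (u.dt - w.dt) := by
    intro φ hφ
    have h2 := hu.isWeakStart hΩ hb hT h φ hφ
    have h3 := hw.isWeakStart hΩ hb hT h φ hφ
    have h4 : fnY (u.toY - w.toY) = fnY u.toY - fnY w.toY := map_sub (fnL _) _ _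
    rw [sub_apply, h2, h3, h4, inner_sub_right]
    ring
  have h5 := h1.nonneg hb h
  have h6 : σ • (u.dt - w.dt) + B (u.toY - w.toY) = 0 := by
    rw [smul_sub, map_sub, sub_add_sub_comm, huw, sub_self]
  have h7 : σ * (u.dt - w.dt) (u.toY - w.toY) + B (u.toY - w.toY) (u.toY - w.toY) = 0 :=
    congrArg (fun L : YDual (cylinder Ω T) => L (u.toY - w.toY)) h6
  have h8 := hB (u.toY - w.toY)
  have h9 : ‖u.toY - w.toY‖ ^ 2 ≤ 0 := by
    by_contra hneg
    push Not at hneg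
    nlinarith
  have h10 : u.toY = w.toY := by
    refine sub_eq_zero.1 (norm_eq_zero.1 ?_)
    exact pow_eq_zero_iff (two_ne_zero) |>.1 (le_antisymm h9 (sq_nonneg _))
  have h11 : u.dt = w.dt := by
    rw [h10, add_left_inj] at huw
    have h12 := congrArg (fun L => σ • L) huw
    simpa only [smul_smul, h.mul_self, one_smul] using h12
  exact Subtype.ext (Prod.ext h10 h11)

end Evolution

end

/-! ### The state and adjoint equations as operator equations; the projection formula -/

section

namespace Setting

variable {d : ℕ} (S : Setting d)

theorem isOpen_domain : IsOpen S.Ω := S.isLipschitzDomain.1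

theorem measurable_κ : Measurable S.κ :=
  Measurable.ite S.isOpen_Q₁.measurableSet measurable_const measurable_const

theorem κ_bounds (z : SpaceTime d) : min S.κ₁ S.κ₂ ≤ S.κ z ∧ |S.κ z| ≤ max S.κ₁ S.κ₂ := by
  have h1 := S.κ₁_pos
  have h2 := S.κ₂_pos
  unfold κ
  split_ifs
  · exact ⟨min_le_left _ _, by rw [abs_of_pos h1]; exact le_max_left _ _⟩
  · exact ⟨min_le_right _ _, by rw [abs_of_pos h2]; exact le_max_right _ _⟩

theorem ωT_subset : S.ωT ⊆ cylinder S.Ω S.T := by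
  rintro z ⟨hz, ht⟩
  refine ⟨?_, ht⟩
  rw [S.split_Ω z.2 (Ioo_subset_Icc_self ht)]
  exact Or.inr (S.ω_subset z.2 (Ioo_subset_Icc_self ht) hz)

theorem measurableSet_ωT : MeasurableSet S.ωT := measurableSet_cylinder S.isOpen_ω

/-- The bilinear form of the advection-diffusion operator. -/
theorem exists_form (hd : 0 < d) :
    ∃ B : Y (cylinder S.Ω S.T) →L[ℝ] Y (cylinder S.Ω S.T) →L[ℝ] ℝ,
      (∃ c > 0, ∀ u, c * ‖u‖ ^ 2 ≤ B u u) ∧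
      (∀ u φ : Y (cylinder S.Ω S.T), B u φ = ∫ z in cylinder S.Ω S.T,
        (⟪S.v z.1 z.2, gradY u z⟫ * fnY φ z + S.κ z * ⟪gradY u z, gradY φ z⟫)) ∧
      ∀ p φ : Y (cylinder S.Ω S.T), B φ p = ∫ z in cylinder S.Ω S.T,
        (-⟪S.v z.1 z.2, gradY p z⟫ * fnY φ z + S.κ z * ⟪gradY p z, gradY φ z⟫) := by
  have hΩ := S.isOpen_domain
  obtain ⟨C, hC⟩ := S.v_regular.exists_bound
  obtain ⟨N, hN, hN2⟩ := exists_transport_operator (T := S.T) hΩ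
    (w := fun z : SpaceTime d => S.v z.1 z.2) (C := C) (c := 0)
    (S.v_regular.continuousOn.aestronglyMeasurable (measurableSet_cylinder hΩ))
    (fun z hz => hC z.2 (Ioo_subset_Icc_self hz.2) z.1 hz.1)
    (fun t ht => (S.v_regular.1 t (Ioo_subset_Icc_self ht)).of_le (by norm_num))
    (fun t ht x hx => S.v_incompressible t (Ioo_subset_Icc_self ht) x hx)
  obtain ⟨K, hK⟩ := exists_pointwise_smul (E := Space d)
    (μ := volume.restrict (cylinder S.Ω S.T)) S.measurable_κ.aestronglyMeasurable
    (Eventually.of_forall fun z => (S.κ_bounds z).2)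
  let B : Y (cylinder S.Ω S.T) →L[ℝ] Y (cylinder S.Ω S.T) →L[ℝ] ℝ := LinearMap.mkContinuous₂
    (LinearMap.mk₂ ℝ (fun u y => ⟪N (gradL _ u), fnL _ y⟫ + ⟪K (gradL _ u), gradL _ y⟫)
      (fun u u' y => by simp only [map_add, inner_add_left]; ring)
      (fun a u y => by
        simp only [map_smul, real_inner_smul_left, smul_eq_mul]; ring)
      (fun u y y' => by simp only [map_add, inner_add_right]; ring)
      (fun a u y => by
        simp only [map_smul, real_inner_smul_right, smul_eq_mul]; ring)) (‖N‖ + ‖K‖)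
    (fun u y => by
      simp only [LinearMap.mk₂_apply, fnL_apply, gradL_apply]
      have h1 : ‖N (gradY u)‖ ≤ ‖N‖ * ‖u‖ := (N.le_opNorm _).trans (by
        gcongr; exact norm_gradY_le u)
      have h2 : ‖K (gradY u)‖ ≤ ‖K‖ * ‖u‖ := (K.le_opNorm _).trans (by
        gcongr; exact norm_gradY_le u)
      calc ‖⟪N (gradY u), fnY y⟫ + ⟪K (gradY u), gradY y⟫‖
          ≤ ‖N (gradY u)‖ * ‖fnY y‖ + ‖K (gradY u)‖ * ‖gradY y‖ :=
            (norm_add_le _ _).trans (add_le_add (norm_inner_le_norm _ _) (norm_inner_le_norm _ _))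
        _ ≤ ‖N‖ * ‖u‖ * ‖y‖ + ‖K‖ * ‖u‖ * ‖y‖ := by
            gcongr
            · exact norm_fnY_le y
            · exact norm_gradY_le y
        _ = (‖N‖ + ‖K‖) * ‖u‖ * ‖y‖ := by ring)
  have hB : ∀ u y, B u y = ⟪N (gradY u), fnY y⟫ + ⟪K (gradY u), gradY y⟫ := fun u y => rfl
  have hint1 : ∀ u y : Y (cylinder S.Ω S.T), Integrable
      (fun z => ⟪S.v z.1 z.2, gradY u z⟫ * fnY y z) (volume.restrict (cylinder S.Ω S.T)) :=
    fun u y => (integrable_mul_L2 (N (gradY u)) (fnY y)).congr (by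
      filter_upwards [hN (gradY u)] with z hz
      rw [hz])
  have hint2 : ∀ u y : Y (cylinder S.Ω S.T), Integrable
      (fun z => S.κ z * ⟪gradY u z, gradY y z⟫) (volume.restrict (cylinder S.Ω S.T)) :=
    fun u y => (L2.integrable_inner (𝕜 := ℝ) (K (gradY u)) (gradY y)).congr (by
      filter_upwards [hK (gradY u)] with z hz
      rw [hz, real_inner_smul_left])
  have hval1 : ∀ u y : Y (cylinder S.Ω S.T), ⟪N (gradY u), fnY y⟫ =
      ∫ z in cylinder S.Ω S.T, ⟪S.v z.1 z.2, gradY u z⟫ * fnY y z := fun u y => by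
    rw [inner_L2]
    refine integral_congr_ae ?_
    filter_upwards [hN (gradY u)] with z hz
    rw [hz]
  have hval2 : ∀ u y : Y (cylinder S.Ω S.T), ⟪K (gradY u), gradY y⟫ =
      ∫ z in cylinder S.Ω S.T, S.κ z * ⟪gradY u z, gradY y z⟫ := fun u y => by
    rw [L2.inner_def]
    refine integral_congr_ae ?_
    filter_upwards [hK (gradY u)] with z hz
    rw [hz, real_inner_smul_left]
  refine ⟨B, ?_, fun u φ => ?_, fun p φ => ?_⟩
  · obtain ⟨R, hR, hpoin⟩ := exists_poincare hd hΩ S.isBounded S.T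
    have hκ : 0 < min S.κ₁ S.κ₂ := lt_min S.κ₁_pos S.κ₂_pos
    -- The Poincaré inequality bounds ‖u‖² by (R² + 1)‖∇u‖², and diffusion controls the gradient
    -- with the smaller of the two coefficients.
    refine ⟨min S.κ₁ S.κ₂ / (R ^ 2 + 1), by positivity, fun u => ?_⟩
    -- Zero divergence makes the advection term skew, so it does not contribute on the diagonal.
    have h1 : ⟪N (gradY u), fnY u⟫ = 0 := by
      have := hN2 u u
      linarith
    have h2 : min S.κ₁ S.κ₂ * ‖gradY u‖ ^ 2 ≤ ⟪K (gradY u), gradY u⟫ := by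
      rw [hval2, norm_sq_eq_integral, ← integral_const_mul]
      refine integral_mono_of_nonneg (Eventually.of_forall fun z => by positivity) (hint2 u u)
        (Eventually.of_forall fun z => ?_)
      simp only [real_inner_self_eq_norm_sq]
      gcongr
      exact (S.κ_bounds z).1
    have h3 : ‖u‖ ^ 2 ≤ (R ^ 2 + 1) * ‖gradY u‖ ^ 2 := by
      rw [norm_sq_Y]
      have : ‖fnY u‖ ^ 2 ≤ (R * ‖gradY u‖) ^ 2 := by
        gcongr
        exact hpoin u
      linarith [mul_pow R ‖gradY u‖ 2]
    rw [hB, h1, zero_add]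
    calc min S.κ₁ S.κ₂ / (R ^ 2 + 1) * ‖u‖ ^ 2
        ≤ min S.κ₁ S.κ₂ / (R ^ 2 + 1) * ((R ^ 2 + 1) * ‖gradY u‖ ^ 2) := by gcongr
      _ = min S.κ₁ S.κ₂ * ‖gradY u‖ ^ 2 := by field_simp
      _ ≤ _ := h2
  · rw [hB, hval1, hval2, ← integral_add (hint1 _ _) (hint2 _ _)]
  -- By the same skewness, transposing the form reverses the sign of the advection term, which is
  -- the form in a'.
  · have h1 := hN2 φ p
    have h2 : B φ p = -⟪N (gradY p), fnY φ⟫ + ⟪K (gradY p), gradY φ⟫ := by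
      rw [hB, hval2, hval2]
      simp_rw [real_inner_comm (gradY p _)]
      linarith
    have h3 : Integrable (fun z => -⟪S.v z.1 z.2, gradY p z⟫ * fnY φ z)
        (volume.restrict (cylinder S.Ω S.T)) := by
      simp_rw [neg_mul]
      exact (hint1 p φ).neg
    rw [h2, hval1, hval2, integral_add h3 (hint2 _ _)]
    simp_rw [neg_mul]
    rw [integral_neg]

theorem inner_multiplication {M : L2 (cylinder S.Ω S.T) →L[ℝ] L2 (cylinder S.Ω S.T)}
    (hM : ∀ f, ∀ᵐ z ∂(volume.restrict (cylinder S.Ω S.T)), M f z = S.ℓ z * f z)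
    (f g : L2 (cylinder S.Ω S.T)) :
    ⟪M f, g⟫ = ∫ z in cylinder S.Ω S.T, S.ℓ z * f z * g z := by
  rw [inner_L2]
  refine integral_congr_ae ?_
  filter_upwards [hM f] with z hz
  rw [hz]

/-- The factor 1 is the direction σ: state and adjoint become instances of one abstract evolution
equation. -/
theorem isState_iff {B : Y (cylinder S.Ω S.T) →L[ℝ] Y (cylinder S.Ω S.T) →L[ℝ] ℝ}
    (hB : ∀ u φ : Y (cylinder S.Ω S.T), B u φ = ∫ z in cylinder S.Ω S.T,
      (⟪S.v z.1 z.2, gradY u z⟫ * fnY φ z + S.κ z * ⟪gradY u z, gradY φ z⟫))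
    {M : L2 (cylinder S.Ω S.T) →L[ℝ] L2 (cylinder S.Ω S.T)}
    (hM : ∀ f, ∀ᵐ z ∂(volume.restrict (cylinder S.Ω S.T)), M f z = S.ℓ z * f z)
    (f : L2 (cylinder S.Ω S.T)) (u : X (cylinder S.Ω S.T)) :
    S.IsState f u ↔ HasTimeTrace u 0 0 ∧
      (1 : ℝ) • u.dt + B u.toY = toDualL (cylinder S.Ω S.T) (M f) := by
  refine and_congr Iff.rfl ((forall_congr' fun φ : Y (cylinder S.Ω S.T) => ?_).trans
    (ContinuousLinearMap.ext_iff (f := (1 : ℝ) • u.dt + B u.toY)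
      (g := toDualL (cylinder S.Ω S.T) (M f))).symm)
  have h1 : ((1 : ℝ) • u.dt + B u.toY) φ = S.a u φ := by
    refine Eq.trans ?_ (congrArg (fun r => u.dt φ + r) (hB u.toY φ))
    show (1 : ℝ) * u.dt φ + B u.toY φ = u.dt φ + B u.toY φ
    rw [one_mul]
  exact Eq.congr h1.symm (S.inner_multiplication hM f (fnY φ)).symm

/-- The adjoint equation is the evolution equation with σ = -1 and the transposed form. -/
theorem isAdjoint_iff {B : Y (cylinder S.Ω S.T) →L[ℝ] Y (cylinder S.Ω S.T) →L[ℝ] ℝ}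
    (hB : ∀ p φ : Y (cylinder S.Ω S.T), B φ p = ∫ z in cylinder S.Ω S.T,
      (-⟪S.v z.1 z.2, gradY p z⟫ * fnY φ z + S.κ z * ⟪gradY p z, gradY φ z⟫))
    {zd : L2 S.ωT} {P : L2 (cylinder S.Ω S.T) →L[ℝ] L2 (cylinder S.Ω S.T)}
    {zt : L2 (cylinder S.Ω S.T)}
    (hP : ∀ f, ∀ᵐ z ∂(volume.restrict (cylinder S.Ω S.T)),
      (P f - zt) z = S.ωT.indicator (fun y => f y - zd y) z ∧
      P f z = S.ωT.indicator (fun y => f y) z) (u p : X (cylinder S.Ω S.T)) :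
    S.IsAdjoint zd u p ↔ HasTimeTrace p S.T 0 ∧
      (-1 : ℝ) • p.dt + B.flip p.toY = toDualL (cylinder S.Ω S.T) (P (fnY u.toY) - zt) := by
  refine and_congr Iff.rfl ((forall_congr' fun φ : Y (cylinder S.Ω S.T) => ?_).trans
    (ContinuousLinearMap.ext_iff (f := (-1 : ℝ) • p.dt + B.flip p.toY)
      (g := toDualL (cylinder S.Ω S.T) (P (fnY u.toY) - zt))).symm)
  have h1 : ((-1 : ℝ) • p.dt + B.flip p.toY) φ = S.a' p φ := by
    refine Eq.trans ?_ (congrArg (fun r => -(p.dt φ) + r) (hB p.toY φ))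
    show (-1 : ℝ) * p.dt φ + B φ p.toY = -(p.dt φ) + B φ p.toY
    rw [neg_one_mul]
  have h2 : toDualL (cylinder S.Ω S.T) (P (fnY u.toY) - zt) φ =
      ∫ z in cylinder S.Ω S.T, S.ωT.indicator (fun y => fnY u.toY y - zd y) z * fnY φ z := by
    rw [toDualL_apply, inner_L2]
    refine integral_congr_ae ?_
    filter_upwards [hP (fnY u.toY)] with z hz
    rw [hz.1]
  exact Eq.congr h1.symm h2.symm

/-- Multiplication by `ℓ`. -/
theorem exists_multiplication : ∃ M : L2 (cylinder S.Ω S.T) →L[ℝ] L2 (cylinder S.Ω S.T),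
    ∀ f, ∀ᵐ z ∂(volume.restrict (cylinder S.Ω S.T)), M f z = S.ℓ z * f z := by
  have h1 : eLpNormEssSup S.ℓ (volume.restrict (cylinder S.Ω S.T)) < ∞ := by
    have := S.ℓ_bounded.2
    rwa [eLpNorm_exponent_top] at this
  refine exists_pointwise_smul (E := ℝ) S.ℓ_bounded.1
    (C := (eLpNormEssSup S.ℓ (volume.restrict (cylinder S.Ω S.T))).toReal) ?_
  filter_upwards [ae_le_eLpNormEssSup (f := S.ℓ) (μ := volume.restrict (cylinder S.Ω S.T))] with z hz
  rw [← Real.norm_eq_abs, ← toReal_enorm]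
  exact ENNReal.toReal_mono h1.ne hz

/-- Restriction to the observation set, and the data extended by zero. -/
theorem exists_observation (zd : L2 S.ωT) :
    ∃ (P : L2 (cylinder S.Ω S.T) →L[ℝ] L2 (cylinder S.Ω S.T)) (zt : L2 (cylinder S.Ω S.T)),
      ∀ f, ∀ᵐ z ∂(volume.restrict (cylinder S.Ω S.T)),
        (P f - zt) z = S.ωT.indicator (fun y => f y - zd y) z ∧
        P f z = S.ωT.indicator (fun y => f y) z := by
  have hm : Measurable (S.ωT.indicator fun _ => (1 : ℝ)) :=
    measurable_const.indicator S.measurableSet_ωT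
  obtain ⟨P, hP⟩ := exists_pointwise_smul (E := ℝ) (μ := volume.restrict (cylinder S.Ω S.T))
    hm.aestronglyMeasurable (C := 1) (Eventually.of_forall fun z => by
      by_cases hz : z ∈ S.ωT <;> simp [hz])
  have hz : MemLp (S.ωT.indicator zd) 2 (volume.restrict (cylinder S.Ω S.T)) := by
    rw [memLp_indicator_iff_restrict S.measurableSet_ωT,
      Measure.restrict_restrict_of_subset S.ωT_subset]
    exact Lp.memLp zd
  refine ⟨P, hz.toLp _, fun f => ?_⟩
  filter_upwards [hP f, hz.coeFn_toLp, Lp.coeFn_sub (P f) (hz.toLp _)] with z h1 h2 h3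
  rw [h3, Pi.sub_apply, h1, h2]
  by_cases hzω : z ∈ S.ωT <;> simp [hzω]

theorem isClosed_admissible : IsClosed S.admissible := by
  have h : S.admissible = Ici 0 := by
    ext f
    exact Lp.coeFn_nonneg f
  rw [h]
  exact isClosed_Ici

theorem convex_admissible : Convex ℝ S.admissible := by
  intro f hf g hg a b ha hb _
  show ∀ᵐ z ∂(volume.restrict S.Q), 0 ≤ (a • f + b • g) z
  filter_upwards [hf, hg, Lp.coeFn_add (a • f) (b • g), Lp.coeFn_smul a f, Lp.coeFn_smul b g]
    with z h1 h2 h3 h4 h5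
  rw [h3, Pi.add_apply, h4, h5, Pi.smul_apply, Pi.smul_apply]
  exact add_nonneg (mul_nonneg ha h1) (mul_nonneg hb h2)

theorem variationalInequality_iff_inner {M : L2 S.Q →L[ℝ] L2 S.Q}
    (hM : ∀ f, ∀ᵐ z ∂(volume.restrict S.Q), M f z = S.ℓ z * f z) (lam : ℝ) (f p : L2 S.Q) :
    S.VariationalInequality lam f p ↔ ∀ g ∈ S.admissible, 0 ≤ ⟪M p + lam • f, g - f⟫ := by
  refine forall₂_congr fun g _ => ?_
  have h : ∫ z in S.Q, (S.ℓ z * p z + lam * f z) * (g z - f z) = ⟪M p + lam • f, g - f⟫ := by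
    rw [inner_L2]
    refine integral_congr_ae ?_
    filter_upwards [hM p, Lp.coeFn_add (M p) (lam • f), Lp.coeFn_smul lam f, Lp.coeFn_sub g f]
      with z h1 h2 h3 h4
    rw [h2, Pi.add_apply, h1, h3, h4]
    rfl
  rw [h]

/-- The integrand is nonnegative pointwise: where the maximum is 0, both ℓp and g are nonnegative;
elsewhere ℓp + λf vanishes. -/
theorem variationalInequality_of_projectionFormula {lam : ℝ} (hlam : 0 < lam) {f p : L2 S.Q}
    (h : S.ProjectionFormula lam f p) : S.VariationalInequality lam f p := by
  intro g hg
  refine integral_nonneg_of_ae ?_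
  filter_upwards [h, hg] with z h1 h2
  rw [Pi.zero_apply]
  rcases le_total (-(1 / lam) * (S.ℓ z * p z)) 0 with h3 | h3
  · rw [max_eq_left h3] at h1
    rw [h1, mul_zero, add_zero, sub_zero]
    refine mul_nonneg ?_ h2
    by_contra h4
    push Not at h4
    have : 0 < -(1 / lam) * (S.ℓ z * p z) :=
      mul_pos_of_neg_of_neg (by simpa using hlam) h4
    linarith
  · rw [max_eq_right h3] at h1
    have h4 : S.ℓ z * p z + lam * f z = 0 := by
      rw [h1]
      field_simp
      ring
    rw [h4, zero_mul]

theorem variationalInequality_iff_projectionFormula {lam : ℝ} (hlam : 0 < lam) {f p : L2 S.Q}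
    (hf : f ∈ S.admissible) :
    S.VariationalInequality lam f p ↔ S.ProjectionFormula lam f p := by
  refine ⟨fun h => ?_, S.variationalInequality_of_projectionFormula hlam⟩
  obtain ⟨M, hM⟩ : ∃ M : L2 S.Q →L[ℝ] L2 S.Q, ∀ f, ∀ᵐ z ∂(volume.restrict S.Q),
    M f z = S.ℓ z * f z := S.exists_multiplication
  -- The candidate given by the projection formula also solves the variational inequality, so it
  -- suffices to show that f equals it.
  let q : L2 S.Q := Lp.posPart (-(1 / lam) • M p)
  have hq : S.ProjectionFormula lam q p := by
    show ∀ᵐ z ∂(volume.restrict S.Q), q z = max 0 (-(1 / lam) * (S.ℓ z * p z))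
    filter_upwards [Lp.coeFn_posPart (-(1 / lam) • M p), Lp.coeFn_smul (-(1 / lam)) (M p), hM p]
      with z h1 h2 h3
    rw [h1, h2, Pi.smul_apply, h3, max_comm, smul_eq_mul]
  have hqa : q ∈ S.admissible := by
    show ∀ᵐ z ∂(volume.restrict S.Q), 0 ≤ q z
    filter_upwards [hq] with z hz
    rw [hz]
    exact le_max_left _ _
  have h1 := (S.variationalInequality_iff_inner hM lam f p).1 h q hqa
  have h2 := (S.variationalInequality_iff_inner hM lam q p).1
    (S.variationalInequality_of_projectionFormula hlam hq) f hf
  -- Each of the two inequalities is tested with the other solution; their sum leaves -λ‖q - f‖² ≥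
  -- 0.
  have h3 : ⟪M p + lam • f, q - f⟫ + ⟪M p + lam • q, f - q⟫ = -(lam * ‖q - f‖ ^ 2) := by
    have h4 : f - q = -(q - f) := by abel
    have h5 : (M p + lam • f) - (M p + lam • q) = -(lam • (q - f)) := by
      rw [smul_sub]
      abel
    rw [h4, inner_neg_right, ← sub_eq_add_neg, ← inner_sub_left, h5, inner_neg_left,
      real_inner_smul_left, real_inner_self_eq_norm_sq]
  have h6 : ‖q - f‖ ^ 2 ≤ 0 := by
    by_contra hneg
    push Not at hneg
    nlinarith
  have h7 : q = f := by
    refine sub_eq_zero.1 (norm_eq_zero.1 ?_)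
    exact pow_eq_zero_iff (two_ne_zero) |>.1 (le_antisymm h6 (sq_nonneg _))
  rwa [h7] at hq

theorem tikhonov_eq {zd : L2 S.ωT} {P : L2 (cylinder S.Ω S.T) →L[ℝ] L2 (cylinder S.Ω S.T)}
    {zt : L2 (cylinder S.Ω S.T)}
    (hP : ∀ f, ∀ᵐ z ∂(volume.restrict (cylinder S.Ω S.T)),
      (P f - zt) z = S.ωT.indicator (fun y => f y - zd y) z ∧
      P f z = S.ωT.indicator (fun y => f y) z) (lam : ℝ) (f : L2 (cylinder S.Ω S.T))
    (u : X (cylinder S.Ω S.T)) :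
    S.tikhonov zd lam f u =
      1 / 2 * ‖P (fnY u.toY) - zt‖ ^ 2 + lam / 2 * ‖f‖ ^ 2 := by
  have h1 : ‖P (fnY u.toY) - zt‖ ^ 2 = ∫ z in S.ωT, (fnY u.toY z - zd z) ^ 2 := by
    have h3 : ∀ g : SpaceTime d → ℝ, ∫ z in cylinder S.Ω S.T, S.ωT.indicator g z =
        ∫ z in S.ωT, g z := fun g => by
      rw [setIntegral_indicator S.measurableSet_ωT, inter_eq_right.2 S.ωT_subset]
    rw [norm_sq_eq_integral, ← h3]
    refine integral_congr_ae ?_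
    filter_upwards [hP (fnY u.toY)] with z hz
    rw [hz.1, Real.norm_eq_abs, sq_abs]
    by_cases hzω : z ∈ S.ωT <;> simp [hzω]
  have h2 : ‖f‖ ^ 2 = ∫ z in cylinder S.Ω S.T, f z ^ 2 := by
    rw [norm_sq_eq_integral]
    simp
  rw [h1, h2]
  rfl

/-- The residual vanishes outside the observation set, so restricting the second factor to it
changes nothing. The adjoint's right-hand side can thus be paired with a whole state. -/
theorem inner_observation {zd : L2 S.ωT} {P : L2 (cylinder S.Ω S.T) →L[ℝ] L2 (cylinder S.Ω S.T)}
    {zt : L2 (cylinder S.Ω S.T)}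
    (hP : ∀ f, ∀ᵐ z ∂(volume.restrict (cylinder S.Ω S.T)),
      (P f - zt) z = S.ωT.indicator (fun y => f y - zd y) z ∧
      P f z = S.ωT.indicator (fun y => f y) z) (f g : L2 (cylinder S.Ω S.T)) :
    ⟪P f - zt, P g⟫ = ⟪P f - zt, g⟫ := by
  rw [inner_L2, inner_L2]
  refine integral_congr_ae ?_
  filter_upwards [hP f, hP g] with z h1 h2
  rw [h1.1, h2.2]
  by_cases hzω : z ∈ S.ωT <;> simp [hzω]

end Setting

end

/-! ### Well-posedness and the reduced control problem -/

section

variable {d : ℕ} {Ω : Set (Space d)} {T : ℝ}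

/-- Well-posedness of the abstract evolution equation, in either direction of time. -/
theorem existsUnique_evolution (hΩ : IsOpen Ω) (hb : Bornology.IsBounded Ω) (hT : 0 < T)
    {σ t₀ t₁ : ℝ} (h : IsDirection T σ t₀ t₁)
    (B : Y (cylinder Ω T) →L[ℝ] Y (cylinder Ω T) →L[ℝ] ℝ) {c : ℝ} (hc : 0 < c)
    (hB : ∀ u, c * ‖u‖ ^ 2 ≤ B u u) (F : YDual (cylinder Ω T)) :
    ∃! u : X (cylinder Ω T), HasTimeTrace u t₀ 0 ∧ σ • u.dt + B u.toY = F := by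
  obtain ⟨x, hx, hxF⟩ := exists_startGraph_solution (hΩ := hΩ) hb h B hc hB F
  obtain ⟨u, hu, hu1, hu2⟩ := exists_X_of_mem_startGraph hb hT h hx
  have hu3 : σ • u.dt + B u.toY = F := by
    rw [hu2, hu1, smul_smul, h.mul_self, one_smul, hxF]
  exact ⟨u, ⟨hu, hu3⟩, fun w hw =>
    eq_of_evolution hΩ hb hT h B hc hB hw.1 hu (hw.2.trans hu3.symm)⟩

theorem apply_of_backward_equation {H : Type*} [NormedAddCommGroup H] [InnerProductSpace ℝ H]
    (B : H →L[ℝ] H →L[ℝ] ℝ) (ζ : H →L[ℝ] ℝ) (q y : H) {G : H →L[ℝ] ℝ}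
    (h : (-1 : ℝ) • ζ + B.flip q = G) : G y = -ζ y + B y q := by
  rw [← h]
  simp

/-- The solution operator of the forward equation, and its duality with the backward equation. -/
theorem exists_forward_operator (hΩ : IsOpen Ω) (hb : Bornology.IsBounded Ω) (hT : 0 < T)
    {B : Y (cylinder Ω T) →L[ℝ] Y (cylinder Ω T) →L[ℝ] ℝ}
    {c : ℝ} (hc : 0 < c) (hB : ∀ u, c * ‖u‖ ^ 2 ≤ B u u) :
    ∃ R : YDual (cylinder Ω T) →L[ℝ] Y (cylinder Ω T),
      (∀ F (u : X (cylinder Ω T)), HasTimeTrace u 0 0 →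
        (1 : ℝ) • u.dt + B u.toY = F → u.toY = R F) ∧
      ∀ F G (p : X (cylinder Ω T)), HasTimeTrace p T 0 →
        (-1 : ℝ) • p.dt + B.flip p.toY = G → F p.toY = G (R F) := by
  have fwd : IsDirection T 1 0 T := Or.inl ⟨rfl, rfl, rfl⟩
  have bwd : IsDirection T (-1) T 0 := Or.inr ⟨rfl, rfl, rfl⟩
  obtain ⟨R, hR⟩ := exists_solution_operator (startGraph hΩ T 1 0)
    (fun x hx => by
      have h1 := (isWeakStart_of_mem_startGraph fwd hx).nonneg hb fwd
      rwa [one_smul, one_mul] at h1) B hc hB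
    (fun F => exists_startGraph_solution hb fwd B hc hB F)
  refine ⟨R, fun F u hu huF => ?_, fun F G p hp hpG => ?_⟩
  · obtain ⟨w, hw, hw1, hw2⟩ := exists_X_of_mem_startGraph hb hT fwd (hR F)
    have h1 : u = w := by
      refine eq_of_evolution hΩ hb hT fwd B hc hB hu hw (huF.trans ?_)
      rw [hw1, hw2, one_smul, one_smul, sub_add_cancel]
    rw [h1, hw1]
  -- The backward solution vanishes weakly at T, so it pairs with the forward pair (R F, F - B(R F))
  -- by parts. The terms in B cancel against those of the backward equation.
  · have h1 := inner_of_mem_startGraph (hR F) (hp.isWeakStart hΩ hb hT bwd)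
    rw [sub_apply, one_mul] at h1
    rw [apply_of_backward_equation B p.dt p.toY (R F) hpG]
    linarith

namespace Setting

variable (S : Setting d)

theorem existsUnique_state (hd : 0 < d) (f : L2 S.Q) : ∃! u : X S.Q, S.IsState f u := by
  obtain ⟨B, ⟨c, hc, hB⟩, hB1, -⟩ := S.exists_form hd
  obtain ⟨M, hM⟩ := S.exists_multiplication
  refine (existsUnique_congr fun u => S.isState_iff hB1 hM f u).2 ?_
  exact existsUnique_evolution S.isOpen_domain S.isBounded S.T_pos
    (Or.inl ⟨rfl, rfl, rfl⟩) B hc hB _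

theorem existsUnique_adjoint (hd : 0 < d) (zd : L2 S.ωT) (u : X S.Q) :
    ∃! p : X S.Q, S.IsAdjoint zd u p := by
  obtain ⟨B, ⟨c, hc, hB⟩, -, hB2⟩ := S.exists_form hd
  obtain ⟨P, zt, hP⟩ := S.exists_observation zd
  refine (existsUnique_congr fun p => S.isAdjoint_iff hB2 hP u p).2 ?_
  -- Transposition leaves the diagonal of the form unchanged, hence also its coercivity.
  exact existsUnique_evolution S.isOpen_domain S.isBounded S.T_pos
    (Or.inr ⟨rfl, rfl, rfl⟩) B.flip hc (fun u => hB u) _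

theorem zero_mem_admissible : (0 : L2 S.Q) ∈ S.admissible := by
  show ∀ᵐ z ∂(volume.restrict S.Q), 0 ≤ (0 : L2 S.Q) z
  filter_upwards [Lp.coeFn_zero ℝ 2 (volume.restrict S.Q)] with z hz
  rw [hz, Pi.zero_apply]

/-- The Tikhonov functional of the states is a quadratic functional of the source, whose
derivative is given by the adjoint. -/
theorem exists_reduced_functional (hd : 0 < d) (zd : L2 S.ωT) :
    ∃ (C : L2 S.Q →L[ℝ] L2 S.Q) (zt : L2 S.Q),
      (∀ lam f u, S.IsState f u →
        S.tikhonov zd lam f u = 1 / 2 * ‖C f - zt‖ ^ 2 + lam / 2 * ‖f‖ ^ 2) ∧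
      ∀ lam f u p, S.IsState f u → S.IsAdjoint zd u p →
        (S.VariationalInequality lam f p.fn ↔
          ∀ g ∈ S.admissible, 0 ≤ ⟪C f - zt, C (g - f)⟫ + lam * ⟪f, g - f⟫) := by
  obtain ⟨B, ⟨c, hc, hB⟩, hB1, hB2⟩ := S.exists_form hd
  obtain ⟨M, hM⟩ := S.exists_multiplication
  obtain ⟨P, zt, hP⟩ := S.exists_observation zd
  obtain ⟨R, hR, hdual⟩ := exists_forward_operator S.isOpen_domain S.isBounded S.T_pos hc hB
  let A : L2 (cylinder S.Ω S.T) →L[ℝ] Y (cylinder S.Ω S.T) := R.comp ((toDualL _).comp M)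
  have hstate : ∀ (f : L2 (cylinder S.Ω S.T)) (u : X (cylinder S.Ω S.T)), S.IsState f u →
      u.toY = A f := fun f u hu =>
    hR _ u ((S.isState_iff hB1 hM f u).1 hu).1 ((S.isState_iff hB1 hM f u).1 hu).2
  let C : L2 (cylinder S.Ω S.T) →L[ℝ] L2 (cylinder S.Ω S.T) := P.comp ((fnL _).comp A)
  have hC : ∀ f, C f = P (fnY (A f)) := fun f => rfl
  have hderiv : ∀ (f h : L2 (cylinder S.Ω S.T)) (u p : X (cylinder S.Ω S.T)), S.IsState f u →
      S.IsAdjoint zd u p → ⟪M p.fn, h⟫ = ⟪C f - zt, C h⟫ := by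
    intro f h u p hu hp
    have hp' := (S.isAdjoint_iff hB2 hP u p).1 hp
    -- Duality with the source ℓh: its pairing with p equals the pairing of the residual with the
    -- state generated by h.
    have h1 : ⟪M h, fnY p.toY⟫ = ⟪P (fnY u.toY) - zt, fnY (A h)⟫ :=
      hdual (toDualL _ (M h)) _ p hp'.1 hp'.2
    rw [← S.inner_observation hP, hstate f u hu, ← hC, ← hC] at h1
    rw [← h1, S.inner_multiplication hM, S.inner_multiplication hM]
    refine integral_congr_ae (Eventually.of_forall fun z => ?_)
    show S.ℓ z * p.fn z * h z = S.ℓ z * h z * p.fn z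
    ring
  refine ⟨C, zt, fun lam f u hu => ?_, fun lam f u p hu hp => ?_⟩
  · refine (S.tikhonov_eq hP lam f u).trans ?_
    rw [hstate f u hu]
    rfl
  · refine (S.variationalInequality_iff_inner hM lam f p.fn).trans (forall₂_congr fun g _ => ?_)
    rw [inner_add_left, real_inner_smul_left]
    exact iff_of_eq (congrArg (fun r => 0 ≤ r + lam * ⟪f, g - f⟫) (hderiv f (g - f) u p hu hp))

end Setting

end

end InverseSource

end

theorem mainTheorem10 {d : ℕ} (hd : d = 1 ∨ d = 2) (S : InverseSource.Setting d)
    (zd : InverseSource.L2 S.ωT) (lam : ℝ) (hlam : 0 < lam) :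
    -- every source has exactly one state, and every state exactly one adjoint
    (∀ f : InverseSource.L2 S.Q, ∃! u : InverseSource.X S.Q, S.IsState f u) ∧
    (∀ u ∈ S.X₀, ∃! p : InverseSource.X S.Q, S.IsAdjoint zd u p) ∧
    -- the unique minimizer, with its state and adjoint, satisfies the optimality conditions
    (∃ (f : InverseSource.L2 S.Q) (u p : InverseSource.X S.Q),
      S.IsRegularizedSolution zd lam f ∧
      (∀ f' : InverseSource.L2 S.Q, S.IsRegularizedSolution zd lam f' → f' = f) ∧
      S.IsState f u ∧ S.IsAdjoint zd u p ∧
      S.VariationalInequality lam f p.fn ∧ S.ProjectionFormula lam f p.fn) ∧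
    -- the variational inequality is equivalent to the projection formula
    (∀ f ∈ S.admissible, ∀ p ∈ S.XT,
      S.VariationalInequality lam f p.fn ↔ S.ProjectionFormula lam f p.fn) := by
  have hd0 : 0 < d := by omega
  refine ⟨S.existsUnique_state hd0, fun u _ => S.existsUnique_adjoint hd0 zd u, ?_,
    fun f hf p _ => S.variationalInequality_iff_projectionFormula hlam hf⟩
  obtain ⟨C, zt, hJ, hVI⟩ := S.exists_reduced_functional hd0 zd
  obtain ⟨f, hf, hfg⟩ := InverseSource.exists_variational_inequality C zt hlam
    ⟨0, S.zero_mem_admissible⟩ S.isClosed_admissible S.convex_admissible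
  obtain ⟨u, hu, -⟩ := S.existsUnique_state hd0 f
  obtain ⟨p, hp, -⟩ := S.existsUnique_adjoint hd0 zd u
  have hineq : S.VariationalInequality lam f p.fn := (hVI lam f u p hu hp).2 hfg
  refine ⟨f, u, p, ⟨hf, u, hu, fun g hg w hw => ?_⟩, ?_, hu, hp, hineq,
    (S.variationalInequality_iff_projectionFormula hlam hf).1 hineq⟩
  · rw [hJ lam f u hu, hJ lam g w hw, InverseSource.quadratic_expansion C zt lam f g]
    have h1 : 0 ≤ 1 / 2 * ‖C (g - f)‖ ^ 2 + lam / 2 * ‖g - f‖ ^ 2 := by positivity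
    linarith [hfg g hg]
  -- Expanding at f, the value at f' exceeds that at f by at least (λ/2)‖f' - f‖², so a second
  -- minimizer must coincide with f.
  · rintro f' ⟨hf', u', hu', hmin⟩
    have h1 := hmin f hf u hu
    rw [hJ lam f u hu, hJ lam f' u' hu', InverseSource.quadratic_expansion C zt lam f f'] at h1
    have h2 := hfg f' hf'
    have h3 : 0 ≤ 1 / 2 * ‖C (f' - f)‖ ^ 2 := by positivity
    have h4 : lam / 2 * ‖f' - f‖ ^ 2 ≤ 0 := by linarith
    have h5 : ‖f' - f‖ ^ 2 ≤ 0 := nonpos_of_mul_nonpos_right h4 (by positivity)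
    exact sub_eq_zero.1 (norm_eq_zero.1 (pow_eq_zero_iff two_ne_zero |>.1
      (le_antisymm h5 (sq_nonneg _))))
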